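/- Everything is over $\mathbb C$; spaces, Lie superalgebras and modules are $\mathbb Z_2$-graded, submodules are graded, a simple module is a nonzero module without graded submodules other than $0$ and itself, isomorphisms are even, and $\Pi(N)$ denotes the module $N$ with its two parities exchanged and the same action. Let $\dot{\mathfrak g}$ be a finite-dimensional simple Lie algebra, and let $\mathcal A=\mathbb C[t^{\pm1}]\otimes\Lambda(\xi)$ with $t$ even and $\xi$ odd, $\xi^2=0$. Let $\overline{\mathfrak s}$ be the centreless $N=1$ Ramond algebra, with even basis elements $L_i$ and odd basis elements $G_i$ ($i\in\mathbb Z$) and $$[L_i,L_j]=(j-i)L_{i+j},\quad [L_i,G_j]=\left(j-\tfrac i2\right)G_{i+j},\quad [G_i,G_j]=-2L_{i+j}.$$ It acts on $\mathcal A$ by $L_i\cdot f=t^{i+1}\frac{\partial f}{\partial t}+\frac i2t^i\xi\frac{\partial f}{\partial\xi}$ and $G_i\cdot f=t^{i+1}\xi\frac{\partial f}{\partial t}-t^i\frac{\partial f}{\partial\xi}$, and it is an $\mathcal A$-module through $t^iL_n=L_{n+i}$, $t^iG_n=G_{n+i}$, $\xi L_n=\frac12G_n$, $\xi G_n=0$.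 Put $\mathfrak g=\overline{\mathfrak s}\ltimes(\dot{\mathfrak g}\otimes\mathcal A)$, where $[x\otimes f,y\otimes g]=[x,y]\otimes fg$ and $[a,x\otimes f]=x\otimes(a\cdot f)$ for $a\in\overline{\mathfrak s}$, and $\widetilde{\mathfrak g}=\mathfrak g\ltimes\mathcal A$, where $\mathcal A$ is abelian, $[a,f]=a\cdot f$ for $a\in\overline{\mathfrak s}$ and $[\dot{\mathfrak g}\otimes\mathcal A,\mathcal A]=0$. An $\mathcal A\mathfrak g$-module is a $\widetilde{\mathfrak g}$-module $M$ on which $\mathcal A$ acts associatively: $1v=v$ and $(fg)v=f(gv)$ for $f,g\in\mathcal A$, $v\in M$. It is cuspidal if $L_0$ acts diagonalizably on $M$ and the dimensions of the eigenspaces of $L_0$ are bounded by some $N\in\mathbb N$. Let $\mathfrak a_0=(t-1)\overline{\mathfrak s}\ltimes(\dot{\mathfrak g}\otimes\mathcal A)\subset\mathfrak g$, let $R=(t-1)\overline{\mathfrak s}/(t-1)^2\overline{\mathfrak s}$, and let $\mathfrak m=(t-1,\xi)\subset\mathcal A$. Then $\mathfrak a_0/\big((t-1)^2\overline{\mathfrak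 s}\ltimes(\dot{\mathfrak g}\otimes\mathfrak m)\big)=R\ltimes\dot{\mathfrak g}$, where $R$ acts trivially on $\dot{\mathfrak g}=\dot{\mathfrak g}\otimes(\mathcal A/\mathfrak m)$; every $R\ltimes\dot{\mathfrak g}$-module is thereby an $\mathfrak a_0$-module. For an $\mathfrak a_0$-module $V$ and $\lambda\in\mathbb C$, the tensor module $\Gamma(\lambda,V)$ is the $\mathcal A\mathfrak g$-module $\mathcal A\otimes V$ on which $\mathcal A$ acts by multiplication on the left factor and $$\begin{aligned} L_i(f\otimes v)&=t^if\otimes(L_i-L_0)v-(-1)^{|f|}\tfrac i2t^i\xi f\otimes(G_i-G_0)v+t^i\left(\lambda f+t\tfrac{\partial f}{\partial t}\right)\otimes v+\tfrac i2t^i\xi\tfrac{\partial f}{\partial\xi}\otimes v,\\ G_i(f\otimes v)&=(-1)^{|f|}t^if\otimes(G_i-G_0)v+2t^i\xi f\otimes(L_i-L_0)v+t^i\xi\left(\lambda f+t\tfrac{\partial f}{\partial t}\right)\otimes v-t^i\tfrac{\partial f}{\partial\xi}\otimes v,\\ (x\otimes t^i)(f\otimes v)&=t^if\otimes(x\otimes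 t^i)v-(-1)^{|f|}\,i\,t^i\xi f\otimes(x\otimes t^i\xi)v,\\ (x\otimes t^i\xi)(f\otimes v)&=t^i\xi f\otimes(x\otimes t^i)v+(-1)^{|f|}t^if\otimes(x\otimes t^i\xi)v \end{aligned}$$ for $i\in\mathbb Z$, $x\in\dot{\mathfrak g}$, $v\in V$ and homogeneous $f\in\mathcal A$. **Theorem.** Let $M$ be a simple cuspidal $\mathcal A\mathfrak g$-module. Then there are $\lambda\in\mathbb C$ and a finite-dimensional simple $R\ltimes\dot{\mathfrak g}$-module $V$ such that $M\cong\Gamma(\lambda,V)$ or $M\cong\Pi(\Gamma(\lambda,V))$ as $\widetilde{\mathfrak g}$-modules. -/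

import Mathlib

open scoped TensorProduct LaurentPolynomial DualNumber

universe v w

/-- A super vector space over `ℂ`: a space `V = V₀ ⊕ V₁` with a `ℤ/2`-gradation. -/
class SuperSpace (V : Type*) [AddCommGroup V] [Module ℂ V] where
  /-- `grade i` is the homogeneous part of parity `i`. -/
  grade : ZMod 2 → Submodule ℂ V
  isCompl : IsCompl (grade 0) (grade 1)

open SuperSpace (grade)

/-- The sign `(-1)^{ij}` for parities `i, j`. -/
def sgn (i j : ZMod 2) : ℂ := (-1) ^ (i.val * j.val)

@[simp] lemma sgn_zero_left (j : ZMod 2) : sgn 0 j = 1 := by simp [sgn]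
@[simp] lemma sgn_zero_right (i : ZMod 2) : sgn i 0 = 1 := by simp [sgn]
@[simp] lemma sgn_one_one : sgn 1 1 = -1 := by simp [sgn, ZMod.val_one]

lemma parity_cases (i : ZMod 2) : i = 0 ∨ i = 1 := by revert i; decide

@[simp] lemma parity_one_add_one : (1 : ZMod 2) + 1 = 0 := by decide

/-- A (not necessarily finite-dimensional) Lie superalgebra over `ℂ`. -/
class LieSuperalgebra (L : Type*) [AddCommGroup L] [Module ℂ L] [SuperSpace L] where
  /-- The super bracket. -/
  br : L →ₗ[ℂ] L →ₗ[ℂ] L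
  br_mem : ∀ {i j : ZMod 2} {x y : L}, x ∈ grade i → y ∈ grade j → br x y ∈ grade (i + j)
  br_skew : ∀ {i j : ZMod 2} {x y : L}, x ∈ grade i → y ∈ grade j →
    br x y = -(sgn i j • br y x)
  br_jacobi : ∀ {i j k : ZMod 2} {x y z : L}, x ∈ grade i → y ∈ grade j → z ∈ grade k →
    br x (br y z) = br (br x y) z + sgn i j • br y (br x z)

open LieSuperalgebra (br)

section SuperBasics

variable {V W : Type*} [AddCommGroup V] [Module ℂ V] [AddCommGroup W] [Module ℂ W]

/-- A subspace is graded when it is the sum of its homogeneous parts. -/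
def IsGraded [SuperSpace V] (S : Submodule ℂ V) : Prop :=
  S ≤ (S ⊓ grade 0) ⊔ (S ⊓ grade 1)

lemma isCompl_of_involution {E O : Submodule ℂ V} (h : E ⊔ O = ⊤) (τ : V →ₗ[ℂ] V)
    (hE : ∀ x ∈ E, τ x = x) (hO : ∀ x ∈ O, τ x = -x) : IsCompl E O := by
  refine ⟨?_, codisjoint_iff.2 h⟩
  rw [Submodule.disjoint_def]
  intro x hx hx'
  have h1 := hE x hx
  rw [hO x hx'] at h1
  have h2 : (2 : ℂ) • x = 0 := by rw [two_smul]; nth_rewrite 1 [← h1]; simp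
  exact (smul_eq_zero.1 h2).resolve_left two_ne_zero

/-- The projection of a super space to its part of parity `i`. -/
noncomputable def sproj [SuperSpace V] (i : ZMod 2) : V →ₗ[ℂ] V :=
  if i = 0 then (grade 0).projection (grade 1) SuperSpace.isCompl
  else (grade 1).projection (grade 0) SuperSpace.isCompl.symm

lemma sproj_mem [SuperSpace V] (i : ZMod 2) (x : V) : sproj i x ∈ grade i := by
  rcases parity_cases i with rfl | rfl
  · simp only [sproj, if_true]; exact Submodule.projection_apply_mem _ _
  · simp only [sproj, one_ne_zero, if_false]; exact Submodule.projection_apply_mem _ _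

lemma sproj_of_mem [SuperSpace V] {i : ZMod 2} {x : V} (hx : x ∈ grade i) (j : ZMod 2) :
    sproj j x = if j = i then x else 0 := by
  rcases parity_cases i with rfl | rfl <;> rcases parity_cases j with rfl | rfl <;>
    simp [sproj, hx]

/-- The parity automorphism `x ↦ (-1)^{|x|} x`. -/
noncomputable def parityAut [SuperSpace V] : V →ₗ[ℂ] V := sproj 0 - sproj 1

lemma parityAut_even [SuperSpace V] {x : V} (hx : x ∈ grade 0) : parityAut x = x := by
  simp [parityAut, sproj_of_mem hx]

lemma parityAut_odd [SuperSpace V] {x : V} (hx : x ∈ grade 1) : parityAut x = -x := by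
  simp [parityAut, sproj_of_mem hx]

lemma grade_induction [SuperSpace V] {p : V → Prop} (h0 : ∀ x ∈ grade 0, p x)
    (h1 : ∀ x ∈ grade 1, p x) (hadd : ∀ x y, p x → p y → p (x + y)) (x : V) : p x := by
  have hx : x ∈ (grade 0 : Submodule ℂ V) ⊔ grade 1 := by
    rw [SuperSpace.isCompl.sup_eq_top]; trivial
  obtain ⟨a, ha, b, hb, rfl⟩ := Submodule.mem_sup.1 hx
  exact hadd a b (h0 a ha) (h1 b hb)

/-- The direct sum of two super spaces. -/
instance [SuperSpace V] [SuperSpace W] : SuperSpace (V × W) where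
  grade i := (grade i).prod (grade i)
  isCompl := by
    constructor
    · rw [disjoint_iff, Submodule.prod_inf_prod, (SuperSpace.isCompl (V := V)).inf_eq_bot,
        (SuperSpace.isCompl (V := W)).inf_eq_bot, Submodule.prod_bot]
    · rw [codisjoint_iff, Submodule.prod_sup_prod, (SuperSpace.isCompl (V := V)).sup_eq_top,
        (SuperSpace.isCompl (V := W)).sup_eq_top, Submodule.prod_top]

/-- The tensor product of super spaces; `v ⊗ w` has parity `|v| + |w|`. -/
noncomputable instance [SuperSpace V] [SuperSpace W] : SuperSpace (V ⊗[ℂ] W) where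
  grade k := Submodule.span ℂ
    {z | ∃ i j : ZMod 2, i + j = k ∧ ∃ v ∈ grade (V := V) i, ∃ w ∈ grade (V := W) j,
      z = v ⊗ₜ[ℂ] w}
  isCompl := by
    refine isCompl_of_involution ?_ (TensorProduct.map parityAut parityAut) ?_ ?_
    · rw [← Submodule.span_union, eq_top_iff, ← TensorProduct.span_tmul_eq_top,
        Submodule.span_le]
      rintro _ ⟨v, w, rfl⟩
      refine grade_induction (V := V) (p := fun v => v ⊗ₜ[ℂ] w ∈ _) ?_ ?_ ?_ v
      · intro v hv
        refine grade_induction (V := W) (p := fun w => v ⊗ₜ[ℂ] w ∈ _) ?_ ?_ ?_ w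
        · exact fun w hw => Submodule.subset_span (Or.inl ⟨0, 0, by decide, v, hv, w, hw, rfl⟩)
        · exact fun w hw => Submodule.subset_span (Or.inr ⟨0, 1, by decide, v, hv, w, hw, rfl⟩)
        · intro x y hx hy
          rw [TensorProduct.tmul_add]; exact Submodule.add_mem _ hx hy
      · intro v hv
        refine grade_induction (V := W) (p := fun w => v ⊗ₜ[ℂ] w ∈ _) ?_ ?_ ?_ w
        · exact fun w hw => Submodule.subset_span (Or.inr ⟨1, 0, by decide, v, hv, w, hw, rfl⟩)
        · exact fun w hw => Submodule.subset_span (Or.inl ⟨1, 1, by decide, v, hv, w, hw, rfl⟩)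
        · intro x y hx hy
          rw [TensorProduct.tmul_add]; exact Submodule.add_mem _ hx hy
      · intro x y hx hy
        rw [TensorProduct.add_tmul]; exact Submodule.add_mem _ hx hy
    · intro x hx
      induction hx using Submodule.span_induction with
      | mem z hz =>
        obtain ⟨i, j, hij, v, hv, w, hw, rfl⟩ := hz
        rcases parity_cases i with rfl | rfl <;> rcases parity_cases j with rfl | rfl
        · simp [parityAut_even hv, parityAut_even hw]
        · simp at hij
        · simp at hij
        · simp [parityAut_odd hv, parityAut_odd hw, TensorProduct.neg_tmul, TensorProduct.tmul_neg]
      | zero => simp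
      | add a b _ _ ha hb => rw [map_add, ha, hb]
      | smul c a _ ha => rw [map_smul, ha]
    · intro x hx
      induction hx using Submodule.span_induction with
      | mem z hz =>
        obtain ⟨i, j, hij, v, hv, w, hw, rfl⟩ := hz
        rcases parity_cases i with rfl | rfl <;> rcases parity_cases j with rfl | rfl
        · simp at hij
        · simp [parityAut_even hv, parityAut_odd hw, TensorProduct.tmul_neg]
        · simp [parityAut_odd hv, parityAut_even hw, TensorProduct.neg_tmul]
        · simp at hij
      | zero => simp
      | add a b _ _ ha hb => rw [map_add, ha, hb, neg_add]
      | smul c a _ ha => rw [map_smul, ha, smul_neg]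

lemma tmul_mem_grade [SuperSpace V] [SuperSpace W] {i j : ZMod 2} {v : V} {w : W}
    (hv : v ∈ grade i) (hw : w ∈ grade j) : v ⊗ₜ[ℂ] w ∈ grade (i + j) :=
  Submodule.subset_span ⟨i, j, rfl, v, hv, w, hw, rfl⟩

end SuperBasics

section SubQuotient

variable {L : Type*} [AddCommGroup L] [Module ℂ L] [SuperSpace L] [LieSuperalgebra L]

variable (L) in
/-- A (graded) Lie super subalgebra. -/
structure LieSuperSubalgebra extends Submodule ℂ L where
  graded : IsGraded toSubmodule
  br_closed : ∀ {x y : L}, x ∈ toSubmodule → y ∈ toSubmodule → br x y ∈ toSubmodule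

variable (L) in
/-- A (graded) ideal. -/
structure LieSuperIdeal extends Submodule ℂ L where
  graded : IsGraded toSubmodule
  br_left : ∀ (x : L) {y : L}, y ∈ toSubmodule → br x y ∈ toSubmodule
  br_right : ∀ {x : L} (y : L), x ∈ toSubmodule → br x y ∈ toSubmodule

instance (S : LieSuperSubalgebra L) : SuperSpace S.toSubmodule where
  grade i := (grade i).comap S.toSubmodule.subtype
  isCompl := by
    constructor
    · rw [Submodule.disjoint_def]
      intro x h0 h1
      exact Subtype.ext
        (Submodule.disjoint_def.1 (SuperSpace.isCompl (V := L)).disjoint x.1 h0 h1)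
    · rw [codisjoint_iff, eq_top_iff]
      rintro ⟨x, hx⟩ -
      obtain ⟨a, ha, b, hb, hab⟩ := Submodule.mem_sup.1 (S.graded hx)
      refine Submodule.mem_sup.2 ⟨⟨a, ha.1⟩, ha.2, ⟨b, hb.1⟩, hb.2, Subtype.ext hab⟩

instance (S : LieSuperSubalgebra L) : LieSuperalgebra S.toSubmodule where
  br := LinearMap.mk₂ ℂ (fun x y => ⟨br x.1 y.1, S.br_closed x.2 y.2⟩)
    (fun x x' y => Subtype.ext (by simp)) (fun c x y => Subtype.ext (by simp))
    (fun x y y' => Subtype.ext (by simp)) (fun c x y => Subtype.ext (by simp))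
  br_mem hx hy := LieSuperalgebra.br_mem (L := L) hx hy
  br_skew hx hy := Subtype.ext (LieSuperalgebra.br_skew (L := L) hx hy)
  br_jacobi hx hy hz := Subtype.ext (LieSuperalgebra.br_jacobi (L := L) hx hy hz)

instance (I : LieSuperIdeal L) : SuperSpace (L ⧸ I.toSubmodule) where
  grade i := (grade i).map I.toSubmodule.mkQ
  isCompl := by
    constructor
    · rw [Submodule.disjoint_def]
      rintro _ ⟨a, ha, rfl⟩ ⟨b, hb, hab⟩
      have h : a - b ∈ I.toSubmodule :=
        (Submodule.Quotient.eq _).1 (show I.toSubmodule.mkQ a = I.toSubmodule.mkQ b from hab.symm)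
      obtain ⟨c, hc, d, hd, hcd⟩ := Submodule.mem_sup.1 (I.graded h)
      have e : a - c = b + d := by
        have : a = b + (c + d) := by rw [hcd]; abel
        rw [this]; abel
      have : a - c = 0 := Submodule.disjoint_def.1 (SuperSpace.isCompl (V := L)).disjoint _
        (Submodule.sub_mem _ ha hc.2) (e ▸ Submodule.add_mem _ hb hd.2)
      rw [sub_eq_zero.1 this]
      exact (Submodule.Quotient.mk_eq_zero _).2 hc.1
    · rw [codisjoint_iff, ← Submodule.map_sup, (SuperSpace.isCompl (V := L)).sup_eq_top,
        Submodule.map_top, Submodule.range_mkQ]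

instance (I : LieSuperIdeal L) : LieSuperalgebra (L ⧸ I.toSubmodule) where
  br := I.toSubmodule.liftQ
    { toFun := fun x => I.toSubmodule.mapQ I.toSubmodule (br x) (fun _ hy => I.br_left x hy)
      map_add' := fun x y => by ext; simp
      map_smul' := fun c x => by ext; simp }
    (fun x hx => by
      ext y
      exact (Submodule.Quotient.mk_eq_zero _).2 (I.br_right y hx))
  br_mem := by
    rintro i j _ _ ⟨a, ha, rfl⟩ ⟨b, hb, rfl⟩
    exact ⟨br a b, LieSuperalgebra.br_mem ha hb, rfl⟩
  br_skew := by
    rintro i j _ _ ⟨a, ha, rfl⟩ ⟨b, hb, rfl⟩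
    exact congrArg I.toSubmodule.mkQ (LieSuperalgebra.br_skew ha hb)
  br_jacobi := by
    rintro i j k _ _ _ ⟨a, ha, rfl⟩ ⟨b, hb, rfl⟩ ⟨c, hc, rfl⟩
    exact congrArg I.toSubmodule.mkQ (LieSuperalgebra.br_jacobi ha hb hc)

end SubQuotient

section Semidirect

variable (K I : Type*) [AddCommGroup K] [Module ℂ K] [SuperSpace K] [LieSuperalgebra K]
  [AddCommGroup I] [Module ℂ I] [SuperSpace I] [LieSuperalgebra I]

/-- An even action of the Lie superalgebra `K` on the Lie superalgebra `I` by superderivations. -/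
structure DerivationAction where
  toLin : K →ₗ[ℂ] I →ₗ[ℂ] I
  mem : ∀ {i j : ZMod 2} {a : K} {x : I}, a ∈ grade i → x ∈ grade j → toLin a x ∈ grade (i + j)
  hom : ∀ {i j : ZMod 2} {a b : K}, a ∈ grade i → b ∈ grade j → ∀ x : I,
    toLin (br a b) x = toLin a (toLin b x) - sgn i j • toLin b (toLin a x)
  deriv : ∀ {i j : ZMod 2} {a : K} {x : I}, a ∈ grade i → x ∈ grade j → ∀ y : I,
    toLin a (br x y) = br (toLin a x) y + sgn i j • br x (toLin a y)

variable {K I}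

/-- The underlying space `K ⊕ I` of the semidirect product `K ⋉ I`. -/
def Semidirect (_δ : DerivationAction K I) : Type _ := K × I

variable (δ : DerivationAction K I)

instance : AddCommGroup (Semidirect δ) := inferInstanceAs (AddCommGroup (K × I))
instance : Module ℂ (Semidirect δ) := inferInstanceAs (Module ℂ (K × I))
instance : SuperSpace (Semidirect δ) := inferInstanceAs (SuperSpace (K × I))

/-- The bilinear map that is `(b, x) ↦ (-1)^{|b||x|} δ b x` on homogeneous elements. -/
noncomputable def DerivationAction.twist : K →ₗ[ℂ] I →ₗ[ℂ] I :=
  δ.toLin ∘ₗ sproj 0 + (δ.toLin ∘ₗ sproj 1).compl₂ parityAut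

lemma DerivationAction.twist_apply {i j : ZMod 2} {b : K} {x : I} (hb : b ∈ grade i)
    (hx : x ∈ grade j) : δ.twist b x = sgn i j • δ.toLin b x := by
  rcases parity_cases i with rfl | rfl <;> rcases parity_cases j with rfl | rfl <;>
    simp [twist, sproj_of_mem hb, parityAut, sproj_of_mem hx]

/-- The bracket of `K ⋉ I`:
`[(a, x), (b, y)] = ([a, b], δ a y - (-1)^{|b||x|} δ b x + [x, y])`. -/
noncomputable def Semidirect.brAux : (K × I) →ₗ[ℂ] (K × I) →ₗ[ℂ] (K × I) :=
  LinearMap.mk₂ ℂ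
    (fun p q => (br p.1 q.1, δ.toLin p.1 q.2 - δ.twist q.1 p.2 + br p.2 q.2))
    (fun p p' q => by ext <;> simp; abel)
    (fun c p q => by ext <;> simp [smul_sub])
    (fun p q q' => by ext <;> simp; abel)
    (fun c p q => by ext <;> simp [smul_sub])

lemma Semidirect.brAux_apply {i j : ZMod 2} {p q : K × I} (hp : p ∈ grade i) (hq : q ∈ grade j) :
    Semidirect.brAux δ p q =
      (br p.1 q.1, δ.toLin p.1 q.2 - sgn i j • δ.toLin q.1 p.2 + br p.2 q.2) := by
  simp only [brAux, LinearMap.mk₂_apply]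
  rw [δ.twist_apply hq.1 hp.2, show sgn j i = sgn i j by simp [sgn, mul_comm]]

lemma Semidirect.brAux_mem {i j : ZMod 2} {p q : K × I} (hp : p ∈ grade i) (hq : q ∈ grade j) :
    Semidirect.brAux δ p q ∈ grade (V := K × I) (i + j) := by
  rw [Semidirect.brAux_apply δ hp hq]
  refine ⟨LieSuperalgebra.br_mem hp.1 hq.1, ?_⟩
  refine Submodule.add_mem _ (Submodule.sub_mem _ (δ.mem hp.1 hq.2) (Submodule.smul_mem _ _ ?_))
    (LieSuperalgebra.br_mem hp.2 hq.2)
  rw [add_comm]; exact δ.mem hq.1 hp.2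

lemma Semidirect.brAux_skew {i j : ZMod 2} {p q : K × I} (hp : p ∈ grade i) (hq : q ∈ grade j) :
    Semidirect.brAux δ p q = -(sgn i j • Semidirect.brAux δ q p) := by
  rw [Semidirect.brAux_apply δ hp hq, Semidirect.brAux_apply δ hq hp]
  have h1 := LieSuperalgebra.br_skew hp.1 hq.1
  have h2 := LieSuperalgebra.br_skew hp.2 hq.2
  refine Prod.ext h1 ?_
  change _ = -(sgn i j • (_ - _ + _))
  dsimp only
  rw [h2]
  rcases parity_cases i with rfl | rfl <;> rcases parity_cases j with rfl | rfl <;>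
    simp only [sgn_zero_left, sgn_zero_right, sgn_one_one] <;> module

lemma Semidirect.brAux_jacobi {i j k : ZMod 2} {p q r : K × I} (hp : p ∈ grade i)
    (hq : q ∈ grade j) (hr : r ∈ grade k) :
    Semidirect.brAux δ p (Semidirect.brAux δ q r) =
      Semidirect.brAux δ (Semidirect.brAux δ p q) r +
        sgn i j • Semidirect.brAux δ q (Semidirect.brAux δ p r) := by
  rw [Semidirect.brAux_apply δ hp (Semidirect.brAux_mem δ hq hr),
    Semidirect.brAux_apply δ hq (Semidirect.brAux_mem δ hp hr),
    Semidirect.brAux_apply δ (Semidirect.brAux_mem δ hp hq) hr,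
    Semidirect.brAux_apply δ hq hr, Semidirect.brAux_apply δ hp hr,
    Semidirect.brAux_apply δ hp hq]
  have h1 := LieSuperalgebra.br_jacobi hp.1 hq.1 hr.1
  have h2 := LieSuperalgebra.br_jacobi hp.2 hq.2 hr.2
  refine Prod.ext h1 ?_
  change _ = _ + sgn i j • _
  dsimp only
  simp only [map_add, map_sub, map_smul, LinearMap.add_apply, LinearMap.sub_apply,
    LinearMap.smul_apply]
  rw [δ.hom hp.1 hq.1, δ.hom hq.1 hr.1, δ.hom hp.1 hr.1, δ.deriv hp.1 hq.2,
    δ.deriv hq.1 hp.2, δ.deriv hr.1 hp.2, h2, LieSuperalgebra.br_skew hq.2 (δ.mem hr.1 hp.2)]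
  rcases parity_cases i with rfl | rfl <;> rcases parity_cases j with rfl | rfl <;>
    rcases parity_cases k with rfl | rfl <;>
    simp only [sgn_zero_left, sgn_zero_right, sgn_one_one, add_zero, zero_add,
      parity_one_add_one] <;> module

noncomputable instance : LieSuperalgebra (Semidirect δ) where
  br := Semidirect.brAux δ
  br_mem := Semidirect.brAux_mem δ
  br_skew := Semidirect.brAux_skew δ
  br_jacobi := Semidirect.brAux_jacobi δ

end Semidirect

section Modules

variable (L : Type v) [AddCommGroup L] [Module ℂ L] [SuperSpace L] [LieSuperalgebra L]

/-- A (`ℤ/2`-graded) module over a Lie superalgebra. -/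
structure LieSuperModule where
  carrier : Type w
  [addCommGroup : AddCommGroup carrier]
  [module : Module ℂ carrier]
  [superSpace : SuperSpace carrier]
  /-- The action `act x v = x · v`. -/
  act : L →ₗ[ℂ] carrier →ₗ[ℂ] carrier
  act_mem : ∀ {i j : ZMod 2} {x : L} {v : carrier}, x ∈ grade i → v ∈ grade j →
    act x v ∈ grade (i + j)
  act_br : ∀ {i j : ZMod 2} {x y : L}, x ∈ grade i → y ∈ grade j → ∀ v : carrier,
    act (br x y) v = act x (act y v) - sgn i j • act y (act x v)

/-- An even homomorphism of Lie superalgebras. -/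
structure LieSuperHom (L' : Type*) [AddCommGroup L'] [Module ℂ L'] [SuperSpace L']
    [LieSuperalgebra L'] where
  toLin : L →ₗ[ℂ] L'
  mem : ∀ {i : ZMod 2} {x : L}, x ∈ grade i → toLin x ∈ grade i
  map_br : ∀ x y : L, toLin (br x y) = br (toLin x) (toLin y)

attribute [instance] LieSuperModule.addCommGroup LieSuperModule.module LieSuperModule.superSpace

namespace LieSuperModule

variable {L} (M N : LieSuperModule.{v, w} L)

/-- Simplicity: `M ≠ 0` and the only graded submodules are `0` and `M`. -/
def IsSimple : Prop :=
  Nontrivial M.carrier ∧ ∀ W : Submodule ℂ M.carrier, IsGraded W →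
    (∀ x : L, ∀ v ∈ W, M.act x v ∈ W) → W = ⊥ ∨ W = ⊤

/-- The restriction of a module along a homomorphism. -/
def pullback {L' : Type*} [AddCommGroup L'] [Module ℂ L'] [SuperSpace L'] [LieSuperalgebra L']
    (φ : LieSuperHom L' L) : LieSuperModule L' where
  carrier := M.carrier
  act := M.act ∘ₗ φ.toLin
  act_mem hx hv := M.act_mem (φ.mem hx) hv
  act_br := by
    intro i j x y hx hy v
    simp only [LinearMap.comp_apply, φ.map_br]
    exact M.act_br (φ.mem hx) (φ.mem hy) v

end LieSuperModule

end Modules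

noncomputable section

namespace Ramond

/-- The Laurent polynomial algebra `ℂ[t, t⁻¹]`; `LaurentPolynomial.T i` is `t ^ i`. -/
abbrev P : Type := LaurentPolynomial ℂ

section Laurent

variable {W : Type*} [AddCommMonoid W] [Module ℂ W]

/-- The linear map `ℂ[t, t⁻¹] → W` with prescribed values on the basis `t ^ i`. -/
def onT (φ : ℤ → W) : P →ₗ[ℂ] W :=
  Finsupp.linearCombination ℂ φ ∘ₗ (AddMonoidAlgebra.coeffLinearEquiv ℂ).toLinearMap

@[simp] lemma onT_T (φ : ℤ → W) (i : ℤ) : onT φ (LaurentPolynomial.T i) = φ i := by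
  simp only [onT, LinearMap.comp_apply]
  exact (Finsupp.linearCombination_single ℂ (1 : ℂ) i).trans (one_smul _ _)

lemma P_ext {f g : P →ₗ[ℂ] W}
    (h : ∀ i : ℤ, f (LaurentPolynomial.T i) = g (LaurentPolynomial.T i)) : f = g := by
  ext i
  exact h i

/-- The derivation `t d/dt` of `ℂ[t, t⁻¹]`. -/
def D : P →ₗ[ℂ] P := onT fun i => (i : ℂ) • LaurentPolynomial.T i

lemma D_T (i : ℤ) : D (LaurentPolynomial.T i) = (i : ℂ) • LaurentPolynomial.T i := onT_T _ i

lemma D_mul (f g : P) : D (f * g) = D f * g + f * D g := by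
  have h : (LinearMap.mul ℂ P).compr₂ D =
      (LinearMap.mul ℂ P) ∘ₗ D + (LinearMap.mul ℂ P).compl₂ D := by
    refine P_ext fun i => P_ext fun j => ?_
    simp only [LinearMap.compr₂_apply, LinearMap.mul_apply', LinearMap.add_apply,
      LinearMap.comp_apply, LinearMap.compl₂_apply, ← LaurentPolynomial.T_add, D_T]
    simp only [smul_mul_assoc, mul_smul_comm, ← LaurentPolynomial.T_add, ← add_smul]
    push_cast; rfl
  exact LinearMap.congr_fun₂ h f g

end Laurent

/-! ### The superalgebra `𝒜` -/

/-- `𝒜 = ℂ[t, t⁻¹] ⊗ Λ(ξ)`: the elements `f₀ + f₁ ξ` with `ξ² = 0`. As a product of two odd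
elements vanishes, `𝒜` is commutative in the ordinary sense as well. -/
abbrev A : Type := DualNumber P

/-- `f ∈ ℂ[t, t⁻¹]` as an even element of `𝒜`. -/
def ev : P →ₗ[ℂ] A where
  toFun f := TrivSqZeroExt.inl f
  map_add' _ _ := TrivSqZeroExt.inl_add _ _ _
  map_smul' _ _ := TrivSqZeroExt.inl_smul _ _ _

/-- `f ξ` for `f ∈ ℂ[t, t⁻¹]`. -/
def od : P →ₗ[ℂ] A where
  toFun f := TrivSqZeroExt.inr f
  map_add' _ _ := TrivSqZeroExt.inr_add _ _ _
  map_smul' _ _ := TrivSqZeroExt.inr_smul _ _ _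

/-- The coefficient `f₀` of `f₀ + f₁ ξ`. -/
def coeff0 : A →ₗ[ℂ] P where
  toFun f := f.fst
  map_add' _ _ := rfl
  map_smul' _ _ := rfl

/-- The coefficient `f₁` of `f₀ + f₁ ξ`. -/
def coeff1 : A →ₗ[ℂ] P where
  toFun f := f.snd
  map_add' _ _ := rfl
  map_smul' _ _ := rfl

@[simp] lemma coeff0_ev (f : P) : coeff0 (ev f) = f := rfl
@[simp] lemma coeff1_ev (f : P) : coeff1 (ev f) = 0 := rfl
@[simp] lemma coeff0_od (f : P) : coeff0 (od f) = 0 := rfl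
@[simp] lemma coeff1_od (f : P) : coeff1 (od f) = f := rfl
@[simp] lemma coeff0_mul (f g : A) : coeff0 (f * g) = coeff0 f * coeff0 g := rfl
@[simp] lemma coeff1_mul (f g : A) :
    coeff1 (f * g) = coeff0 f * coeff1 g + coeff1 f * coeff0 g := by
  change (f * g).snd = f.fst * g.snd + f.snd * g.fst
  rw [TrivSqZeroExt.snd_mul]; rfl
@[simp] lemma coeff0_one : coeff0 1 = 1 := rfl
@[simp] lemma coeff1_one : coeff1 1 = 0 := rfl

lemma A_ext {f g : A} (h0 : coeff0 f = coeff0 g) (h1 : coeff1 f = coeff1 g) : f = g :=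
  TrivSqZeroExt.ext h0 h1

/-- Even part `ℂ[t, t⁻¹]`, odd part `ℂ[t, t⁻¹] ξ`. -/
instance : SuperSpace A where
  grade i := if i = 0 then LinearMap.ker coeff1 else LinearMap.ker coeff0
  isCompl := by
    simp only [if_true, one_ne_zero, if_false]
    constructor
    · rw [Submodule.disjoint_def]
      intro x h1 h0
      exact A_ext (LinearMap.mem_ker.1 h0) (LinearMap.mem_ker.1 h1)
    · rw [codisjoint_iff, eq_top_iff]
      intro x _
      refine Submodule.mem_sup.2 ⟨ev (coeff0 x), by simp, od (coeff1 x), by simp, ?_⟩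
      apply A_ext <;> simp

lemma mem_A0 {f : A} : f ∈ grade 0 ↔ coeff1 f = 0 := Iff.rfl
lemma mem_A1 {f : A} : f ∈ grade 1 ↔ coeff0 f = 0 := Iff.rfl

/-- `𝒜` regarded as an abelian Lie superalgebra. -/
instance : LieSuperalgebra A where
  br := 0
  br_mem _ _ := Submodule.zero_mem _
  br_skew _ _ := by simp
  br_jacobi _ _ _ := by simp

/-- `t ∂/∂t` on `𝒜`. -/
def tdt : A →ₗ[ℂ] A := ev ∘ₗ D ∘ₗ coeff0 + od ∘ₗ D ∘ₗ coeff1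

/-- `∂/∂ξ` on `𝒜`. -/
def dxi : A →ₗ[ℂ] A := ev ∘ₗ coeff1

@[simp] lemma coeff0_tdt (f : A) : coeff0 (tdt f) = D (coeff0 f) := by simp [tdt]
@[simp] lemma coeff1_tdt (f : A) : coeff1 (tdt f) = D (coeff1 f) := by simp [tdt]
@[simp] lemma coeff0_dxi (f : A) : coeff0 (dxi f) = coeff1 f := by simp [dxi]
@[simp] lemma coeff1_dxi (f : A) : coeff1 (dxi f) = 0 := by simp [dxi]

/-! ### The centreless `N = 1` Ramond algebra -/

/-- The centreless Ramond algebra `𝔰̄`. The element `(f, g)` stands for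
`∑ fᵢ Lᵢ + ∑ gᵢ Gᵢ`, where `f = ∑ fᵢ tⁱ` and `g = ∑ gᵢ tⁱ`. -/
def SBar : Type := P × P

instance : AddCommGroup SBar := inferInstanceAs (AddCommGroup (P × P))
instance : Module ℂ SBar := inferInstanceAs (Module ℂ (P × P))

/-- The coefficients of the `Lᵢ`. -/
def sL : SBar →ₗ[ℂ] P := LinearMap.fst ℂ P P

/-- The coefficients of the `Gᵢ`. -/
def sG : SBar →ₗ[ℂ] P := LinearMap.snd ℂ P P

/-- `elt f g = ∑ fᵢ Lᵢ + ∑ gᵢ Gᵢ`. -/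
def elt (f g : P) : SBar := (f, g)

@[simp] lemma sL_elt (f g : P) : sL (elt f g) = f := rfl
@[simp] lemma sG_elt (f g : P) : sG (elt f g) = g := rfl

lemma SBar_ext {a b : SBar} (h0 : sL a = sL b) (h1 : sG a = sG b) : a = b := Prod.ext h0 h1

/-- The basis element `Lᵢ`. -/
def L (i : ℤ) : SBar := elt (LaurentPolynomial.T i) 0

/-- The basis element `Gᵢ`. -/
def G (i : ℤ) : SBar := elt 0 (LaurentPolynomial.T i)

instance : SuperSpace SBar where
  grade i := if i = 0 then LinearMap.ker sG else LinearMap.ker sL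
  isCompl := by
    simp only [if_true, one_ne_zero, if_false]
    constructor
    · rw [Submodule.disjoint_def]
      intro x h1 h0
      exact SBar_ext (LinearMap.mem_ker.1 h0) (LinearMap.mem_ker.1 h1)
    · rw [codisjoint_iff, eq_top_iff]
      intro x _
      refine Submodule.mem_sup.2 ⟨elt (sL x) 0, by simp, elt 0 (sG x), by simp, ?_⟩
      apply SBar_ext <;> simp

lemma mem_S0 {a : SBar} : a ∈ grade 0 ↔ sG a = 0 := Iff.rfl
lemma mem_S1 {a : SBar} : a ∈ grade 1 ↔ sL a = 0 := Iff.rfl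

/-- The bracket of `∑ fᵢ Lᵢ + ∑ gᵢ Gᵢ` and `∑ f'ᵢ Lᵢ + ∑ g'ᵢ Gᵢ` in terms of `(f, g)` and
`(f', g')` and of the derivation `D = t d/dt`. -/
def bracketFormula {R : Type*} [CommRing R] [Algebra ℂ R] (D : R →ₗ[ℂ] R) (a b : R × R) :
    R × R :=
  (a.1 * D b.1 - b.1 * D a.1 - (2 : ℂ) • (a.2 * b.2),
    a.1 * D b.2 - (1 / 2 : ℂ) • (D a.1 * b.2) - (b.1 * D a.2 - (1 / 2 : ℂ) • (D b.1 * a.2)))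

lemma bracketFormula_jacobi {R : Type*} [CommRing R] [Algebra ℂ R] (D : R →ₗ[ℂ] R)
    (h : ∀ f g, D (f * g) = D f * g + f * D g) (i j k : ZMod 2) (a b c : R × R)
    (ha : (if i = 0 then a.2 else a.1) = 0)
    (hb : (if j = 0 then b.2 else b.1) = 0)
    (hc : (if k = 0 then c.2 else c.1) = 0) :
    bracketFormula D a (bracketFormula D b c) =
      bracketFormula D (bracketFormula D a b) c +
        sgn i j • bracketFormula D b (bracketFormula D a c) := by
  obtain ⟨a0, a1⟩ := a
  obtain ⟨b0, b1⟩ := b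
  obtain ⟨c0, c1⟩ := c
  have h2 : (algebraMap ℂ R 2⁻¹) * 2 = 1 := by
    rw [← map_ofNat (algebraMap ℂ R) 2, ← map_mul]; simp
  rcases parity_cases i with rfl | rfl <;> rcases parity_cases j with rfl | rfl <;>
    rcases parity_cases k with rfl | rfl <;>
    simp only [if_true, one_ne_zero, if_false] at ha hb hc <;> subst ha hb hc <;>
    apply Prod.ext <;> simp [bracketFormula, h, mul_add, mul_sub] <;>
    (try simp only [Algebra.smul_def, map_ofNat]) <;>
    generalize (algebraMap ℂ R 2⁻¹) = u at h2 <;> grind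

/-- The bracket of `𝔰̄`, determined by `[Lᵢ, Lⱼ] = (j - i) Lᵢ₊ⱼ`,
`[Lᵢ, Gⱼ] = (j - i/2) Gᵢ₊ⱼ`, `[Gᵢ, Gⱼ] = -2 Lᵢ₊ⱼ`. -/
def sBr : SBar →ₗ[ℂ] SBar →ₗ[ℂ] SBar :=
  LinearMap.mk₂ ℂ
    (fun a b => elt (bracketFormula D (sL a, sG a) (sL b, sG b)).1
      (bracketFormula D (sL a, sG a) (sL b, sG b)).2)
    (fun a a' b => by
      apply SBar_ext <;> simp [bracketFormula, add_mul, mul_add] <;> module)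
    (fun c a b => by apply SBar_ext <;> simp [bracketFormula] <;> module)
    (fun a b b' => by
      apply SBar_ext <;> simp [bracketFormula, add_mul, mul_add] <;> module)
    (fun c a b => by apply SBar_ext <;> simp [bracketFormula] <;> module)

@[simp] lemma sL_sBr (a b : SBar) : sL (sBr a b) =
    sL a * D (sL b) - sL b * D (sL a) - (2 : ℂ) • (sG a * sG b) := rfl
@[simp] lemma sG_sBr (a b : SBar) : sG (sBr a b) =
    sL a * D (sG b) - (1 / 2 : ℂ) • (D (sL a) * sG b)
        - (sL b * D (sG a) - (1 / 2 : ℂ) • (D (sL b) * sG a)) := rfl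

instance : LieSuperalgebra SBar where
  br := sBr
  br_mem := by
    intro i j a b ha hb
    rcases parity_cases i with rfl | rfl <;> rcases parity_cases j with rfl | rfl <;>
      simp only [mem_S0, mem_S1, add_zero, zero_add, parity_one_add_one] at * <;>
      simp [ha, hb]
  br_skew := by
    intro i j a b ha hb
    rcases parity_cases i with rfl | rfl <;> rcases parity_cases j with rfl | rfl <;>
      simp only [mem_S0, mem_S1] at ha hb <;>
      apply SBar_ext <;> simp [ha, hb, mul_comm]
  br_jacobi := by
    intro i j k a b c ha hb hc
    refine bracketFormula_jacobi D D_mul i j k a b c ?_ ?_ ?_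
    · rcases parity_cases i with rfl | rfl <;> exact ha
    · rcases parity_cases j with rfl | rfl <;> exact hb
    · rcases parity_cases k with rfl | rfl <;> exact hc

lemma br_L_L (i j : ℤ) : br (L i) (L j) = ((j : ℂ) - i) • L (i + j) := by
  apply SBar_ext <;> simp only [br, sL_sBr, sG_sBr, L, sL_elt, sG_elt, map_smul, D_T, map_zero,
    mul_smul_comm, ← LaurentPolynomial.T_add, mul_zero, smul_zero, sub_zero, add_comm j i]
  module

lemma br_L_G (i j : ℤ) : br (L i) (G j) = ((j : ℂ) - i / 2) • G (i + j) := by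
  apply SBar_ext <;> simp only [br, sL_sBr, sG_sBr, L, G, sL_elt, sG_elt, map_smul, D_T, map_zero,
    mul_smul_comm, smul_mul_assoc, ← LaurentPolynomial.T_add, mul_zero, zero_mul, smul_zero,
    sub_zero]
  module

lemma br_G_G (i j : ℤ) : br (G i) (G j) = (-2 : ℂ) • L (i + j) := by
  apply SBar_ext <;> simp only [br, sL_sBr, sG_sBr, L, G, sL_elt, sG_elt, map_smul, D_T, map_zero,
    mul_smul_comm, ← LaurentPolynomial.T_add, mul_zero, zero_mul, smul_zero, sub_zero]
  module

/-- The action of `𝔰̄` on `𝒜`: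
`Lᵢ f = tⁱ⁺¹ ∂f/∂t + (i/2) tⁱ ξ ∂f/∂ξ` and `Gᵢ f = tⁱ⁺¹ ξ ∂f/∂t - tⁱ ∂f/∂ξ`. -/
def sAct : SBar →ₗ[ℂ] A →ₗ[ℂ] A :=
  LinearMap.mk₂ ℂ
    (fun a f => ev (sL a) * tdt f + (1 / 2 : ℂ) • (od (D (sL a)) * dxi f)
      + (od (sG a) * tdt f - ev (sG a) * dxi f))
    (fun a a' f => by simp only [map_add, add_mul]; module)
    (fun c a f => by simp only [map_smul, smul_mul_assoc]; module)
    (fun a f f' => by simp only [map_add, mul_add]; module)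
    (fun c a f => by simp only [map_smul, mul_smul_comm]; module)

@[simp] lemma coeff0_sAct (a : SBar) (f : A) :
    coeff0 (sAct a f) = sL a * D (coeff0 f) - sG a * coeff1 f := by
  simp [sAct, sub_eq_add_neg]

@[simp] lemma coeff1_sAct (a : SBar) (f : A) :
    coeff1 (sAct a f) = sL a * D (coeff1 f) + (1 / 2 : ℂ) • (D (sL a) * coeff1 f)
      + sG a * D (coeff0 f) := by
  simp [sAct]

lemma sAct_mem {i j : ZMod 2} {a : SBar} {f : A} (ha : a ∈ grade i) (hf : f ∈ grade j) :
    sAct a f ∈ grade (i + j) := by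
  rcases parity_cases i with rfl | rfl <;> rcases parity_cases j with rfl | rfl <;>
    simp only [mem_S0, mem_S1, mem_A0, mem_A1, add_zero, zero_add, parity_one_add_one] at * <;>
    simp [ha, hf]

lemma algebraMap_half : (algebraMap ℂ P 2⁻¹) * 2 = 1 := by
  rw [← map_ofNat (algebraMap ℂ P) 2, ← map_mul]; simp

lemma sAct_hom {i j : ZMod 2} {a b : SBar} (ha : a ∈ grade i) (hb : b ∈ grade j) (f : A) :
    sAct (br a b) f = sAct a (sAct b f) - sgn i j • sAct b (sAct a f) := by
  have h2 := algebraMap_half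
  rcases parity_cases i with rfl | rfl <;> rcases parity_cases j with rfl | rfl <;>
    simp only [mem_S0, mem_S1] at ha hb <;>
    apply A_ext <;> simp [br, ha, hb, D_mul, mul_add] <;>
    (try simp only [Algebra.smul_def, map_ofNat]) <;>
    generalize (algebraMap ℂ P 2⁻¹) = u at h2 <;> grind

/-- `𝔰̄` acts on the algebra `𝒜` by superderivations. -/
lemma sAct_mul {i j : ZMod 2} {a : SBar} {f : A} (ha : a ∈ grade i) (hf : f ∈ grade j) (g : A) :
    sAct a (f * g) = sAct a f * g + sgn i j • (f * sAct a g) := by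
  rcases parity_cases i with rfl | rfl <;> rcases parity_cases j with rfl | rfl <;>
    simp only [mem_S0, mem_S1, mem_A0, mem_A1] at ha hf <;>
    apply A_ext <;> simp [ha, hf, D_mul, mul_add] <;>
    (try simp only [Algebra.smul_def]) <;> ring

/-! ### The Lie superalgebras `𝔤 = 𝔰̄ ⋉ (𝔤̇ ⊗ 𝒜)` and `𝔤̃ = 𝔤 ⋉ 𝒜` -/

section Current

variable (𝔨 : Type*) [LieRing 𝔨] [LieAlgebra ℂ 𝔨]

/-- A Lie algebra `𝔨`, regarded as a purely even Lie superalgebra. -/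
def PureEven (𝔨 : Type*) : Type _ := 𝔨

instance : AddCommGroup (PureEven 𝔨) := inferInstanceAs (AddCommGroup 𝔨)
instance : Module ℂ (PureEven 𝔨) := inferInstanceAs (Module ℂ 𝔨)

variable {𝔨} in
/-- The bracket of `𝔨`. -/
def PureEven.lie : PureEven 𝔨 →ₗ[ℂ] PureEven 𝔨 →ₗ[ℂ] PureEven 𝔨 :=
  (LinearMap.mk₂ ℂ (fun x y : 𝔨 => ⁅x, y⁆) add_lie smul_lie lie_add lie_smul :
    𝔨 →ₗ[ℂ] 𝔨 →ₗ[ℂ] 𝔨)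

variable {𝔨} in
lemma PureEven.lie_skew (x y : PureEven 𝔨) : PureEven.lie x y = -PureEven.lie y x :=
  (_root_.lie_skew (L := 𝔨) x y).symm

variable {𝔨} in
lemma PureEven.lie_jacobi (x y z : PureEven 𝔨) : PureEven.lie x (PureEven.lie y z) =
    PureEven.lie (PureEven.lie x y) z + PureEven.lie y (PureEven.lie x z) :=
  LieRing.leibniz_lie (L := 𝔨) x y z

instance : SuperSpace (PureEven 𝔨) where
  grade i := if i = 0 then ⊤ else ⊥
  isCompl := by simpa using isCompl_top_bot

variable {𝔨} in
lemma mem_PureEven_one {x : PureEven 𝔨} : x ∈ SuperSpace.grade 1 ↔ x = 0 := Iff.rfl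

variable {𝔨} in
lemma mem_PureEven_zero (x : PureEven 𝔨) : x ∈ SuperSpace.grade 0 := trivial

instance : LieSuperalgebra (PureEven 𝔨) where
  br := PureEven.lie
  br_mem := by
    intro i j x y hx hy
    rcases parity_cases i with rfl | rfl <;> rcases parity_cases j with rfl | rfl <;>
      simp_all [mem_PureEven_one, mem_PureEven_zero]
  br_skew := by
    intro i j x y hx hy
    rcases parity_cases i with rfl | rfl <;> rcases parity_cases j with rfl | rfl <;>
      simp_all [mem_PureEven_one]
    exact PureEven.lie_skew x y
  br_jacobi := by
    intro i j k x y z hx hy hz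
    rcases parity_cases i with rfl | rfl <;> rcases parity_cases j with rfl | rfl <;>
      rcases parity_cases k with rfl | rfl <;> simp_all [mem_PureEven_one]
    exact PureEven.lie_jacobi x y z

/-- The super loop algebra `𝔤̇ ⊗ 𝒜`, written with the factor `𝒜` on the left. -/
abbrev Loop : Type _ := A ⊗[ℂ] PureEven 𝔨

variable {𝔨}

lemma loop_induction {i : ZMod 2} {p : Loop 𝔨 → Prop} {z : Loop 𝔨} (hz : z ∈ grade i)
    (h : ∀ f ∈ grade (V := A) i, ∀ x : PureEven 𝔨, p (f ⊗ₜ x)) (h0 : p 0)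
    (hadd : ∀ x y, p x → p y → p (x + y)) (hsmul : ∀ (c : ℂ) x, p x → p (c • x)) : p z := by
  induction hz using Submodule.span_induction with
  | mem z hz =>
    obtain ⟨j, k, hjk, f, hf, x, hx, rfl⟩ := hz
    rcases parity_cases k with rfl | rfl
    · rw [add_zero] at hjk; subst hjk; exact h f hf x
    · have : x = 0 := hx
      subst this; simpa using h0
  | zero => exact h0
  | add a b _ _ ha hb => exact hadd a b ha hb
  | smul c a _ ha => exact hsmul c a ha

lemma tmul_mem_loop {i : ZMod 2} {f : A} (hf : f ∈ grade i) (x : PureEven 𝔨) :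
    f ⊗ₜ[ℂ] x ∈ grade (V := Loop 𝔨) i := by
  have := tmul_mem_grade (W := PureEven 𝔨) hf (show x ∈ grade 0 from trivial)
  rwa [add_zero] at this

/-- The bracket `[x ⊗ f, y ⊗ g] = [x, y] ⊗ f g`, as a bilinear map. -/
def loopBr : Loop 𝔨 →ₗ[ℂ] Loop 𝔨 →ₗ[ℂ] Loop 𝔨 :=
  TensorProduct.map₂ (LinearMap.mul ℂ A) PureEven.lie

@[simp] lemma loopBr_tmul (f g : A) (x y : PureEven 𝔨) :
    loopBr (f ⊗ₜ[ℂ] x) (g ⊗ₜ[ℂ] y) = (f * g) ⊗ₜ[ℂ] PureEven.lie x y := rfl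

lemma A_mul_mem {i j : ZMod 2} {f g : A} (hf : f ∈ grade i) (hg : g ∈ grade j) :
    f * g ∈ grade (i + j) := by
  rcases parity_cases i with rfl | rfl <;> rcases parity_cases j with rfl | rfl <;>
    simp only [mem_A0, mem_A1, add_zero, zero_add, parity_one_add_one] at * <;>
    simp [hf, hg]

lemma loopBr_odd_odd {x y : Loop 𝔨} (hx : x ∈ grade 1) (hy : y ∈ grade 1) : loopBr x y = 0 := by
  refine loop_induction (p := fun x => loopBr x y = 0) hx ?_ (by simp) ?_ ?_
  · intro f hf a
    refine loop_induction (p := fun y => loopBr (f ⊗ₜ[ℂ] a) y = 0) hy ?_ (by simp) ?_ ?_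
    · intro g hg b
      have : f * g = 0 := by
        rw [mem_A1] at hf hg
        apply A_ext <;> simp [hf, hg]
      simp [this]
    · intro x y hx hy; rw [map_add, hx, hy, add_zero]
    · intro c x hx; rw [map_smul, hx, smul_zero]
  · intro x y hx hy; rw [map_add, LinearMap.add_apply, hx, hy, add_zero]
  · intro c x hx; rw [map_smul, LinearMap.smul_apply, hx, smul_zero]

lemma loopBr_mem {i j : ZMod 2} {x y : Loop 𝔨} (hx : x ∈ grade i) (hy : y ∈ grade j) :
    loopBr x y ∈ grade (i + j) := by
  refine loop_induction (p := fun x => loopBr x y ∈ grade (i + j)) hx ?_ (by simp) ?_ ?_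
  · intro f hf a
    refine loop_induction (p := fun y => loopBr (f ⊗ₜ[ℂ] a) y ∈ grade (i + j)) hy ?_
      (by simp) ?_ ?_
    · intro g hg b
      exact tmul_mem_loop (A_mul_mem hf hg) _
    · intro x y hx hy; rw [map_add]; exact Submodule.add_mem _ hx hy
    · intro c x hx; rw [map_smul]; exact Submodule.smul_mem _ _ hx
  · intro x y hx hy; rw [map_add]; exact Submodule.add_mem _ hx hy
  · intro c x hx; rw [map_smul]; exact Submodule.smul_mem _ _ hx

lemma loopBr_skew (x y : Loop 𝔨) : loopBr x y = -loopBr y x := by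
  induction x using TensorProduct.induction_on with
  | zero => simp
  | add u v hu hv => simp only [map_add, LinearMap.add_apply, hu, hv]; abel
  | tmul f a =>
    induction y using TensorProduct.induction_on with
    | zero => simp
    | add u v hu hv => simp only [map_add, LinearMap.add_apply, hu, hv]; abel
    | tmul g b =>
      rw [loopBr_tmul, loopBr_tmul, mul_comm, PureEven.lie_skew, TensorProduct.tmul_neg]

lemma loopBr_jacobi (x y z : Loop 𝔨) :
    loopBr x (loopBr y z) = loopBr (loopBr x y) z + loopBr y (loopBr x z) := by
  induction x using TensorProduct.induction_on with
  | zero => simp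
  | add u v hu hv => simp only [map_add, LinearMap.add_apply, hu, hv]; abel
  | tmul f a =>
    induction y using TensorProduct.induction_on with
    | zero => simp
    | add u v hu hv => simp only [map_add, LinearMap.add_apply, hu, hv]; abel
    | tmul g b =>
      induction z using TensorProduct.induction_on with
      | zero => simp
      | add u v hu hv => simp only [map_add, hu, hv]; abel
      | tmul h c =>
        simp only [loopBr_tmul]
        rw [show g * (f * h) = f * (g * h) by ring, mul_assoc, ← TensorProduct.tmul_add,
          PureEven.lie_jacobi a b c]

lemma sgn_eq_one {i j : ZMod 2} (h : ¬(i = 1 ∧ j = 1)) : sgn i j = 1 := by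
  rcases parity_cases i with rfl | rfl <;> rcases parity_cases j with rfl | rfl <;> simp_all

lemma loopBr_superskew {i j : ZMod 2} {x y : Loop 𝔨} (hx : x ∈ grade i) (hy : y ∈ grade j) :
    loopBr x y = -(sgn i j • loopBr y x) := by
  by_cases h : i = 1 ∧ j = 1
  · obtain ⟨rfl, rfl⟩ := h
    rw [loopBr_odd_odd hx hy, loopBr_odd_odd hy hx, smul_zero, neg_zero]
  · rw [sgn_eq_one h, one_smul]
    exact loopBr_skew x y

lemma loopBr_superjacobi {i j k : ZMod 2} {x y z : Loop 𝔨} (hx : x ∈ grade i)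
    (hy : y ∈ grade j) (hz : z ∈ grade k) :
    loopBr x (loopBr y z) = loopBr (loopBr x y) z + sgn i j • loopBr y (loopBr x z) := by
  by_cases h : i = 1 ∧ j = 1
  · obtain ⟨rfl, rfl⟩ := h
    have h2 : loopBr y (loopBr x z) = 0 := by
      rcases parity_cases k with rfl | rfl
      · have h3 := loopBr_mem hx hz
        rw [add_zero] at h3
        exact loopBr_odd_odd hy h3
      · rw [loopBr_odd_odd hx hz, map_zero]
    rw [loopBr_jacobi, h2, smul_zero]
  · rw [sgn_eq_one h, one_smul]
    exact loopBr_jacobi x y z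

instance : LieSuperalgebra (Loop 𝔨) where
  br := loopBr
  br_mem := loopBr_mem
  br_skew := loopBr_superskew
  br_jacobi := loopBr_superjacobi

variable (𝔨)

/-- The action of `𝔰̄` on `𝔤̇ ⊗ 𝒜` through `𝒜`: `a (x ⊗ f) = x ⊗ (a f)`. -/
def sActLoop : DerivationAction SBar (Loop 𝔨) where
  toLin := LinearMap.rTensorHom (PureEven 𝔨) ∘ₗ sAct
  mem := by
    intro i j a z ha hz
    refine loop_induction (p := fun z => LinearMap.rTensor (PureEven 𝔨) (sAct a) z ∈ grade (i + j))
      hz ?_ (by simp) ?_ ?_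
    · intro f hf x
      exact tmul_mem_loop (sAct_mem ha hf) x
    · intro x y hx hy; rw [map_add]; exact Submodule.add_mem _ hx hy
    · intro c x hx; rw [map_smul]; exact Submodule.smul_mem _ _ hx
  hom := by
    intro i j a b ha hb z
    change LinearMap.rTensor _ (sAct _) z = LinearMap.rTensor _ (sAct _)
      (LinearMap.rTensor _ (sAct _) z) - sgn i j • LinearMap.rTensor _ (sAct _)
      (LinearMap.rTensor _ (sAct _) z)
    induction z using TensorProduct.induction_on with
    | zero => simp
    | tmul f x =>
      simp only [LinearMap.rTensor_tmul, sAct_hom ha hb, TensorProduct.sub_tmul,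
        TensorProduct.smul_tmul']
    | add x y hx hy => simp only [map_add, hx, hy, smul_add]; abel
  deriv := by
    intro i j a z ha hz y
    change LinearMap.rTensor _ (sAct a) (loopBr z y) = loopBr (LinearMap.rTensor _ (sAct a) z) y
      + sgn i j • loopBr z (LinearMap.rTensor _ (sAct a) y)
    refine loop_induction (p := fun z => LinearMap.rTensor (PureEven 𝔨) (sAct a) (loopBr z y) =
      loopBr (LinearMap.rTensor _ (sAct a) z) y
      + sgn i j • loopBr z (LinearMap.rTensor _ (sAct a) y)) hz ?_ (by simp) ?_ ?_
    · intro f hf x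
      induction y using TensorProduct.induction_on with
      | zero => simp
      | tmul g y =>
        simp only [LinearMap.rTensor_tmul, loopBr_tmul, sAct_mul ha hf, TensorProduct.add_tmul,
          TensorProduct.smul_tmul']
      | add u v hu hv => simp only [map_add, hu, hv, smul_add]; abel
    · intro u v hu hv; simp only [map_add, LinearMap.add_apply, hu, hv, smul_add]; abel
    · intro c u hu
      simp only [map_smul, LinearMap.smul_apply, hu, smul_add, smul_comm c (sgn i j)]

/-- The Lie superalgebra `𝔤 = 𝔰̄ ⋉ (𝔤̇ ⊗ 𝒜)`. -/
abbrev Current : Type _ := Semidirect (sActLoop 𝔨)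

/-- The action of `𝔤` on (the abelian Lie superalgebra) `𝒜`: `𝔰̄` acts as above and the ideal
`𝔤̇ ⊗ 𝒜` acts by zero. -/
def currentAct : DerivationAction (Current 𝔨) A where
  toLin := sAct ∘ₗ LinearMap.fst ℂ SBar (Loop 𝔨)
  mem ha hx := sAct_mem ha.1 hx
  hom ha hb x := sAct_hom ha.1 hb.1 x
  deriv _ _ _ := by simp [br]

/-- The Lie superalgebra `𝔤̃ = 𝔤 ⋉ 𝒜`. -/
abbrev Extended : Type _ := Semidirect (currentAct 𝔨)

variable {𝔨}

/-- `a ∈ 𝔰̄` as an element of `𝔤̃`. -/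
def Extended.ofS (a : SBar) : Extended 𝔨 := (((a, 0) : SBar × Loop 𝔨), (0 : A))

/-- `w ∈ 𝔤̇ ⊗ 𝒜` as an element of `𝔤̃`. -/
def Extended.ofLoop (w : Loop 𝔨) : Extended 𝔨 := (((0, w) : SBar × Loop 𝔨), (0 : A))

/-- `f ∈ 𝒜` as an element of `𝔤̃`. -/
def Extended.ofA (f : A) : Extended 𝔨 := (((0, 0) : SBar × Loop 𝔨), f)

end Current

/-! ### The Lie superalgebra `R = (t - 1) 𝔰̄ / (t - 1)² 𝔰̄` -/

/-- The `𝒜`-module structure of `𝔰̄`: `tⁱ Lₙ = Lₙ₊ᵢ`, `tⁱ Gₙ = Gₙ₊ᵢ`, `ξ Lₙ = Gₙ / 2`,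
`ξ Gₙ = 0`. -/
def aSmul : A →ₗ[ℂ] SBar →ₗ[ℂ] SBar :=
  LinearMap.mk₂ ℂ
    (fun f a => elt (coeff0 f * sL a) (coeff0 f * sG a + (1 / 2 : ℂ) • (coeff1 f * sL a)))
    (fun f f' a => by apply SBar_ext <;> simp [add_mul]; module)
    (fun c f a => by apply SBar_ext <;> simp; module)
    (fun f a a' => by apply SBar_ext <;> simp [mul_add]; module)
    (fun c f a => by apply SBar_ext <;> simp; module)

@[simp] lemma sL_aSmul (f : A) (a : SBar) : sL (aSmul f a) = coeff0 f * sL a := rfl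
@[simp] lemma sG_aSmul (f : A) (a : SBar) :
    sG (aSmul f a) = coeff0 f * sG a + (1 / 2 : ℂ) • (coeff1 f * sL a) := rfl

/-- `t - 1`, as a Laurent polynomial. -/
def tm1 : P := LaurentPolynomial.T 1 - 1

lemma D_one : D (1 : P) = 0 := by
  rw [← LaurentPolynomial.T_zero, D_T]; simp

lemma D_tm1 : D tm1 = LaurentPolynomial.T 1 := by
  simp [tm1, D_T, D_one]

lemma ev_pow (f : P) (k : ℕ) : ev f ^ k = ev (f ^ k) := by
  induction k with
  | zero => rfl
  | succ k ih => rw [pow_succ, ih]; apply A_ext <;> simp [pow_succ]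

/-- The subspace `(t - 1)ᵏ 𝔰̄` of `𝔰̄`. -/
def tsPow (k : ℕ) : Submodule ℂ SBar := LinearMap.range (aSmul (ev tm1 ^ k))

lemma mem_tsPow {k : ℕ} {a : SBar} : a ∈ tsPow k ↔ tm1 ^ k ∣ sL a ∧ tm1 ^ k ∣ sG a := by
  rw [tsPow, ev_pow]
  constructor
  · rintro ⟨b, rfl⟩
    simp
  · rintro ⟨⟨f, hf⟩, ⟨g, hg⟩⟩
    exact ⟨elt f g, by apply SBar_ext <;> simp [hf, hg]⟩

lemma tsPow_graded (k : ℕ) : IsGraded (tsPow k) := by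
  intro a ha
  rw [mem_tsPow] at ha
  refine Submodule.mem_sup.2 ⟨elt (sL a) 0, ⟨?_, by simp [mem_S0]⟩, elt 0 (sG a),
    ⟨?_, by simp [mem_S1]⟩, by apply SBar_ext <;> simp⟩
  · exact mem_tsPow.2 ⟨ha.1, by simp⟩
  · exact mem_tsPow.2 ⟨by simp, ha.2⟩

lemma br_tsPow_one {a b : SBar} (ha : a ∈ tsPow 1) (hb : b ∈ tsPow 1) : br a b ∈ tsPow 1 := by
  rw [mem_tsPow] at *
  obtain ⟨⟨a0, ha0⟩, ⟨a1, ha1⟩⟩ := ha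
  obtain ⟨⟨b0, hb0⟩, ⟨b1, hb1⟩⟩ := hb
  rw [pow_one] at *
  simp only [br, sL_sBr, sG_sBr, ha0, ha1, hb0, hb1, D_mul, D_tm1, Algebra.smul_def]
  generalize algebraMap ℂ P (1 / 2) = h
  generalize (LaurentPolynomial.T 1 : P) = T
  generalize tm1 = m
  exact ⟨Dvd.intro (a0 * (T * b0 + m * D b0) - b0 * (T * a0 + m * D a0)
      - m * (algebraMap ℂ P 2 * a1 * b1)) (by ring),
    Dvd.intro (a0 * (T * b1 + m * D b1) - h * (T * a0 + m * D a0) * b1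
      - b0 * (T * a1 + m * D a1) + h * (T * b0 + m * D b0) * a1) (by ring)⟩

lemma br_tsPow_two {a b : SBar} (ha : a ∈ tsPow 1) (hb : b ∈ tsPow 2) :
    br a b ∈ tsPow 2 ∧ br b a ∈ tsPow 2 := by
  simp only [mem_tsPow] at *
  obtain ⟨⟨a0, ha0⟩, ⟨a1, ha1⟩⟩ := ha
  obtain ⟨⟨b0, hb0⟩, ⟨b1, hb1⟩⟩ := hb
  rw [pow_one] at ha0 ha1
  rw [pow_two] at *
  simp only [br, sL_sBr, sG_sBr, ha0, ha1, hb0, hb1, D_mul, D_tm1, Algebra.smul_def]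
  generalize algebraMap ℂ P (1 / 2) = h
  generalize (LaurentPolynomial.T 1 : P) = T
  generalize tm1 = m
  exact ⟨⟨Dvd.intro (a0 * (2 * T * b0 + m * D b0) - b0 * (T * a0 + m * D a0)
        - m * (algebraMap ℂ P 2 * a1 * b1)) (by ring),
      Dvd.intro (a0 * (2 * T * b1 + m * D b1) - h * (T * a0 + m * D a0) * b1
        - b0 * (T * a1 + m * D a1) + h * (2 * T * b0 + m * D b0) * a1) (by ring)⟩,
    ⟨Dvd.intro (b0 * (T * a0 + m * D a0) - a0 * (2 * T * b0 + m * D b0)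
        - m * (algebraMap ℂ P 2 * a1 * b1)) (by ring),
      Dvd.intro (-(a0 * (2 * T * b1 + m * D b1) - h * (T * a0 + m * D a0) * b1
        - b0 * (T * a1 + m * D a1) + h * (2 * T * b0 + m * D b0) * a1)) (by ring)⟩⟩

/-- The Lie superalgebra `(t - 1) 𝔰̄`. -/
def ts : LieSuperSubalgebra SBar where
  toSubmodule := tsPow 1
  graded := tsPow_graded 1
  br_closed := br_tsPow_one

/-- The ideal `(t - 1)² 𝔰̄` of `(t - 1) 𝔰̄`. -/
def tsSq : LieSuperIdeal ts.toSubmodule where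
  toSubmodule := (tsPow 2).comap ts.toSubmodule.subtype
  graded := by
    rintro ⟨a, ha⟩ ha'
    obtain ⟨b, hb, c, hc, hbc⟩ := Submodule.mem_sup.1 (tsPow_graded 2 ha')
    have key : ∀ x ∈ tsPow 2, x ∈ tsPow 1 := fun x hx => by
      rw [mem_tsPow] at *
      exact ⟨(pow_dvd_pow _ one_le_two).trans hx.1, (pow_dvd_pow _ one_le_two).trans hx.2⟩
    exact Submodule.mem_sup.2 ⟨⟨b, key b hb.1⟩, hb, ⟨c, key c hc.1⟩, hc, Subtype.ext hbc⟩
  br_left x _ hy := (br_tsPow_two x.2 hy).1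
  br_right y hx := (br_tsPow_two y.2 hx).2

/-- `R = (t - 1) 𝔰̄ / (t - 1)² 𝔰̄`. -/
abbrev R : Type := ts.toSubmodule ⧸ tsSq.toSubmodule

section

variable (𝔨 : Type*) [LieRing 𝔨] [LieAlgebra ℂ 𝔨]

/-- The action of `R` on `𝔤̇` in `R ⋉ 𝔤̇` is the one induced by `𝔤` on
`𝔤̇ ⊗ (𝒜 / 𝔪) = 𝔤̇`, where `𝔪 = (t - 1, ξ)`; since `(t - 1) 𝔰̄` maps `𝒜` into `𝔪`, it is zero. -/
def rAct : DerivationAction R (PureEven 𝔨) where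
  toLin := 0
  mem _ _ := Submodule.zero_mem _
  hom _ _ _ := by simp
  deriv _ _ _ := by simp

/-- The Lie superalgebra `R ⋉ 𝔤̇`. -/
abbrev RSemi : Type _ := Semidirect (rAct 𝔨)

/-! ### The Lie superalgebra `𝔞₀ = (t - 1) 𝔰̄ ⋉ (𝔤̇ ⊗ 𝒜)` and its map onto `R ⋉ 𝔤̇` -/

/-- The projection of `𝔤 = 𝔰̄ ⋉ (𝔤̇ ⊗ 𝒜)` to `𝔰̄`. -/
def toS : Current 𝔨 →ₗ[ℂ] SBar := LinearMap.fst ℂ SBar (Loop 𝔨)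

/-- The linear projection of `𝔤 = 𝔰̄ ⋉ (𝔤̇ ⊗ 𝒜)` to `𝔤̇ ⊗ 𝒜`. -/
def toLoop : Current 𝔨 →ₗ[ℂ] Loop 𝔨 := LinearMap.snd ℂ SBar (Loop 𝔨)

variable {𝔨}

/-- The element `(a, w)` of `𝔤 = 𝔰̄ ⋉ (𝔤̇ ⊗ 𝒜)`. -/
def cur (a : SBar) (w : Loop 𝔨) : Current 𝔨 := ((a, w) : SBar × Loop 𝔨)

@[simp] lemma toS_cur (a : SBar) (w : Loop 𝔨) : toS 𝔨 (cur a w) = a := rfl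
@[simp] lemma toLoop_cur (a : SBar) (w : Loop 𝔨) : toLoop 𝔨 (cur a w) = w := rfl
lemma toS_br (p q : Current 𝔨) : toS 𝔨 (br p q) = br (toS 𝔨 p) (toS 𝔨 q) := rfl
lemma toLoop_br (p q : Current 𝔨) : toLoop 𝔨 (br p q) =
    LinearMap.rTensor (PureEven 𝔨) (sAct (toS 𝔨 p)) (toLoop 𝔨 q)
      - (sActLoop 𝔨).twist (toS 𝔨 q) (toLoop 𝔨 p) + loopBr (toLoop 𝔨 p) (toLoop 𝔨 q) := rfl

variable (𝔨)

/-- `𝔞₀ = (t - 1) 𝔰̄ ⋉ (𝔤̇ ⊗ 𝒜)`, a subalgebra of `𝔤`. -/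
def a0 : LieSuperSubalgebra (Current 𝔨) where
  toSubmodule := ts.toSubmodule.comap (toS 𝔨)
  graded := by
    intro p hp
    obtain ⟨b, hb, c, hc, hbc⟩ := Submodule.mem_sup.1 (ts.graded hp)
    have hw : toLoop 𝔨 p ∈ (grade 0 : Submodule ℂ (Loop 𝔨)) ⊔ grade 1 := by
      rw [SuperSpace.isCompl.sup_eq_top]; trivial
    obtain ⟨u, hu, v, hv, huv⟩ := Submodule.mem_sup.1 hw
    exact Submodule.mem_sup.2 ⟨cur b u, ⟨hb.1, hb.2, hu⟩, cur c v, ⟨hc.1, hc.2, hv⟩,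
      Prod.ext hbc huv⟩
  br_closed hx hy := by
    rw [Submodule.mem_comap, toS_br]
    exact ts.br_closed hx hy

/-- Evaluation at `t = 1`. -/
def evalOne : P →ₐ[ℂ] ℂ := AddMonoidAlgebra.lift ℂ ℂ ℤ 1

/-- The quotient map `𝒜 → 𝒜 / 𝔪 = ℂ`, `t ↦ 1`, `ξ ↦ 0`. -/
def aug : A →ₗ[ℂ] ℂ := evalOne.toLinearMap ∘ₗ coeff0

/-- The quotient map `𝔤̇ ⊗ 𝒜 → 𝔤̇ ⊗ (𝒜 / 𝔪) = 𝔤̇`. -/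
def loopEval : Loop 𝔨 →ₗ[ℂ] PureEven 𝔨 :=
  (TensorProduct.lid ℂ (PureEven 𝔨)).toLinearMap ∘ₗ LinearMap.rTensor (PureEven 𝔨) aug

variable {𝔨}

lemma loopEval_tmul (f : A) (x : PureEven 𝔨) : loopEval 𝔨 (f ⊗ₜ[ℂ] x) = aug f • x := rfl

lemma evalOne_tm1 : evalOne tm1 = 0 := by
  simp [evalOne, tm1, LaurentPolynomial.T, -LaurentPolynomial.single_eq_C_mul_T]

lemma aug_mul (f g : A) : aug (f * g) = aug f * aug g := by simp [aug]

lemma aug_sAct {a : SBar} (ha : a ∈ ts.toSubmodule) (f : A) : aug (sAct a f) = 0 := by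
  obtain ⟨⟨a0, ha0⟩, ⟨a1, ha1⟩⟩ := mem_tsPow.1 ha
  simp [aug, ha0, ha1, evalOne_tm1]

lemma loopEval_sAct {a : SBar} (ha : a ∈ ts.toSubmodule) (w : Loop 𝔨) :
    loopEval 𝔨 (LinearMap.rTensor (PureEven 𝔨) (sAct a) w) = 0 := by
  induction w using TensorProduct.induction_on with
  | zero => simp
  | tmul f x => rw [LinearMap.rTensor_tmul, loopEval_tmul, aug_sAct ha, zero_smul]
  | add x y hx hy => rw [map_add, map_add, hx, hy, add_zero]

lemma loopEval_br (w z : Loop 𝔨) :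
    loopEval 𝔨 (loopBr w z) = PureEven.lie (loopEval 𝔨 w) (loopEval 𝔨 z) := by
  induction w using TensorProduct.induction_on with
  | zero => simp
  | add u v hu hv => simp only [map_add, LinearMap.add_apply, hu, hv]
  | tmul f a =>
    induction z using TensorProduct.induction_on with
    | zero => simp
    | add u v hu hv => simp only [map_add, hu, hv]
    | tmul g b =>
      simp only [loopBr_tmul, loopEval_tmul, aug_mul, map_smul, LinearMap.smul_apply, mul_smul]
      rw [smul_comm]

lemma aug_odd {f : A} (hf : f ∈ grade 1) : aug f = 0 := by
  rw [mem_A1] at hf; simp [aug, hf]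

lemma loopEval_mem {i : ZMod 2} {w : Loop 𝔨} (hw : w ∈ grade i) :
    loopEval 𝔨 w ∈ grade i := by
  rcases parity_cases i with rfl | rfl
  · exact mem_PureEven_zero _
  · rw [mem_PureEven_one]
    refine loop_induction (p := fun w => loopEval 𝔨 w = 0) hw ?_ (by simp) ?_ ?_
    · intro f hf x
      rw [loopEval_tmul, aug_odd hf, zero_smul]
    · intro x y hx hy; rw [map_add, hx, hy, add_zero]
    · intro c x hx; rw [map_smul, hx, smul_zero]

lemma loopEval_twist {a : SBar} (ha : a ∈ ts.toSubmodule) (w : Loop 𝔨) :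
    loopEval 𝔨 ((sActLoop 𝔨).twist a w) = 0 := by
  obtain ⟨b, hb, c, hc, rfl⟩ := Submodule.mem_sup.1 (ts.graded ha)
  have key : ∀ (i : ZMod 2) (b : SBar), b ∈ ts.toSubmodule → b ∈ grade i →
      loopEval 𝔨 ((sActLoop 𝔨).twist b w) = 0 := by
    intro i b hb hi
    refine grade_induction (p := fun w => loopEval 𝔨 ((sActLoop 𝔨).twist b w) = 0) ?_ ?_ ?_ w
    · intro x hx
      rw [(sActLoop 𝔨).twist_apply hi hx, map_smul]
      erw [loopEval_sAct hb x]; simp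
    · intro x hx
      rw [(sActLoop 𝔨).twist_apply hi hx, map_smul]
      erw [loopEval_sAct hb x]; simp
    · intro x y hx hy; rw [map_add, map_add, hx, hy, add_zero]
  rw [map_add, LinearMap.add_apply, map_add, key 0 b hb.1 hb.2, key 1 c hc.1 hc.2, add_zero]

variable (𝔨)

/-- The quotient map `𝔞₀ → R ⋉ 𝔤̇`, `((t - 1) a, x ⊗ f) ↦ ((t - 1) a mod (t - 1)² 𝔰̄, f(1) x)`
(with `ξ ↦ 0`); its kernel is `(t - 1)² 𝔰̄ ⋉ (𝔤̇ ⊗ 𝔪)`. -/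
def a0ToRSemi : LieSuperHom (a0 𝔨).toSubmodule (RSemi 𝔨) where
  toLin := LinearMap.prod
    (tsSq.toSubmodule.mkQ ∘ₗ (toS 𝔨).restrict (p := (a0 𝔨).toSubmodule) (q := ts.toSubmodule)
      (fun _ hx => hx))
    (loopEval 𝔨 ∘ₗ toLoop 𝔨 ∘ₗ (a0 𝔨).toSubmodule.subtype)
  mem := by
    rintro i ⟨p, hp⟩ hi
    exact ⟨⟨⟨toS 𝔨 p, hp⟩, hi.1, rfl⟩, loopEval_mem hi.2⟩
  map_br := by
    rintro ⟨p, hp⟩ ⟨q, hq⟩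
    refine Prod.ext rfl ?_
    change loopEval 𝔨 (toLoop 𝔨 (br p q)) = 0 - (rAct 𝔨).twist _ _
      + PureEven.lie (loopEval 𝔨 (toLoop 𝔨 p)) (loopEval 𝔨 (toLoop 𝔨 q))
    rw [toLoop_br, map_add, map_sub, loopEval_sAct hp, loopEval_twist hq, loopEval_br]
    simp [DerivationAction.twist, rAct]

end

/-! ### The tensor modules `Γ(λ, V)` -/

/-- `tᵐ ∈ 𝒜`. -/
def te (m : ℤ) : A := ev (LaurentPolynomial.T m)

/-- `tᵐ ξ ∈ 𝒜`. -/
def tx (m : ℤ) : A := od (LaurentPolynomial.T m)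

lemma sAct_L_te (i m : ℤ) : sAct (L i) (te m) = (m : ℂ) • te (i + m) := by
  apply A_ext <;> simp [L, te, D_T, -LaurentPolynomial.T_mul, ← LaurentPolynomial.T_add]
lemma sAct_L_tx (i m : ℤ) : sAct (L i) (tx m) = ((m : ℂ) + i / 2) • tx (i + m) := by
  apply A_ext <;> simp [L, tx, D_T, -LaurentPolynomial.T_mul, ← LaurentPolynomial.T_add]
  module
lemma sAct_G_te (i m : ℤ) : sAct (G i) (te m) = (m : ℂ) • tx (i + m) := by
  apply A_ext <;> simp [G, te, tx, D_T, -LaurentPolynomial.T_mul, ← LaurentPolynomial.T_add]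
lemma sAct_G_tx (i m : ℤ) : sAct (G i) (tx m) = -te (i + m) := by
  apply A_ext <;> simp [G, te, tx, -LaurentPolynomial.T_mul, ← LaurentPolynomial.T_add]

section Gamma

variable {𝔨 : Type v} [LieRing 𝔨] [LieAlgebra ℂ 𝔨]

lemma tm1_dvd (i : ℤ) : tm1 ∣ LaurentPolynomial.T i - 1 := by
  have hn : ∀ n : ℕ, tm1 ∣ (LaurentPolynomial.T (n : ℤ) : P) - 1 := fun n => by
    have := sub_one_dvd_pow_sub_one (LaurentPolynomial.T 1 : P) n
    rw [LaurentPolynomial.T_pow, mul_one] at this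
    exact this
  rcases Int.eq_nat_or_neg i with ⟨n, rfl | rfl⟩
  · exact hn n
  · have : (LaurentPolynomial.T (-(n : ℤ)) : P) - 1 =
        (LaurentPolynomial.T (n : ℤ) - 1) * (-LaurentPolynomial.T (-(n : ℤ))) := by
      rw [sub_mul, mul_neg, ← LaurentPolynomial.T_add, add_neg_cancel, LaurentPolynomial.T_zero]
      ring
    rw [this]
    exact (hn n).mul_right _

variable (𝔨) in
/-- `Lᵢ - L₀ ∈ 𝔞₀`. -/
def a0L (i : ℤ) : (a0 𝔨).toSubmodule :=
  ⟨cur (L i - L 0) 0, by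
    change L i - L 0 ∈ tsPow 1
    rw [mem_tsPow, pow_one]
    simpa [L] using tm1_dvd i⟩

variable (𝔨) in
/-- `Gᵢ - G₀ ∈ 𝔞₀`. -/
def a0G (i : ℤ) : (a0 𝔨).toSubmodule :=
  ⟨cur (G i - G 0) 0, by
    change G i - G 0 ∈ tsPow 1
    rw [mem_tsPow, pow_one]
    simpa [G] using tm1_dvd i⟩

/-- `w ∈ 𝔤̇ ⊗ 𝒜`, as an element of `𝔞₀`. -/
def a0Loop : Loop 𝔨 →ₗ[ℂ] (a0 𝔨).toSubmodule where
  toFun w := ⟨cur 0 w, ts.toSubmodule.zero_mem⟩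
  map_add' _ _ := Subtype.ext (Prod.ext (add_zero _).symm rfl)
  map_smul' _ _ := Subtype.ext (Prod.ext (smul_zero _).symm rfl)

variable (lam : ℂ) (V : LieSuperModule.{v, w} (a0 𝔨).toSubmodule)

/-- The operator of `Lᵢ` on `𝒜 ⊗ V`:
`f ⊗ v ↦ tⁱ f ⊗ (Lᵢ - L₀) v - (-1)^{|f|} (i/2) tⁱ ξ f ⊗ (Gᵢ - G₀) v
  + tⁱ (λ f + t ∂f/∂t) ⊗ v + (i/2) tⁱ ξ ∂f/∂ξ ⊗ v`. -/
def opL (i : ℤ) : A ⊗[ℂ] V.carrier →ₗ[ℂ] A ⊗[ℂ] V.carrier :=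
  TensorProduct.map (LinearMap.mul ℂ A (te i)) (V.act (a0L 𝔨 i))
    - ((i : ℂ) / 2) •
      TensorProduct.map (LinearMap.mul ℂ A (tx i) ∘ₗ parityAut) (V.act (a0G 𝔨 i))
    + TensorProduct.map (LinearMap.mul ℂ A (te i) ∘ₗ (lam • LinearMap.id + tdt)) LinearMap.id
    + ((i : ℂ) / 2) • TensorProduct.map (LinearMap.mul ℂ A (tx i) ∘ₗ dxi) LinearMap.id

/-- The operator of `Gᵢ` on `𝒜 ⊗ V`:
`f ⊗ v ↦ (-1)^{|f|} tⁱ f ⊗ (Gᵢ - G₀) v + 2 tⁱ ξ f ⊗ (Lᵢ - L₀) v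
  + tⁱ ξ (λ f + t ∂f/∂t) ⊗ v - tⁱ ∂f/∂ξ ⊗ v`. -/
def opG (i : ℤ) : A ⊗[ℂ] V.carrier →ₗ[ℂ] A ⊗[ℂ] V.carrier :=
  TensorProduct.map (LinearMap.mul ℂ A (te i) ∘ₗ parityAut) (V.act (a0G 𝔨 i))
    + (2 : ℂ) • TensorProduct.map (LinearMap.mul ℂ A (tx i)) (V.act (a0L 𝔨 i))
    + TensorProduct.map (LinearMap.mul ℂ A (tx i) ∘ₗ (lam • LinearMap.id + tdt)) LinearMap.id
    - TensorProduct.map (LinearMap.mul ℂ A (te i) ∘ₗ dxi) LinearMap.id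

/-- The operator of `x ⊗ tⁱ` on `𝒜 ⊗ V`:
`f ⊗ v ↦ tⁱ f ⊗ (x ⊗ tⁱ) v - (-1)^{|f|} i tⁱ ξ f ⊗ (x ⊗ tⁱ ξ) v`. -/
def opX (i : ℤ) : PureEven 𝔨 →ₗ[ℂ] A ⊗[ℂ] V.carrier →ₗ[ℂ] A ⊗[ℂ] V.carrier where
  toFun x := TensorProduct.map (LinearMap.mul ℂ A (te i)) (V.act (a0Loop (te i ⊗ₜ x)))
    - (i : ℂ) •
      TensorProduct.map (LinearMap.mul ℂ A (tx i) ∘ₗ parityAut) (V.act (a0Loop (tx i ⊗ₜ x)))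
  map_add' x y := by
    simp only [TensorProduct.tmul_add, map_add, TensorProduct.map_add_right]; module
  map_smul' c x := by
    simp only [TensorProduct.tmul_smul, map_smul, TensorProduct.map_smul_right,
      RingHom.id_apply]
    module

/-- The operator of `x ⊗ tⁱ ξ` on `𝒜 ⊗ V`:
`f ⊗ v ↦ tⁱ ξ f ⊗ (x ⊗ tⁱ) v + (-1)^{|f|} tⁱ f ⊗ (x ⊗ tⁱ ξ) v`. -/
def opXi (i : ℤ) : PureEven 𝔨 →ₗ[ℂ] A ⊗[ℂ] V.carrier →ₗ[ℂ] A ⊗[ℂ] V.carrier where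
  toFun x := TensorProduct.map (LinearMap.mul ℂ A (tx i)) (V.act (a0Loop (te i ⊗ₜ x)))
    + TensorProduct.map (LinearMap.mul ℂ A (te i) ∘ₗ parityAut) (V.act (a0Loop (tx i ⊗ₜ x)))
  map_add' x y := by
    simp only [TensorProduct.tmul_add, map_add, TensorProduct.map_add_right]; module
  map_smul' c x := by
    simp only [TensorProduct.tmul_smul, map_smul, TensorProduct.map_smul_right,
      RingHom.id_apply]
    module

/-- The action of `𝔰̄` on `𝒜 ⊗ V`, the linear extension of `opL` and `opG`. -/
def gammaS : SBar →ₗ[ℂ] A ⊗[ℂ] V.carrier →ₗ[ℂ] A ⊗[ℂ] V.carrier :=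
  onT (opL lam V) ∘ₗ sL + onT (opG lam V) ∘ₗ sG

/-- The action of `𝔤̇ ⊗ 𝒜` on `𝒜 ⊗ V`, the linear extension of `opX` and `opXi`. -/
def gammaLoop : Loop 𝔨 →ₗ[ℂ] A ⊗[ℂ] V.carrier →ₗ[ℂ] A ⊗[ℂ] V.carrier :=
  TensorProduct.lift (onT (opX V) ∘ₗ coeff0 + onT (opXi V) ∘ₗ coeff1)

/-- The action of `𝒜` on `𝒜 ⊗ V` by multiplication on the left factor. -/
def gammaA : A →ₗ[ℂ] A ⊗[ℂ] V.carrier →ₗ[ℂ] A ⊗[ℂ] V.carrier :=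
  LinearMap.rTensorHom V.carrier ∘ₗ LinearMap.mul ℂ A

/-- The action of `𝔤̃` on `𝒜 ⊗ V`; the super space `𝒜 ⊗ V` with this action is `Γ(λ, V)`. -/
def gammaAct : Extended 𝔨 →ₗ[ℂ] A ⊗[ℂ] V.carrier →ₗ[ℂ] A ⊗[ℂ] V.carrier :=
  gammaS lam V ∘ₗ toS 𝔨 ∘ₗ LinearMap.fst ℂ (Current 𝔨) A
    + gammaLoop V ∘ₗ toLoop 𝔨 ∘ₗ LinearMap.fst ℂ (Current 𝔨) A
    + gammaA V ∘ₗ LinearMap.snd ℂ (Current 𝔨) A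

/-! ### `𝒜𝔤`-modules, weight modules and cuspidal modules -/

section Cuspidal

variable {𝔨 : Type v} [LieRing 𝔨] [LieAlgebra ℂ 𝔨] (M : LieSuperModule.{v, w} (Extended 𝔨))

/-- An `𝒜𝔤`-module: a `𝔤̃`-module on which `𝒜` acts as a unital associative algebra. -/
def IsAssociative : Prop :=
  (∀ v : M.carrier, M.act (Extended.ofA 1) v = v) ∧
    ∀ (f g : A) (v : M.carrier),
      M.act (Extended.ofA (f * g)) v = M.act (Extended.ofA f) (M.act (Extended.ofA g) v)

/-- The weight spaces are the eigenspaces of `L₀`. -/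
def weightSpace (μ : ℂ) : Submodule ℂ M.carrier :=
  Module.End.eigenspace (M.act (Extended.ofS (L 0))) μ

/-- A weight module: `L₀` acts diagonalizably. -/
def IsWeight : Prop := ⨆ μ : ℂ, weightSpace M μ = ⊤

/-- A cuspidal module: a weight module whose weight spaces have uniformly bounded finite
dimension. -/
def IsCuspidal : Prop :=
  IsWeight M ∧ ∃ N : ℕ, ∀ μ : ℂ, Module.rank ℂ (weightSpace M μ) ≤ N

/-- `M` is isomorphic to `Γ(λ, V)` or to `Π Γ(λ, V)`: there is a linear bijection
`M ≃ 𝒜 ⊗ V` that commutes with the actions of `𝔤̃` and that either preserves parities (`p = 0`)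
or exchanges them (`p = 1`). -/
def IsoGammaUpToParity (lam : ℂ) (V : LieSuperModule.{v, w} (a0 𝔨).toSubmodule) : Prop :=
  ∃ e : M.carrier ≃ₗ[ℂ] A ⊗[ℂ] V.carrier,
    (∃ p : ZMod 2, ∀ i : ZMod 2, ∀ m ∈ grade i, e m ∈ grade (i + p)) ∧
      ∀ (x : Extended 𝔨) (m : M.carrier), e (M.act x m) = gammaAct lam V x (e m)

end Cuspidal

end Gamma

end Ramond

end

/-! In `Γ(λ, V)` the subspace `1 ⊗ V` is cut out by two equations, `L₀ v = λ v` and `G₀ v = λ ξ v`.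
The proof reads this backwards: `vac M lam` is the solution space of these equations in `M`. On `M`
one has `G₀² = -L₀`, `G₀ ξ + ξ G₀ = -1` and `ξ² = 0`, so `(G₀ - λ ξ)² = λ - L₀` vanishes on the
weight space of `λ`. Hence `G₀ - λ ξ` sends a weight vector outside `vac` to a nonzero vector of
`vac` (`exists_ne_zero_mem_vac`).

Solving the formulas of the tensor module for the operators on `V` gives the operators `ellOp`,
`gamOp`, `chiOp`, `etaOp` on `M`, and these preserve `vac`. Therefore `𝒜 · vac` is a submodule,
equal to `M` by simplicity (`map₂_eq_top`). The map `𝒜 ⊗ vac → M` is also injective: `L₀` separates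
the powers of `t`, and `G₀` separates `1` from `ξ` (`vacMap_bijective`). So `vac` is a model of the
fibre `M / 𝔪 M`. As `(t - 1) 𝔰̄` maps `𝒜` into `𝔪`, the algebra `𝔞₀` acts on this fibre
(`vacModule`); its generators act there by the four families, and `M` is `Γ(λ, vac)` without
exchange of parities (`iso_gamma_vacModule`). The fibre is simple, because a nonzero submodule `W`
has `𝒜 W = M` and projects to `W`. It is finite-dimensional, because it lies in one weight space.

It remains to see that the kernel of `𝔞₀ → R ⋉ 𝔤̇` kills every finite-dimensional simple `𝔞₀`-module
`V` (`act_eq_zero_of_a0ToRSemi`). Let `E = L₀ - L₋₁`, which is `(t - 1) d/dt` on Laurent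
polynomials. Since `ad E` has finitely many eigenvalues on `End V`, the elements `(t - 1)ᵏ⁺¹ d/dt`
act by zero for large `k`, and brackets spread this to all elements of high order at `t = 1`
(`exists_vanish`). The order is then lowered step by step. Modulo higher order, `ad E` multiplies
the next layer by a nonzero constant, so some nonzero vector is killed by the whole layer
(`exists_ne_zero_killed_of_shift`); the common kernel is a submodule, hence all of `V`. The
constants are integers on even layers and half-integers on odd ones, so only the even layer of
weight zero can survive (`vanish_of_isSimple`). -/

section GradedLinearAlgebra

/-! ### Graded linear algebra and eigenvalue arguments in finite dimension. -/

variable {V W : Type*} [AddCommGroup V] [Module ℂ V] [AddCommGroup W] [Module ℂ W]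

lemma sproj_add_sproj [SuperSpace V] (x : V) : sproj 0 x + sproj 1 x = x := by
  refine grade_induction (p := fun x => sproj 0 x + sproj 1 x = x) ?_ ?_ ?_ x
  · intro x hx; simp [sproj_of_mem hx]
  · intro x hx; simp [sproj_of_mem hx]
  · intro x y hx hy
    rw [map_add, map_add, add_add_add_comm, hx, hy]

lemma isGraded_iff [SuperSpace V] {S : Submodule ℂ V} :
    IsGraded S ↔ ∀ x ∈ S, ∀ i, sproj i x ∈ S := by
  constructor
  · intro h x hx i
    obtain ⟨a, ha, b, hb, rfl⟩ := Submodule.mem_sup.1 (h hx)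
    rw [map_add, sproj_of_mem ha.2, sproj_of_mem hb.2]
    refine S.add_mem ?_ ?_ <;> split_ifs
    exacts [ha.1, S.zero_mem, hb.1, S.zero_mem]
  · intro h x hx
    exact Submodule.mem_sup.2 ⟨_, ⟨h x hx 0, sproj_mem 0 x⟩, _, ⟨h x hx 1, sproj_mem 1 x⟩,
      sproj_add_sproj x⟩

/-- Turns homogeneity of an operator into an identity of operators. Graded kernels, homogeneous
preimages and the evenness of inverse maps are all read off from it. -/
lemma sproj_comm [SuperSpace V] [SuperSpace W] {T : V →ₗ[ℂ] W} {j : ZMod 2}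
    (hT : ∀ i, ∀ x ∈ grade i, T x ∈ grade (i + j)) (i : ZMod 2) (x : V) :
    sproj (i + j) (T x) = T (sproj i x) := by
  refine grade_induction (p := fun x => sproj (i + j) (T x) = T (sproj i x)) ?_ ?_ ?_ x
  · intro x hx
    rw [sproj_of_mem hx, sproj_of_mem (hT 0 x hx)]
    simp only [add_left_inj]; split_ifs <;> simp
  · intro x hx
    rw [sproj_of_mem hx, sproj_of_mem (hT 1 x hx)]
    simp only [add_left_inj]; split_ifs <;> simp
  · intro x y hx hy; simp only [map_add, hx, hy]

lemma isGraded_ker [SuperSpace V] [SuperSpace W] {T : V →ₗ[ℂ] W} {j : ZMod 2}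
    (hT : ∀ i, ∀ x ∈ grade i, T x ∈ grade (i + j)) : IsGraded (LinearMap.ker T) := by
  rw [isGraded_iff]
  intro x hx i
  rw [LinearMap.mem_ker, ← sproj_comm hT, LinearMap.mem_ker.1 hx, map_zero]

lemma IsGraded.inf [SuperSpace V] {S T : Submodule ℂ V} (hS : IsGraded S) (hT : IsGraded T) :
    IsGraded (S ⊓ T) := by
  rw [isGraded_iff] at *
  exact fun x hx i => ⟨hS x hx.1 i, hT x hx.2 i⟩

lemma isGraded_iInf [SuperSpace V] {ι : Sort*} {S : ι → Submodule ℂ V}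
    (hS : ∀ k, IsGraded (S k)) : IsGraded (⨅ k, S k) := by
  simp only [isGraded_iff] at *
  intro x hx i
  rw [Submodule.mem_iInf] at *
  exact fun k => hS k x (hx k) i

lemma mem_grade_iff_sproj [SuperSpace V] {i : ZMod 2} {x : V} : x ∈ grade i ↔ sproj i x = x :=
  ⟨fun h => by simp [sproj_of_mem h], fun h => h ▸ sproj_mem i x⟩

/-- A graded subspace of a super space is a super space. -/
abbrev subSuperSpace [SuperSpace V] (S : Submodule ℂ V) (hS : IsGraded S) : SuperSpace S where
  grade i := (grade i).comap S.subtype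
  isCompl := by
    constructor
    · rw [Submodule.disjoint_def]
      intro x h0 h1
      exact Subtype.ext
        (Submodule.disjoint_def.1 (SuperSpace.isCompl (V := V)).disjoint x.1 h0 h1)
    · rw [codisjoint_iff, eq_top_iff]
      rintro ⟨x, hx⟩ -
      obtain ⟨a, ha, b, hb, hab⟩ := Submodule.mem_sup.1 (hS hx)
      exact Submodule.mem_sup.2 ⟨⟨a, ha.1⟩, ha.2, ⟨b, hb.1⟩, hb.2, Subtype.ext hab⟩

/-- An operator on a nonzero finite-dimensional space has an eigenvector that is killed by every
operator that shifts eigenvalues by a fixed nonzero `c`. -/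
lemma exists_ne_zero_killed_of_shift [FiniteDimensional ℂ V] [Nontrivial V] (E : V →ₗ[ℂ] V)
    {c : ℂ} (hc : c ≠ 0) :
    ∃ x : V, x ≠ 0 ∧ ∀ T : V →ₗ[ℂ] V, (∀ y, E (T y) - T (E y) = c • T y) → T x = 0 := by
  have hfin : {μ : ℂ | Module.End.HasEigenvalue E μ}.Finite := Module.End.finite_hasEigenvalue E
  obtain ⟨μ₀, hμ₀⟩ := Module.End.exists_eigenvalue E
  -- Dividing by `c` turns the shift `μ ↦ c + μ` into a shift by `1`, so for an eigenvalue that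
  -- maximizes `Re (μ / c)` the number `c + μ` is no longer an eigenvalue.
  obtain ⟨μ, hμ, hmax⟩ := Set.exists_max_image _ (fun μ : ℂ => (μ / c).re) hfin ⟨μ₀, hμ₀⟩
  obtain ⟨x, hx⟩ := Module.End.HasEigenvalue.exists_hasEigenvector hμ
  refine ⟨x, hx.2, fun T hT => ?_⟩
  by_contra h
  have h1 := hT x
  rw [hx.apply_eq_smul, map_smul, sub_eq_iff_eq_add, ← add_smul] at h1
  have h2 := hmax (c + μ) (Module.End.hasEigenvalue_of_hasEigenvector (x := T x)
    ⟨Module.End.mem_eigenspace_iff.2 h1, h⟩)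
  simp only [add_div, div_self hc, Complex.add_re, Complex.one_re] at h2
  linarith

/-- Eigenvectors of an operator of a finite-dimensional space with eigenvalues `0, 1, 2, …`
vanish eventually. -/
lemma exists_forall_ge_eq_zero_of_eigen [FiniteDimensional ℂ V] (T : V →ₗ[ℂ] V) (x : ℕ → V)
    (hx : ∀ k, T (x k) = (k : ℂ) • x k) : ∃ K, ∀ k, K ≤ k → x k = 0 := by
  have hfin : {μ : ℂ | Module.End.HasEigenvalue T μ}.Finite := Module.End.finite_hasEigenvalue T
  have hfin' : {k : ℕ | x k ≠ 0}.Finite := by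
    refine (hfin.preimage (f := fun k : ℕ => (k : ℂ)) (Nat.cast_injective.injOn)).subset ?_
    intro k hk
    exact Module.End.hasEigenvalue_of_hasEigenvector (x := x k)
      ⟨Module.End.mem_eigenspace_iff.2 (hx k), hk⟩
  obtain ⟨K, hK⟩ := hfin'.bddAbove
  refine ⟨K + 1, fun k hk => ?_⟩
  by_contra h
  have := hK h
  omega

end GradedLinearAlgebra

/-! ### Descent of modules along surjective homomorphisms. -/

section Descent

variable {L L' : Type v} [AddCommGroup L] [Module ℂ L] [SuperSpace L] [LieSuperalgebra L]
  [AddCommGroup L'] [Module ℂ L'] [SuperSpace L'] [LieSuperalgebra L']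

/-- A module on which the kernel of a surjective homomorphism acts by zero is the pullback of a
module over the target. -/
lemma LieSuperModule.exists_pullback_eq (φ : LieSuperHom L' L)
    (hφ : Function.Surjective φ.toLin) (V : LieSuperModule.{v, w} L')
    (hV : ∀ x, φ.toLin x = 0 → V.act x = 0) :
    ∃ N : LieSuperModule.{v, w} L, N.pullback φ = V := by
  have hle : LinearMap.ker φ.toLin ≤ LinearMap.ker V.act := fun x hx => hV x hx
  let e := φ.toLin.quotKerEquivOfSurjective hφ
  let α : L →ₗ[ℂ] V.carrier →ₗ[ℂ] V.carrier := (LinearMap.ker φ.toLin).liftQ V.act hle ∘ₗ e.symm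
  have hα : ∀ x, α (φ.toLin x) = V.act x := by
    intro x
    have : e.symm (φ.toLin x) = Submodule.Quotient.mk x := by
      rw [LinearEquiv.symm_apply_eq]; rfl
    simp only [α, LinearMap.comp_apply, LinearEquiv.coe_coe, this]
    rfl
  -- The module axioms speak of homogeneous elements only, so homogeneous lifts are needed; the
  -- parity component of any lift will do, since `φ` is even.
  have hom : ∀ i, ∀ y ∈ grade (V := L) i, ∃ x ∈ grade (V := L') i, φ.toLin x = y := by
    intro i y hy
    obtain ⟨x, rfl⟩ := hφ y
    refine ⟨sproj i x, sproj_mem i x, ?_⟩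
    rw [← sproj_comm (j := 0) (fun i x hx => by rw [add_zero]; exact φ.mem hx), add_zero]
    exact mem_grade_iff_sproj.1 hy
  refine ⟨{ carrier := V.carrier, act := α, act_mem := ?_, act_br := ?_ }, ?_⟩
  · intro i j x v hx hv
    obtain ⟨x, hx', rfl⟩ := hom i x hx
    rw [hα]; exact V.act_mem hx' hv
  · intro i j x y hx hy v
    obtain ⟨x, hx', rfl⟩ := hom i x hx
    obtain ⟨y, hy', rfl⟩ := hom j y hy
    rw [← φ.map_br, hα, hα, hα]; exact V.act_br hx' hy' v
  · have hcomp : α ∘ₗ φ.toLin = V.act := LinearMap.ext hα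
    -- With `α` opaque and `hcomp` kept, `V` can be destructured, and the equality of modules
    -- becomes the equality of the two actions.
    clear_value α
    cases V
    simp only [LieSuperModule.pullback, LieSuperModule.mk.injEq, heq_eq_eq, true_and]
    exact hcomp

/-- A subspace stable under `L` is stable under `L'` acting through `φ`; this direction does not
need `φ` to be surjective. -/
lemma LieSuperModule.isSimple_of_pullback (φ : LieSuperHom L' L) (N : LieSuperModule.{v, w} L)
    (h : (N.pullback φ).IsSimple) : N.IsSimple :=
  ⟨h.1, fun W hW hinv => h.2 W hW fun x v hv => hinv (φ.toLin x) v hv⟩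

end Descent

noncomputable section

namespace Ramond

/-! ### The derivation `t d/dt` on powers of `t - 1`. -/

/-- `D` lowers the order of vanishing at `t = 1` by one. The leading coefficient `k + 1` is the
source of the weights of the Euler field used later. -/
lemma D_tm1_pow_succ_mul (k : ℕ) (f : P) :
    D (tm1 ^ (k + 1) * f) =
      tm1 ^ k * (((k : P) + 1) * LaurentPolynomial.T 1 * f + tm1 * D f) := by
  have h : D (tm1 ^ (k + 1)) = tm1 ^ k * (((k : P) + 1) * LaurentPolynomial.T 1) := by
    induction k with
    | zero => simp [D_tm1]
    | succ k ih => rw [pow_succ, D_mul, ih, D_tm1]; push_cast; ring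
  rw [D_mul, h]; ring

/-- The factor `t - 1` in front keeps the exponent at `k`, so `k = 0` is included without a
truncated `k - 1`. -/
lemma tm1_mul_D_tm1_pow_mul (k : ℕ) (f : P) :
    tm1 * D (tm1 ^ k * f) = tm1 ^ k * ((k : P) * LaurentPolynomial.T 1 * f + tm1 * D f) := by
  have h := D_tm1_pow_succ_mul k f
  rw [pow_succ', mul_assoc, D_mul, D_tm1] at h
  linear_combination h

lemma T_neg_one_mul_T_one : (LaurentPolynomial.T (-1) : P) * LaurentPolynomial.T 1 = 1 := by
  rw [← LaurentPolynomial.T_add]; simp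

lemma D_T_neg_one : D (LaurentPolynomial.T (-1)) = -LaurentPolynomial.T (-1) := by
  simp [D_T]

lemma T_one_eq : (LaurentPolynomial.T 1 : P) = tm1 + 1 := by simp [tm1]

/-! ### The algebra `𝔞₀`: generators, brackets, and their operators on a module. -/

section Operators

variable {𝔨 : Type v} [LieRing 𝔨] [LieAlgebra ℂ 𝔨]

lemma Current_ext {p q : Current 𝔨} (h : toS 𝔨 p = toS 𝔨 q) (h' : toLoop 𝔨 p = toLoop 𝔨 q) :
    p = q := Prod.ext h h'

lemma a0_ext {x y : (a0 𝔨).toSubmodule} (h : toS 𝔨 x.1 = toS 𝔨 y.1)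
    (h' : toLoop 𝔨 x.1 = toLoop 𝔨 y.1) : x = y := Subtype.ext (Current_ext h h')

lemma coe_br_a0 (x y : (a0 𝔨).toSubmodule) : (br x y).1 = br x.1 y.1 := rfl

lemma mem_grade_a0 {i : ZMod 2} {x : (a0 𝔨).toSubmodule} :
    x ∈ grade i ↔ toS 𝔨 x.1 ∈ grade i ∧ toLoop 𝔨 x.1 ∈ grade i := Iff.rfl

variable (𝔨) in
/-- The inclusion of `𝔰̄` in `𝔤`. -/
def curS : SBar →ₗ[ℂ] Current 𝔨 where
  toFun a := cur a 0
  map_add' a b := Current_ext (by simp) (by simp)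
  map_smul' c a := Current_ext (by simp) (by simp)

lemma toS_curS (a : SBar) : toS 𝔨 (curS 𝔨 a) = a := rfl
lemma toLoop_curS (a : SBar) : toLoop 𝔨 (curS 𝔨 a) = 0 := rfl

variable (𝔨) in
/-- `a ↦ (t - 1) a`, from `𝔰̄` to `𝔞₀`. -/
def a0Mul : SBar →ₗ[ℂ] (a0 𝔨).toSubmodule :=
  LinearMap.codRestrict _ (curS 𝔨 ∘ₗ aSmul (ev tm1)) fun a => by
    have h : aSmul (ev tm1) a ∈ tsPow 1 := by rw [tsPow, pow_one]; exact ⟨a, rfl⟩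
    exact h

lemma toS_a0Mul (a : SBar) : toS 𝔨 (a0Mul 𝔨 a).1 = aSmul (ev tm1) a := rfl
lemma toLoop_a0Mul (a : SBar) : toLoop 𝔨 (a0Mul 𝔨 a).1 = 0 := rfl
lemma toS_a0Loop (w : Loop 𝔨) : toS 𝔨 (a0Loop w).1 = 0 := rfl
lemma toLoop_a0Loop (w : Loop 𝔨) : toLoop 𝔨 (a0Loop w).1 = w := rfl

lemma aSmul_tm1_elt (f g : P) : aSmul (ev tm1) (elt f g) = elt (tm1 * f) (tm1 * g) := by
  apply SBar_ext <;> simp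

/-- Both components in `𝔰̄` are divided by `t - 1`. The cofactors are exported because
`act_eq_zero_of_a0ToRSemi` has to find a second factor `t - 1` in `f`. -/
lemma a0_eq_a0Mul_add (y : (a0 𝔨).toSubmodule) :
    ∃ f g : P, tm1 * f = sL (toS 𝔨 y.1) ∧ tm1 * g = sG (toS 𝔨 y.1) ∧
      y = a0Mul 𝔨 (elt f 0) + a0Mul 𝔨 (elt 0 g) + a0Loop (toLoop 𝔨 y.1) := by
  obtain ⟨⟨f, hf⟩, ⟨g, hg⟩⟩ := mem_tsPow.1 (show toS 𝔨 y.1 ∈ tsPow 1 from y.2)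
  rw [pow_one] at hf hg
  refine ⟨f, g, hf.symm, hg.symm, a0_ext ?_ ?_⟩
  · rw [Submodule.coe_add, Submodule.coe_add, map_add, map_add, toS_a0Mul, toS_a0Mul, toS_a0Loop]
    apply SBar_ext <;> simp [hf, hg]
  · rw [Submodule.coe_add, Submodule.coe_add, map_add, map_add, toLoop_a0Mul, toLoop_a0Mul,
      toLoop_a0Loop]
    simp

/-- As `(t - 1) 𝔰̄` is parametrized by `𝔰̄`, the bracket has to be divided by `t - 1`; the quotient
`c` is supplied by the caller. -/
lemma br_a0Mul_a0Mul (a b : SBar) (c : SBar)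
    (h : br (aSmul (ev tm1) a) (aSmul (ev tm1) b) = aSmul (ev tm1) c) :
    br (a0Mul 𝔨 a) (a0Mul 𝔨 b) = a0Mul 𝔨 c := by
  apply a0_ext
  · rw [coe_br_a0, toS_br, toS_a0Mul, toS_a0Mul, toS_a0Mul, h]
  · rw [coe_br_a0, toLoop_br, toLoop_a0Mul, toLoop_a0Mul, toLoop_a0Mul]
    simp only [map_zero, sub_zero, add_zero]

lemma br_a0Mul_a0Loop (a : SBar) (w : Loop 𝔨) : br (a0Mul 𝔨 a) (a0Loop w) =
    a0Loop (LinearMap.rTensor (PureEven 𝔨) (sAct (aSmul (ev tm1) a)) w) := by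
  apply a0_ext
  · rw [coe_br_a0, toS_br, toS_a0Loop, toS_a0Loop, map_zero]
  · rw [coe_br_a0, toLoop_br, toLoop_a0Mul, toS_a0Mul, toLoop_a0Loop, toLoop_a0Loop, toS_a0Loop,
      map_zero, map_zero, LinearMap.zero_apply, sub_zero, add_zero]

lemma br_a0Loop_a0Loop (w z : Loop 𝔨) : br (a0Loop w) (a0Loop z) = a0Loop (loopBr w z) := by
  apply a0_ext
  · rw [coe_br_a0, toS_br, toS_a0Loop, toS_a0Loop, toS_a0Loop, map_zero]
  · rw [coe_br_a0, toLoop_br, toS_a0Loop, toS_a0Loop, toLoop_a0Loop, toLoop_a0Loop,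
      toLoop_a0Loop, map_zero, map_zero, LinearMap.rTensor_zero, LinearMap.zero_apply,
      LinearMap.zero_apply, sub_zero, zero_add]

lemma aSmul_tm1_mem {i : ZMod 2} {a : SBar} (ha : a ∈ grade i) : aSmul (ev tm1) a ∈ grade i := by
  rcases parity_cases i with rfl | rfl <;> simp only [mem_S0, mem_S1] at * <;> simp [ha]

lemma a0Mul_mem {i : ZMod 2} {a : SBar} (ha : a ∈ grade i) : a0Mul 𝔨 a ∈ grade i := by
  rw [mem_grade_a0, toS_a0Mul, toLoop_a0Mul]
  exact ⟨aSmul_tm1_mem ha, Submodule.zero_mem _⟩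

lemma a0Loop_mem {i : ZMod 2} {w : Loop 𝔨} (hw : w ∈ grade i) : a0Loop w ∈ grade i := by
  rw [mem_grade_a0, toS_a0Loop, toLoop_a0Loop]
  exact ⟨Submodule.zero_mem _, hw⟩

lemma elt_even (f : P) : elt f 0 ∈ grade 0 := by simp [mem_S0]
lemma elt_odd (f : P) : elt 0 f ∈ grade 1 := by simp [mem_S1]
lemma ev_mem (f : P) : ev f ∈ grade 0 := by simp [mem_A0]
lemma od_mem (f : P) : od f ∈ grade 1 := by simp [mem_A1]

variable (V : LieSuperModule.{v, w} (a0 𝔨).toSubmodule)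

/-- The operator of `(t - 1) ∑ fᵢ Lᵢ`. -/
def lOp (f : P) : V.carrier →ₗ[ℂ] V.carrier := V.act (a0Mul 𝔨 (elt f 0))

/-- The operator of `(t - 1) ∑ fᵢ Gᵢ`. -/
def gOp (f : P) : V.carrier →ₗ[ℂ] V.carrier := V.act (a0Mul 𝔨 (elt 0 f))

/-- The operator of `x ⊗ f`. -/
def xOp (x : PureEven 𝔨) (f : P) : V.carrier →ₗ[ℂ] V.carrier := V.act (a0Loop (ev f ⊗ₜ x))

/-- The operator of `x ⊗ f ξ`. -/
def yOp (x : PureEven 𝔨) (f : P) : V.carrier →ₗ[ℂ] V.carrier := V.act (a0Loop (od f ⊗ₜ x))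

lemma elt_add (f g f' g' : P) : elt (f + f') (g + g') = elt f g + elt f' g' := rfl
lemma elt_smul (c : ℂ) (f g : P) : elt (c • f) (c • g) = c • elt f g := rfl

lemma lOp_add (f g : P) : lOp V (f + g) = lOp V f + lOp V g := by
  rw [lOp, ← add_zero (0 : P), elt_add]; simp only [map_add]; rfl
lemma lOp_smul (c : ℂ) (f : P) : lOp V (c • f) = c • lOp V f := by
  rw [lOp, ← smul_zero (A := P) c, elt_smul]; simp only [map_smul]; rfl
lemma gOp_add (f g : P) : gOp V (f + g) = gOp V f + gOp V g := by
  rw [gOp, ← add_zero (0 : P), elt_add]; simp only [map_add]; rfl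
lemma gOp_smul (c : ℂ) (f : P) : gOp V (c • f) = c • gOp V f := by
  rw [gOp, ← smul_zero (A := P) c, elt_smul]; simp only [map_smul]; rfl
lemma xOp_add (x : PureEven 𝔨) (f g : P) : xOp V x (f + g) = xOp V x f + xOp V x g := by
  simp only [xOp, map_add, TensorProduct.add_tmul]
lemma xOp_smul (x : PureEven 𝔨) (c : ℂ) (f : P) : xOp V x (c • f) = c • xOp V x f := by
  simp only [xOp, map_smul, ← TensorProduct.smul_tmul']
lemma yOp_add (x : PureEven 𝔨) (f g : P) : yOp V x (f + g) = yOp V x f + yOp V x g := by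
  simp only [yOp, map_add, TensorProduct.add_tmul]
lemma yOp_smul (x : PureEven 𝔨) (c : ℂ) (f : P) : yOp V x (c • f) = c • yOp V x f := by
  simp only [yOp, map_smul, ← TensorProduct.smul_tmul']

/-- In this and the following relations the arguments of `lOp` and `gOp` omit one factor `t - 1`.
Each relation is solved for one order of the two operators, so that rewriting moves an operator past
another onto a vector that it kills. -/
lemma lOp_lOp (f g : P) (v : V.carrier) : lOp V f (lOp V g v) =
    lOp V g (lOp V f v) + lOp V (f * D (tm1 * g) - g * D (tm1 * f)) v := by
  have h := V.act_br (a0Mul_mem (𝔨 := 𝔨) (elt_even f)) (a0Mul_mem (elt_even g)) v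
  rw [br_a0Mul_a0Mul (c := elt (f * D (tm1 * g) - g * D (tm1 * f)) 0), sgn_zero_left,
    one_smul] at h
  · rw [lOp, lOp, lOp, h]; abel
  · simp only [aSmul_tm1_elt]
    apply SBar_ext <;> simp [br]; ring

lemma lOp_gOp (f g : P) (v : V.carrier) : lOp V f (gOp V g v) =
    gOp V g (lOp V f v) + gOp V (f * D (tm1 * g) - (1 / 2 : ℂ) • (D (tm1 * f) * g)) v := by
  have h := V.act_br (a0Mul_mem (𝔨 := 𝔨) (elt_even f)) (a0Mul_mem (elt_odd g)) v
  rw [br_a0Mul_a0Mul (c := elt 0 (f * D (tm1 * g) - (1 / 2 : ℂ) • (D (tm1 * f) * g))),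
    sgn_zero_left, one_smul] at h
  · rw [lOp, gOp, gOp, h]; abel
  · simp only [aSmul_tm1_elt]
    apply SBar_ext <;> simp [br, Algebra.smul_def]; ring

lemma gOp_gOp (f g : P) (v : V.carrier) : gOp V f (gOp V g v) =
    -gOp V g (gOp V f v) + lOp V ((-2 : ℂ) • (tm1 * (f * g))) v := by
  have h := V.act_br (a0Mul_mem (𝔨 := 𝔨) (elt_odd f)) (a0Mul_mem (elt_odd g)) v
  rw [br_a0Mul_a0Mul (c := elt ((-2 : ℂ) • (tm1 * (f * g))) 0), sgn_one_one] at h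
  · rw [lOp, gOp, gOp, h]; simp
  · simp only [aSmul_tm1_elt]
    apply SBar_ext <;> simp [br, Algebra.smul_def]; ring

lemma lOp_xOp (f : P) (x : PureEven 𝔨) (g : P) (v : V.carrier) : lOp V f (xOp V x g v) =
    xOp V x g (lOp V f v) + xOp V x (tm1 * f * D g) v := by
  have h := V.act_br (a0Mul_mem (𝔨 := 𝔨) (elt_even f)) (a0Loop_mem (tmul_mem_loop (ev_mem g) x)) v
  rw [br_a0Mul_a0Loop, LinearMap.rTensor_tmul, aSmul_tm1_elt, sgn_zero_left, one_smul,
    show sAct (elt (tm1 * f) (tm1 * 0)) (ev g) = ev (tm1 * f * D g) by apply A_ext <;> simp] at h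
  rw [lOp, xOp, xOp, h]; abel

lemma lOp_yOp (f : P) (x : PureEven 𝔨) (g : P) (v : V.carrier) : lOp V f (yOp V x g v) =
    yOp V x g (lOp V f v) + yOp V x (tm1 * f * D g + (1 / 2 : ℂ) • (D (tm1 * f) * g)) v := by
  have h := V.act_br (a0Mul_mem (𝔨 := 𝔨) (elt_even f)) (a0Loop_mem (tmul_mem_loop (od_mem g) x)) v
  rw [br_a0Mul_a0Loop, LinearMap.rTensor_tmul, aSmul_tm1_elt, sgn_zero_left, one_smul,
    show sAct (elt (tm1 * f) (tm1 * 0)) (od g) =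
      od (tm1 * f * D g + (1 / 2 : ℂ) • (D (tm1 * f) * g)) by apply A_ext <;> simp] at h
  rw [lOp, yOp, yOp, h]; abel

lemma gOp_xOp (f : P) (x : PureEven 𝔨) (g : P) (v : V.carrier) : gOp V f (xOp V x g v) =
    xOp V x g (gOp V f v) + yOp V x (tm1 * f * D g) v := by
  have h := V.act_br (a0Mul_mem (𝔨 := 𝔨) (elt_odd f)) (a0Loop_mem (tmul_mem_loop (ev_mem g) x)) v
  rw [br_a0Mul_a0Loop, LinearMap.rTensor_tmul, aSmul_tm1_elt, sgn_zero_right, one_smul,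
    show sAct (elt (tm1 * 0) (tm1 * f)) (ev g) = od (tm1 * f * D g) by apply A_ext <;> simp] at h
  rw [gOp, xOp, yOp, h]; abel

lemma gOp_yOp (f : P) (x : PureEven 𝔨) (g : P) (v : V.carrier) : gOp V f (yOp V x g v) =
    -yOp V x g (gOp V f v) + xOp V x ((-1 : ℂ) • (tm1 * f * g)) v := by
  have h := V.act_br (a0Mul_mem (𝔨 := 𝔨) (elt_odd f)) (a0Loop_mem (tmul_mem_loop (od_mem g) x)) v
  rw [br_a0Mul_a0Loop, LinearMap.rTensor_tmul, aSmul_tm1_elt, sgn_one_one,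
    show sAct (elt (tm1 * 0) (tm1 * f)) (od g) = ev ((-1 : ℂ) • (tm1 * f * g)) by
      apply A_ext <;> simp] at h
  rw [gOp, xOp, yOp, h]; simp

lemma xOp_xOp (x y : PureEven 𝔨) (f g : P) (v : V.carrier) : xOp V x f (xOp V y g v) =
    xOp V y g (xOp V x f v) + xOp V (PureEven.lie x y) (f * g) v := by
  have h := V.act_br (a0Loop_mem (tmul_mem_loop (ev_mem f) x))
    (a0Loop_mem (tmul_mem_loop (ev_mem g) y)) v
  rw [br_a0Loop_a0Loop, loopBr_tmul, sgn_zero_left, one_smul,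
    show ev f * ev g = ev (f * g) by apply A_ext <;> simp] at h
  rw [xOp, xOp, xOp, h]; abel

lemma xOp_yOp (x y : PureEven 𝔨) (f g : P) (v : V.carrier) : xOp V x f (yOp V y g v) =
    yOp V y g (xOp V x f v) + yOp V (PureEven.lie x y) (f * g) v := by
  have h := V.act_br (a0Loop_mem (tmul_mem_loop (ev_mem f) x))
    (a0Loop_mem (tmul_mem_loop (od_mem g) y)) v
  rw [br_a0Loop_a0Loop, loopBr_tmul, sgn_zero_left, one_smul,
    show ev f * od g = od (f * g) by apply A_ext <;> simp] at h
  rw [xOp, yOp, yOp, h]; abel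

/-- The bracket carries the factor `ξ² = 0`, so the two odd operators anticommute. -/
lemma yOp_yOp (x y : PureEven 𝔨) (f g : P) (v : V.carrier) : yOp V x f (yOp V y g v) =
    -yOp V y g (yOp V x f v) := by
  have h := V.act_br (a0Loop_mem (tmul_mem_loop (od_mem f) x))
    (a0Loop_mem (tmul_mem_loop (od_mem g) y)) v
  have h0 : (od f * od g) ⊗ₜ[ℂ] PureEven.lie x y = (0 : Loop 𝔨) := by
    rw [show od f * od g = 0 by apply A_ext <;> simp]; exact TensorProduct.zero_tmul _ _
  have h1 : V.act (br (a0Loop (od f ⊗ₜ x)) (a0Loop (od g ⊗ₜ y))) v = 0 := by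
    rw [br_a0Loop_a0Loop, loopBr_tmul, h0, LinearMap.map_zero, LinearMap.map_zero]; rfl
  rw [h1, sgn_one_one, neg_smul, one_smul, sub_neg_eq_add] at h
  exact eq_neg_of_add_eq_zero_left h.symm

lemma xOp_mem (x : PureEven 𝔨) (f : P) (i : ZMod 2) (v : V.carrier) (hv : v ∈ grade i) :
    xOp V x f v ∈ grade (i + 0) := by
  rw [add_comm]; exact V.act_mem (a0Loop_mem (tmul_mem_loop (ev_mem f) x)) hv
lemma yOp_mem (x : PureEven 𝔨) (f : P) (i : ZMod 2) (v : V.carrier) (hv : v ∈ grade i) :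
    yOp V x f v ∈ grade (i + 1) := by
  rw [add_comm]; exact V.act_mem (a0Loop_mem (tmul_mem_loop (od_mem f) x)) hv
lemma lOp_mem (f : P) (i : ZMod 2) (v : V.carrier) (hv : v ∈ grade i) :
    lOp V f v ∈ grade (i + 0) := by
  rw [add_comm]; exact V.act_mem (a0Mul_mem (elt_even f)) hv
lemma gOp_mem (f : P) (i : ZMod 2) (v : V.carrier) (hv : v ∈ grade i) :
    gOp V f v ∈ grade (i + 1) := by
  rw [add_comm]; exact V.act_mem (a0Mul_mem (elt_odd f)) hv

variable {V}

lemma act_a0Loop_mem {U : Submodule ℂ V.carrier} {v : V.carrier}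
    (hx : ∀ x f, xOp V x f v ∈ U) (hy : ∀ x f, yOp V x f v ∈ U) (w : Loop 𝔨) :
    V.act (a0Loop w) v ∈ U := by
  induction w using TensorProduct.induction_on with
  | zero => simp
  | add x y hx hy => rw [map_add, map_add]; exact U.add_mem hx hy
  | tmul f x =>
    rw [show f = ev (coeff0 f) + od (coeff1 f) by apply A_ext <;> simp, TensorProduct.add_tmul,
      map_add, map_add]
    exact U.add_mem (hx x _) (hy x _)

lemma act_mem_of_generators {U : Submodule ℂ V.carrier} {v : V.carrier}
    (hl : ∀ f, lOp V f v ∈ U) (hg : ∀ f, gOp V f v ∈ U)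
    (hx : ∀ x f, xOp V x f v ∈ U) (hy : ∀ x f, yOp V x f v ∈ U) (y : (a0 𝔨).toSubmodule) :
    V.act y v ∈ U := by
  obtain ⟨f, g, -, -, h⟩ := a0_eq_a0Mul_add y
  rw [h]
  simp only [map_add]
  exact U.add_mem (U.add_mem (hl f) (hg g)) (act_a0Loop_mem hx hy _)

/-- On a finite-dimensional simple module, a family of homogeneous operators vanishes if its
common kernel is a submodule and if `[E, T] = c T`, `c ≠ 0`, for all its members `T`. -/
lemma eq_zero_of_shift [FiniteDimensional ℂ V.carrier] (hs : V.IsSimple)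
    (S : Set (V.carrier →ₗ[ℂ] V.carrier))
    (hom : ∀ T ∈ S, ∃ j, ∀ i, ∀ v ∈ grade i, T v ∈ grade (i + j))
    (hl : ∀ v, (∀ T ∈ S, T v = 0) → ∀ f, ∀ T ∈ S, T (lOp V f v) = 0)
    (hg : ∀ v, (∀ T ∈ S, T v = 0) → ∀ f, ∀ T ∈ S, T (gOp V f v) = 0)
    (hx : ∀ v, (∀ T ∈ S, T v = 0) → ∀ x f, ∀ T ∈ S, T (xOp V x f v) = 0)
    (hy : ∀ v, (∀ T ∈ S, T v = 0) → ∀ x f, ∀ T ∈ S, T (yOp V x f v) = 0)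
    (E : V.carrier →ₗ[ℂ] V.carrier) {c : ℂ} (hc : c ≠ 0)
    (shift : ∀ T ∈ S, ∀ v, E (T v) - T (E v) = c • T v) : ∀ T ∈ S, T = 0 := by
  have := hs.1
  have hU : ∀ v, v ∈ (⨅ T : S, LinearMap.ker T.1) ↔ ∀ T ∈ S, T v = 0 := by
    simp [Submodule.mem_iInf]
  -- A single vector serves all members of `S` at once, which makes the common kernel nonzero; as a
  -- graded submodule it is then everything.
  obtain ⟨v, hv, hv'⟩ := exists_ne_zero_killed_of_shift E hc
  rcases hs.2 (⨅ T : S, LinearMap.ker T.1) (isGraded_iInf fun T => by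
    obtain ⟨j, hj⟩ := hom T.1 T.2
    exact isGraded_ker hj) (fun y v hv => by
      rw [hU] at hv
      exact act_mem_of_generators (fun f => (hU _).2 (hl v hv f)) (fun f => (hU _).2 (hg v hv f))
        (fun x f => (hU _).2 (hx v hv x f)) (fun x f => (hU _).2 (hy v hv x f)) y) with h | h
  · refine absurd ?_ hv
    rw [← Submodule.mem_bot ℂ, ← h, hU]
    exact fun T hT => hv' T (shift T hT)
  · intro T hT
    ext v
    exact (hU v).1 (h ▸ Submodule.mem_top) T hT

variable (V) in
/-- `(t - 1)ⁿ⁺¹ Lᵢ` and `x ⊗ (t - 1)ⁿ tⁱ` act by zero. -/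
def EvenVanish (n : ℕ) : Prop :=
  (∀ f, lOp V (tm1 ^ n * f) = 0) ∧ ∀ x f, xOp V x (tm1 ^ n * f) = 0

variable (V) in
/-- `(t - 1)ⁿ⁺¹ Gᵢ` and `x ⊗ (t - 1)ⁿ tⁱ ξ` act by zero. -/
def OddVanish (n : ℕ) : Prop :=
  (∀ f, gOp V (tm1 ^ n * f) = 0) ∧ ∀ x f, yOp V x (tm1 ^ n * f) = 0

end Operators

lemma D_tm1_mul_pow_mul (k : ℕ) (f : P) : D (tm1 * (tm1 ^ k * f)) =
    tm1 ^ k * (((k : P) + 1) * LaurentPolynomial.T 1 * f + tm1 * D f) := by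
  rw [← mul_assoc, ← pow_succ', D_tm1_pow_succ_mul]

lemma D_tm1_mul_T_neg_one : D (tm1 * LaurentPolynomial.T (-1)) = LaurentPolynomial.T (-1) := by
  rw [D_mul, D_tm1, D_T_neg_one]
  simp only [tm1]; ring

lemma natCast_mul_eq_smul (n : ℕ) (f : P) : (n : P) * f = (n : ℂ) • f := by
  rw [Algebra.smul_def, map_natCast]

/-! ### Lowering the order of vanishing on a finite-dimensional simple module. -/

section Operators

variable {𝔨 : Type v} [LieRing 𝔨] [LieAlgebra ℂ 𝔨]
variable {V : LieSuperModule.{v, w} (a0 𝔨).toSubmodule}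

/-- The shifting operator is that of `E = L₀ - L₋₁`. Modulo `ξ`-terms of higher order `E` multiplies
`(t - 1)ᵏ ξ` by `k + 1/2`, and likewise `(t - 1)ᵏ⁺¹ G`; the `1/2` is the weight of `ξ` and keeps the
constant nonzero even for `k = 0`. The common kernel of the odd layer `k` is a submodule because a
bracket of the layer with a generator stays in the layer, or has order `k + 1` and vanishes by
hypothesis, or contains `ξ²`. -/
lemma oddVanish_of_succ [FiniteDimensional ℂ V.carrier] (hs : V.IsSimple) {k : ℕ}
    (he : EvenVanish V (k + 1)) (ho : OddVanish V (k + 1)) : OddVanish V k := by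
  have key := eq_zero_of_shift hs
    {T | (∃ f, T = gOp V (tm1 ^ k * f)) ∨ ∃ x f, T = yOp V x (tm1 ^ k * f)} ?_ ?_ ?_ ?_ ?_
    (lOp V (LaurentPolynomial.T (-1))) (c := (k : ℂ) + 1 / 2) ?_ ?_
  · exact ⟨fun f => key _ (Or.inl ⟨f, rfl⟩), fun x f => key _ (Or.inr ⟨x, f, rfl⟩)⟩
  · rintro T (⟨f, rfl⟩ | ⟨x, f, rfl⟩)
    exacts [⟨1, gOp_mem V _⟩, ⟨1, yOp_mem V _ _⟩]
  · intro v hv g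
    have hG : ∀ f, gOp V (tm1 ^ k * f) v = 0 := fun f => hv _ (Or.inl ⟨f, rfl⟩)
    have hY : ∀ x f, yOp V x (tm1 ^ k * f) v = 0 := fun x f => hv _ (Or.inr ⟨x, f, rfl⟩)
    rintro T (⟨f, rfl⟩ | ⟨x, f, rfl⟩)
    · have h := lOp_gOp V g (tm1 ^ k * f) v
      rw [hG, map_zero, D_tm1_mul_pow_mul, show ∀ a b c : P,
        g * (tm1 ^ k * a) - (1 / 2 : ℂ) • (b * (tm1 ^ k * c)) =
          tm1 ^ k * (g * a - (1 / 2 : ℂ) • (b * c)) by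
            intro a b c; simp only [Algebra.smul_def]; ring, hG, add_zero] at h
      exact h.symm
    · have h := lOp_yOp V g x (tm1 ^ k * f) v
      rw [hY, map_zero, mul_right_comm, tm1_mul_D_tm1_pow_mul, show ∀ a b c : P,
        tm1 ^ k * a * g + (1 / 2 : ℂ) • (b * (tm1 ^ k * c)) =
          tm1 ^ k * (a * g + (1 / 2 : ℂ) • (b * c)) by
            intro a b c; simp only [Algebra.smul_def]; ring, hY, add_zero] at h
      exact h.symm
  · intro v hv g
    have hG : ∀ f, gOp V (tm1 ^ k * f) v = 0 := fun f => hv _ (Or.inl ⟨f, rfl⟩)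
    have hY : ∀ x f, yOp V x (tm1 ^ k * f) v = 0 := fun x f => hv _ (Or.inr ⟨x, f, rfl⟩)
    rintro T (⟨f, rfl⟩ | ⟨x, f, rfl⟩)
    -- The anticommutator of two odd elements gains a factor `t - 1`, so it falls under the even
    -- hypothesis at order `k + 1`.
    · rw [gOp_gOp, hG, lOp_smul, show tm1 * (tm1 ^ k * f * g) = tm1 ^ (k + 1) * (f * g) by ring,
        he.1]
      simp
    · have h := gOp_yOp V g x (tm1 ^ k * f) v
      rw [hY, map_zero, xOp_smul, show tm1 * g * (tm1 ^ k * f) = tm1 ^ (k + 1) * (g * f) by ring,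
        he.2, smul_zero, LinearMap.zero_apply, add_zero] at h
      exact neg_eq_zero.1 h.symm
  · intro v hv y g
    have hG : ∀ f, gOp V (tm1 ^ k * f) v = 0 := fun f => hv _ (Or.inl ⟨f, rfl⟩)
    have hY : ∀ x f, yOp V x (tm1 ^ k * f) v = 0 := fun x f => hv _ (Or.inr ⟨x, f, rfl⟩)
    rintro T (⟨f, rfl⟩ | ⟨x, f, rfl⟩)
    · rw [gOp_xOp, hG, show tm1 * (tm1 ^ k * f) * D g = tm1 ^ (k + 1) * (f * D g) by ring, ho.2]
      simp
    · have h := xOp_yOp V y x g (tm1 ^ k * f) v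
      rw [hY, map_zero, mul_left_comm, hY, add_zero] at h
      exact h.symm
  · intro v hv y g
    have hG : ∀ f, gOp V (tm1 ^ k * f) v = 0 := fun f => hv _ (Or.inl ⟨f, rfl⟩)
    have hY : ∀ x f, yOp V x (tm1 ^ k * f) v = 0 := fun x f => hv _ (Or.inr ⟨x, f, rfl⟩)
    rintro T (⟨f, rfl⟩ | ⟨x, f, rfl⟩)
    · rw [gOp_yOp, hG, xOp_smul,
        show tm1 * (tm1 ^ k * f) * g = tm1 ^ (k + 1) * (f * g) by ring, he.2]
      simp
    · rw [yOp_yOp, hY]; simp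
  · have h : ((k : ℂ) + 1 / 2) = ((2 * k + 1 : ℕ) : ℂ) / 2 := by push_cast; ring
    rw [h]
    exact div_ne_zero (Nat.cast_ne_zero.2 (by omega)) two_ne_zero
  · rintro T (⟨f, rfl⟩ | ⟨x, f, rfl⟩) v
    -- Leading term plus remainder: replacing `t` by `(t - 1) + 1` leaves the constant `k + 1/2` on
    -- the layer and pushes everything else to order `k + 1`, where `ho` applies.
    · have e : LaurentPolynomial.T (-1) * D (tm1 * (tm1 ^ k * f)) - (1 / 2 : ℂ) •
          (D (tm1 * LaurentPolynomial.T (-1)) * (tm1 ^ k * f)) =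
          ((k : ℂ) + 1 / 2) • (tm1 ^ k * f) + tm1 ^ (k + 1) *
            (LaurentPolynomial.T (-1) * (D f + (1 / 2 : ℂ) • f)) := by
        rw [D_tm1_mul_pow_mul, D_tm1_mul_T_neg_one, add_smul, ← natCast_mul_eq_smul]
        have h1 := T_neg_one_mul_T_one
        have h2 := algebraMap_half
        rw [T_one_eq] at h1 ⊢
        simp only [Algebra.smul_def, one_div]
        generalize algebraMap ℂ P 2⁻¹ = h at *
        linear_combination ((k : P) + 1 - h) * tm1 ^ k * f * h1 - tm1 ^ k * f * h2
      rw [lOp_gOp, add_sub_cancel_left, e, gOp_add, gOp_smul, ho.1, add_zero]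
      rfl
    · have e : tm1 * LaurentPolynomial.T (-1) * D (tm1 ^ k * f) + (1 / 2 : ℂ) •
          (D (tm1 * LaurentPolynomial.T (-1)) * (tm1 ^ k * f)) =
          ((k : ℂ) + 1 / 2) • (tm1 ^ k * f) + tm1 ^ (k + 1) *
            (LaurentPolynomial.T (-1) * (D f - (1 / 2 : ℂ) • f)) := by
        rw [mul_right_comm, tm1_mul_D_tm1_pow_mul, D_tm1_mul_T_neg_one, add_smul,
          ← natCast_mul_eq_smul]
        have h1 := T_neg_one_mul_T_one
        rw [T_one_eq] at h1 ⊢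
        simp only [Algebra.smul_def, one_div]
        generalize algebraMap ℂ P 2⁻¹ = h at *
        linear_combination ((k : P) + h) * tm1 ^ k * f * h1
      rw [lOp_yOp, add_sub_cancel_left, e, yOp_add, yOp_smul, ho.2, add_zero]
      rfl

/-- The same argument for an even layer, on which `E` has weight `k + 1`. Brackets with odd
generators land in odd elements of order `k + 1`, which is why the odd vanishing must already have
reached that order. The layer `0` is out of reach: its weight would be `0`, and this is where `(t -
1) L₀` and `x ⊗ 1` live. -/
lemma evenVanish_of_succ [FiniteDimensional ℂ V.carrier] (hs : V.IsSimple) {k : ℕ}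
    (he : EvenVanish V (k + 2)) (ho : OddVanish V (k + 1)) : EvenVanish V (k + 1) := by
  have key := eq_zero_of_shift hs
    {T | (∃ f, T = lOp V (tm1 ^ (k + 1) * f)) ∨ ∃ x f, T = xOp V x (tm1 ^ (k + 1) * f)}
    ?_ ?_ ?_ ?_ ?_ (lOp V (LaurentPolynomial.T (-1))) (c := ((k + 1 : ℕ) : ℂ)) ?_ ?_
  · exact ⟨fun f => key _ (Or.inl ⟨f, rfl⟩), fun x f => key _ (Or.inr ⟨x, f, rfl⟩)⟩
  · rintro T (⟨f, rfl⟩ | ⟨x, f, rfl⟩)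
    exacts [⟨0, lOp_mem V _⟩, ⟨0, xOp_mem V _ _⟩]
  · intro v hv g
    have hL : ∀ f, lOp V (tm1 ^ (k + 1) * f) v = 0 := fun f => hv _ (Or.inl ⟨f, rfl⟩)
    have hX : ∀ x f, xOp V x (tm1 ^ (k + 1) * f) v = 0 := fun x f => hv _ (Or.inr ⟨x, f, rfl⟩)
    rintro T (⟨f, rfl⟩ | ⟨x, f, rfl⟩)
    · rw [lOp_lOp, hL, map_zero, D_tm1_mul_pow_mul, show ∀ a b c : P,
        tm1 ^ (k + 1) * a * b - g * (tm1 ^ (k + 1) * c) = tm1 ^ (k + 1) * (a * b - g * c) by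
            intro a b c; ring, hL, add_zero]
    · have h := lOp_xOp V g x (tm1 ^ (k + 1) * f) v
      rw [hX, map_zero, mul_right_comm, tm1_mul_D_tm1_pow_mul, mul_assoc, hX, add_zero] at h
      exact h.symm
  · intro v hv g
    have hL : ∀ f, lOp V (tm1 ^ (k + 1) * f) v = 0 := fun f => hv _ (Or.inl ⟨f, rfl⟩)
    have hX : ∀ x f, xOp V x (tm1 ^ (k + 1) * f) v = 0 := fun x f => hv _ (Or.inr ⟨x, f, rfl⟩)
    rintro T (⟨f, rfl⟩ | ⟨x, f, rfl⟩)
    · rw [lOp_gOp, hL, map_zero, D_tm1_mul_pow_mul, show ∀ a b c : P,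
        tm1 ^ (k + 1) * a * b - (1 / 2 : ℂ) • (tm1 ^ (k + 1) * c * g) =
          tm1 ^ (k + 1) * (a * b - (1 / 2 : ℂ) • (c * g)) by
            intro a b c; simp only [Algebra.smul_def]; ring, ho.1]
      simp
    · have h := gOp_xOp V g x (tm1 ^ (k + 1) * f) v
      rw [hX, map_zero, mul_right_comm, tm1_mul_D_tm1_pow_mul, mul_assoc, ho.2,
        LinearMap.zero_apply, add_zero] at h
      exact h.symm
  · intro v hv y g
    have hL : ∀ f, lOp V (tm1 ^ (k + 1) * f) v = 0 := fun f => hv _ (Or.inl ⟨f, rfl⟩)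
    have hX : ∀ x f, xOp V x (tm1 ^ (k + 1) * f) v = 0 := fun x f => hv _ (Or.inr ⟨x, f, rfl⟩)
    rintro T (⟨f, rfl⟩ | ⟨x, f, rfl⟩)
    · rw [lOp_xOp, hL, map_zero,
        show tm1 * (tm1 ^ (k + 1) * f) * D g = tm1 ^ (k + 2) * (f * D g) by ring, he.2]
      simp
    · rw [xOp_xOp, hX, map_zero, mul_assoc, hX, add_zero]
  · intro v hv y g
    have hL : ∀ f, lOp V (tm1 ^ (k + 1) * f) v = 0 := fun f => hv _ (Or.inl ⟨f, rfl⟩)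
    have hX : ∀ x f, xOp V x (tm1 ^ (k + 1) * f) v = 0 := fun x f => hv _ (Or.inr ⟨x, f, rfl⟩)
    rintro T (⟨f, rfl⟩ | ⟨x, f, rfl⟩)
    · rw [lOp_yOp, hL, map_zero, D_tm1_mul_pow_mul, show ∀ a b c : P,
        tm1 * (tm1 ^ (k + 1) * a) * b + (1 / 2 : ℂ) • (tm1 ^ (k + 1) * c * g) =
          tm1 ^ (k + 1) * (tm1 * a * b + (1 / 2 : ℂ) • (c * g)) by
            intro a b c; simp only [Algebra.smul_def]; ring, ho.2]
      simp
    · rw [xOp_yOp, hX, map_zero, mul_assoc, ho.2]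
      simp
  · exact Nat.cast_ne_zero.2 (by omega)
  · rintro T (⟨f, rfl⟩ | ⟨x, f, rfl⟩) v
    · have e : LaurentPolynomial.T (-1) * D (tm1 * (tm1 ^ (k + 1) * f)) -
          tm1 ^ (k + 1) * f * D (tm1 * LaurentPolynomial.T (-1)) =
          ((k + 1 : ℕ) : ℂ) • (tm1 ^ (k + 1) * f) + tm1 ^ (k + 2) *
            (LaurentPolynomial.T (-1) * (D f + f)) := by
        rw [D_tm1_mul_pow_mul, D_tm1_mul_T_neg_one, ← natCast_mul_eq_smul]
        have h1 := T_neg_one_mul_T_one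
        rw [T_one_eq] at h1 ⊢
        push_cast
        linear_combination ((k : P) + 1) * tm1 ^ (k + 1) * f * h1
      rw [lOp_lOp, add_sub_cancel_left, e, lOp_add, lOp_smul, he.1, add_zero]
      rfl
    · have e : tm1 * LaurentPolynomial.T (-1) * D (tm1 ^ (k + 1) * f) =
          ((k + 1 : ℕ) : ℂ) • (tm1 ^ (k + 1) * f) + tm1 ^ (k + 2) *
            (LaurentPolynomial.T (-1) * D f) := by
        rw [mul_right_comm, tm1_mul_D_tm1_pow_mul, ← natCast_mul_eq_smul]
        have h1 := T_neg_one_mul_T_one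
        push_cast
        linear_combination ((k : P) + 1) * tm1 ^ (k + 1) * f * h1
      rw [lOp_xOp, add_sub_cancel_left, e, xOp_add, xOp_smul, he.2, add_zero]
      rfl

end Operators

/-! ### Vanishing in high order, and factorization through `R ⋉ 𝔤̇`. -/

section Operators

variable {𝔨 : Type v} [LieRing 𝔨] [LieAlgebra ℂ 𝔨]
variable (V : LieSuperModule.{v, w} (a0 𝔨).toSubmodule)

lemma D_T_one : D (LaurentPolynomial.T 1) = LaurentPolynomial.T 1 := by simp [D_T]

variable {V} in
-- Compare the bracket of `g h` with `f` and that of `g` with `h f`: both act by zero, and their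
-- difference is `-2 (t - 1) f g D h`. Two vanishing elements thus yield a whole ideal of them,
-- since `g` is arbitrary.
lemma lOp_eq_zero_of_mul {f h : P} (h0 : lOp V f = 0) (h1 : lOp V (h * f) = 0) (g : P) :
    lOp V (tm1 * f * g * D h) = 0 := by
  ext v
  have a := lOp_lOp V (g * h) f v
  have b := lOp_lOp V g (h * f) v
  simp only [h0, h1, LinearMap.zero_apply, map_zero, zero_add] at a b
  have c : tm1 * f * g * D h = (-1 / 2 : ℂ) • ((g * h * D (tm1 * f) - f * D (tm1 * (g * h))) +
      (-1 : ℂ) • (g * D (tm1 * (h * f)) - h * f * D (tm1 * g))) := by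
    simp only [D_mul]
    have h3 := algebraMap_half
    rw [show (-1 / 2 : ℂ) = -2⁻¹ by norm_num]
    simp only [Algebra.smul_def, map_neg, map_one]
    generalize algebraMap ℂ P 2⁻¹ = u at *
    linear_combination -tm1 * f * g * D h * h3
  rw [c, lOp_smul, lOp_add, lOp_smul]
  simp only [LinearMap.smul_apply, LinearMap.add_apply]
  rw [← a, ← b, smul_zero, add_zero, smul_zero]
  rfl

variable {V} in
-- The device of `lOp_eq_zero_of_mul` with an odd second argument: moving `h` from one side of the
-- bracket to the other changes it by `-3/2` times the claimed element.
lemma gOp_eq_zero_of_mul {f h : P} (h0 : lOp V f = 0) (h1 : lOp V (f * h) = 0) (g : P) :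
    gOp V (tm1 * f * g * D h) = 0 := by
  ext v
  have a := lOp_gOp V (f * h) g v
  have b := lOp_gOp V f (h * g) v
  simp only [h0, h1, LinearMap.zero_apply, map_zero, zero_add] at a b
  have c : tm1 * f * g * D h = (-2 / 3 : ℂ) •
      ((f * h * D (tm1 * g) - (1 / 2 : ℂ) • (D (tm1 * (f * h)) * g)) +
      (-1 : ℂ) • (f * D (tm1 * (h * g)) - (1 / 2 : ℂ) • (D (tm1 * f) * (h * g)))) := by
    simp only [D_mul]
    have h3 := algebraMap_half
    have h4 : algebraMap ℂ P 3⁻¹ * 3 = 1 := by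
      rw [← map_ofNat (algebraMap ℂ P) 3, ← map_mul]; simp
    rw [show (-2 / 3 : ℂ) = -(2 * 3⁻¹) by norm_num]
    simp only [Algebra.smul_def, map_neg, map_one, map_mul, map_ofNat, one_div]
    generalize algebraMap ℂ P 2⁻¹ = u at *
    generalize algebraMap ℂ P 3⁻¹ = u' at *
    linear_combination -tm1 * f * g * D h * (u' * h3 + h4)
  rw [c, gOp_smul, gOp_add, gOp_smul]
  simp only [LinearMap.smul_apply, LinearMap.add_apply]
  rw [← a, ← b, smul_zero, add_zero, smul_zero]
  rfl

variable {V} in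
-- Again `h` is moved across the bracket; here the difference is `-1/2` times the claimed element.
lemma yOp_eq_zero_of_mul {f h : P} (h0 : lOp V f = 0) (h1 : lOp V (f * h) = 0)
    (x : PureEven 𝔨) (g : P) : yOp V x (tm1 * f * g * D h) = 0 := by
  ext v
  have a := lOp_yOp V (f * h) x g v
  have b := lOp_yOp V f x (h * g) v
  simp only [h0, h1, LinearMap.zero_apply, map_zero, zero_add] at a b
  have c : tm1 * f * g * D h = (-2 : ℂ) •
      ((tm1 * (f * h) * D g + (1 / 2 : ℂ) • (D (tm1 * (f * h)) * g)) +
      (-1 : ℂ) • (tm1 * f * D (h * g) + (1 / 2 : ℂ) • (D (tm1 * f) * (h * g)))) := by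
    simp only [D_mul]
    have h3 := algebraMap_half
    simp only [Algebra.smul_def, map_neg, map_one, map_ofNat, one_div]
    generalize algebraMap ℂ P 2⁻¹ = u at *
    linear_combination tm1 * f * g * D h * h3
  rw [c, yOp_smul, yOp_add, yOp_smul]
  simp only [LinearMap.smul_apply, LinearMap.add_apply]
  rw [← a, ← b, smul_zero, add_zero, smul_zero]
  rfl

/-- The elements `(t - 1)ᵏ⁺¹ d/dt` are exact eigenvectors of `ad E` with eigenvalue `k`, so their
operators vanish from some `K` on. Two consecutive ones then generate an ideal by
`lOp_eq_zero_of_mul`. -/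
lemma exists_lOp_vanish [FiniteDimensional ℂ V.carrier] :
    ∃ n : ℕ, ∀ f, lOp V (tm1 ^ n * f) = 0 := by
  obtain ⟨K, hK⟩ := exists_forall_ge_eq_zero_of_eigen
    (LinearMap.mulLeft ℂ (lOp V (LaurentPolynomial.T (-1)) : Module.End ℂ V.carrier) -
      LinearMap.mulRight ℂ (lOp V (LaurentPolynomial.T (-1))))
    (fun k => lOp V (tm1 ^ k * LaurentPolynomial.T (-1))) (fun k => by
      ext v
      have e : LaurentPolynomial.T (-1) * D (tm1 * (tm1 ^ k * LaurentPolynomial.T (-1))) -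
          tm1 ^ k * LaurentPolynomial.T (-1) * D (tm1 * LaurentPolynomial.T (-1)) =
          (k : ℂ) • (tm1 ^ k * LaurentPolynomial.T (-1)) := by
        rw [D_tm1_mul_pow_mul, D_tm1_mul_T_neg_one, D_T_neg_one, ← natCast_mul_eq_smul]
        have h1 := T_neg_one_mul_T_one
        rw [T_one_eq] at h1 ⊢
        linear_combination ((k : P)) * tm1 ^ k * LaurentPolynomial.T (-1) * h1
      have h := lOp_lOp V (LaurentPolynomial.T (-1)) (tm1 ^ k * LaurentPolynomial.T (-1)) v
      rw [e, lOp_smul] at h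
      exact sub_eq_iff_eq_add'.2 h)
  refine ⟨K + 1, fun g => ?_⟩
  -- With `h = t - 1` the factor `D h = t` cancels the `t⁻¹` in the eigenvectors, leaving `(t -
  -- 1)ᴷ⁺¹ g`.
  have h := lOp_eq_zero_of_mul (h := tm1) (hK K le_rfl)
    (by rw [← mul_assoc, ← pow_succ']; exact hK (K + 1) (Nat.le_succ K)) g
  rw [D_tm1] at h
  rw [← h]
  congr 1
  linear_combination (-tm1 ^ (K + 1) * g) * T_neg_one_mul_T_one

/-- Brackets with elements `(t - 1)ⁿ⁺¹ f L`, which already act by zero, produce the other three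
families. The auxiliary element is `t`: it is a unit with `D t = t`, so no order is lost beyond one
factor `t - 1`. -/
lemma exists_vanish [FiniteDimensional ℂ V.carrier] :
    ∃ n : ℕ, EvenVanish V n ∧ OddVanish V n := by
  obtain ⟨n, hn⟩ := exists_lOp_vanish V
  have e : ∀ f, tm1 ^ (n + 1) * f =
      tm1 * (tm1 ^ n * LaurentPolynomial.T (-1)) * f * D (LaurentPolynomial.T 1) := fun f => by
    rw [D_T_one]
    linear_combination (-tm1 ^ (n + 1) * f) * T_neg_one_mul_T_one
  refine ⟨n + 1, ⟨fun f => ?_, fun x f => ?_⟩, ⟨fun f => ?_, fun x f => ?_⟩⟩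
  · rw [pow_succ, mul_assoc, hn]
  · ext v
    have a := lOp_xOp V (tm1 ^ n * (LaurentPolynomial.T (-1) * f)) x (LaurentPolynomial.T 1) v
    rw [hn, LinearMap.zero_apply, LinearMap.zero_apply, map_zero, zero_add] at a
    rw [LinearMap.zero_apply, a, e, mul_assoc tm1, mul_assoc (tm1 ^ n)]
  · rw [e]
    exact gOp_eq_zero_of_mul (hn _) (by rw [mul_assoc]; exact hn _) f
  · rw [e]
    exact yOp_eq_zero_of_mul (hn _) (by rw [mul_assoc]; exact hn _) x f

variable {V}

/-- The two lowering steps alternate: the odd order drops first, and this is what allows the even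
order to drop. The process ends at even order `1` and odd order `0`, the last layers with nonzero
weight. -/
lemma vanish_of_isSimple [FiniteDimensional ℂ V.carrier] (hs : V.IsSimple) :
    EvenVanish V 1 ∧ OddVanish V 0 := by
  obtain ⟨n, he, ho⟩ := exists_vanish V
  have key : ∀ n, EvenVanish V (n + 1) → OddVanish V (n + 1) →
      EvenVanish V 1 ∧ OddVanish V 0 := by
    intro n
    induction n with
    | zero => exact fun he ho => ⟨he, oddVanish_of_succ hs he ho⟩
    | succ n ih =>
      intro he ho
      have ho' := oddVanish_of_succ hs he ho
      exact ih (evenVanish_of_succ hs he ho') ho'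
  -- `key` starts at order `n + 1`; vanishing at order `n` implies it, one factor `t - 1` being
  -- moved into the argument.
  refine key n ⟨fun f => ?_, fun x f => ?_⟩ ⟨fun f => ?_, fun x f => ?_⟩ <;>
    rw [pow_succ, mul_assoc]
  exacts [he.1 _, he.2 _ _, ho.1 _, ho.2 _ _]

/-- Every `tⁱ` is congruent to `1` modulo `t - 1`, and multiples of `t - 1` act by zero. -/
lemma xOp_eq_evalOne_smul (h : EvenVanish V 1) (x : PureEven 𝔨) (f : P) :
    xOp V x f = evalOne f • xOp V x 1 := by
  let F : P →ₗ[ℂ] V.carrier →ₗ[ℂ] V.carrier :=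
    ⟨⟨xOp V x, xOp_add V x⟩, xOp_smul V x⟩
  have : F = evalOne.toLinearMap.smulRight (xOp V x 1) := by
    refine P_ext fun i => ?_
    obtain ⟨q, hq⟩ := tm1_dvd i
    have e : (LaurentPolynomial.T i : P) = 1 + tm1 ^ 1 * q := by rw [pow_one, ← hq]; ring
    change xOp V x _ = evalOne (LaurentPolynomial.T i) • xOp V x 1
    rw [e, xOp_add, h.2, map_add, map_mul, pow_one, evalOne_tm1, map_one, zero_mul, add_zero,
      add_zero, one_smul]
  exact LinearMap.congr_fun this f

/-- On a finite-dimensional simple `𝔞₀`-module, the kernel of `𝔞₀ → R ⋉ 𝔤̇` acts by zero. -/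
lemma act_eq_zero_of_a0ToRSemi [FiniteDimensional ℂ V.carrier] (hs : V.IsSimple)
    (y : (a0 𝔨).toSubmodule) (hy : (a0ToRSemi 𝔨).toLin y = 0) : V.act y = 0 := by
  obtain ⟨he, ho⟩ := vanish_of_isSimple hs
  have h1 : toS 𝔨 y.1 ∈ tsPow 2 :=
    (Submodule.Quotient.mk_eq_zero tsSq.toSubmodule).1 (congrArg Prod.fst hy)
  have h2 : loopEval 𝔨 (toLoop 𝔨 y.1) = 0 := congrArg Prod.snd hy
  obtain ⟨f, g, hf, hg, e⟩ := a0_eq_a0Mul_add y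
  obtain ⟨⟨f', hf'⟩, -⟩ := mem_tsPow.1 h1
  have hf2 : f = tm1 ^ 1 * f' := by
    -- Otherwise `t = D (t - 1)` would be zero, although it is a unit.
    have hne : tm1 ≠ 0 := fun h => by
      have := D_tm1
      rw [h, map_zero] at this
      have h1 := T_neg_one_mul_T_one
      rw [← this, mul_zero] at h1
      exact zero_ne_one h1
    rw [← hf, pow_two, mul_assoc] at hf'
    rw [pow_one, mul_left_cancel₀ hne hf']
  have hl : ∀ w : Loop 𝔨, V.act (a0Loop w) = xOp V (loopEval 𝔨 w) 1 := by
    intro w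
    induction w using TensorProduct.induction_on with
    | zero => simp [xOp]
    | add x y hx hy =>
      rw [map_add, map_add, hx, hy, map_add]
      simp only [xOp, TensorProduct.tmul_add, map_add]
    | tmul f x =>
      have e : f ⊗ₜ[ℂ] x = ev (coeff0 f) ⊗ₜ x + od (coeff1 f) ⊗ₜ[ℂ] x := by
        rw [← TensorProduct.add_tmul]; congr 1; apply A_ext <;> simp
      -- Odd elements act by zero altogether, by `OddVanish V 0`; hence the loop part acts through
      -- evaluation at `t = 1`, `ξ = 0`.
      have hy0 : yOp V x (coeff1 f) = 0 := by simpa using ho.2 x (coeff1 f)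
      rw [loopEval_tmul, e, map_add, map_add]
      change xOp V x _ + yOp V x _ = _
      rw [hy0, add_zero, xOp_eq_evalOne_smul he]
      simp only [xOp, TensorProduct.tmul_smul, map_smul]
      rfl
  rw [e, map_add, map_add, hl, h2]
  change lOp V f + gOp V g + _ = 0
  rw [hf2, he.1, show gOp V g = 0 by simpa using ho.1 g]
  simp [xOp]

lemma a0ToRSemi_surjective : Function.Surjective (a0ToRSemi 𝔨).toLin := by
  rintro ⟨r, x⟩
  obtain ⟨⟨a, ha⟩, rfl⟩ := Submodule.Quotient.mk_surjective _ r
  refine ⟨⟨cur a ((1 : A) ⊗ₜ x), ha⟩, Prod.ext rfl ?_⟩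
  change loopEval 𝔨 ((1 : A) ⊗ₜ x) = x
  rw [loopEval_tmul]
  simp [aug]

end Operators

/-! ### Components, brackets and spanning elements of `𝔤̃`. -/

section ExtendedAlgebra

variable {𝔨 : Type v} [LieRing 𝔨] [LieAlgebra ℂ 𝔨]

variable (𝔨) in
/-- The projection of `𝔤̃ = 𝔤 ⋉ 𝒜` to `𝔤`. -/
def extToCur : Extended 𝔨 →ₗ[ℂ] Current 𝔨 := LinearMap.fst ℂ (Current 𝔨) A

variable (𝔨) in
/-- The linear projection of `𝔤̃ = 𝔤 ⋉ 𝒜` to `𝒜`. -/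
def extToA : Extended 𝔨 →ₗ[ℂ] A := LinearMap.snd ℂ (Current 𝔨) A

variable (𝔨) in
/-- The inclusion of `𝔤` in `𝔤̃`. -/
def ofCur : Current 𝔨 →ₗ[ℂ] Extended 𝔨 := LinearMap.inl ℂ (Current 𝔨) A

lemma Extended_ext {x y : Extended 𝔨} (h : extToCur 𝔨 x = extToCur 𝔨 y)
    (h' : extToA 𝔨 x = extToA 𝔨 y) : x = y := Prod.ext h h'

lemma extToCur_ofCur (p : Current 𝔨) : extToCur 𝔨 (ofCur 𝔨 p) = p := rfl
lemma extToA_ofCur (p : Current 𝔨) : extToA 𝔨 (ofCur 𝔨 p) = 0 := rfl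
lemma extToCur_ofA (f : A) : extToCur 𝔨 (Extended.ofA f) = 0 := rfl
lemma extToA_ofA (f : A) : extToA 𝔨 (Extended.ofA f) = f := rfl

variable (𝔨) in
/-- The inclusion of `𝒜` in `𝔤̃`. -/
def extA : A →ₗ[ℂ] Extended 𝔨 := LinearMap.inr ℂ (Current 𝔨) A

variable (𝔨) in
/-- The inclusion of `𝔤̇ ⊗ 𝒜` in `𝔤`. -/
def curLoop : Loop 𝔨 →ₗ[ℂ] Current 𝔨 where
  toFun w := cur 0 w
  map_add' a b := Current_ext (by simp) (by simp)
  map_smul' c a := Current_ext (by simp) (by simp)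

lemma toS_curLoop (w : Loop 𝔨) : toS 𝔨 (curLoop 𝔨 w) = 0 := rfl
lemma toLoop_curLoop (w : Loop 𝔨) : toLoop 𝔨 (curLoop 𝔨 w) = w := rfl

lemma ofS_eq (a : SBar) : (Extended.ofS a : Extended 𝔨) = ofCur 𝔨 (curS 𝔨 a) := rfl
lemma ofLoop_eq (w : Loop 𝔨) : Extended.ofLoop w = ofCur 𝔨 (curLoop 𝔨 w) := rfl

lemma extToCur_br (x y : Extended 𝔨) :
    extToCur 𝔨 (br x y) = br (extToCur 𝔨 x) (extToCur 𝔨 y) := rfl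

lemma extToA_br (x y : Extended 𝔨) : extToA 𝔨 (br x y) =
    (currentAct 𝔨).toLin (extToCur 𝔨 x) (extToA 𝔨 y)
      - (currentAct 𝔨).twist (extToCur 𝔨 y) (extToA 𝔨 x) + br (extToA 𝔨 x) (extToA 𝔨 y) := rfl

lemma currentAct_toLin (p : Current 𝔨) (f : A) :
    (currentAct 𝔨).toLin p f = sAct (toS 𝔨 p) f := rfl

lemma br_A (f g : A) : br f g = 0 := rfl

lemma br_ofCur_ofCur (p q : Current 𝔨) : br (ofCur 𝔨 p) (ofCur 𝔨 q) = ofCur 𝔨 (br p q) := by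
  apply Extended_ext
  · rw [extToCur_br, extToCur_ofCur, extToCur_ofCur, extToCur_ofCur]
  · rw [extToA_br, extToA_ofCur, extToA_ofCur, extToA_ofCur, br_A, map_zero, map_zero]
    simp

lemma br_ofCur_ofA (p : Current 𝔨) (f : A) :
    br (ofCur 𝔨 p) (Extended.ofA f) = Extended.ofA (sAct (toS 𝔨 p) f) := by
  apply Extended_ext
  · rw [extToCur_br, extToCur_ofA, extToCur_ofA, map_zero]
  · rw [extToA_br, extToA_ofCur, extToA_ofA, extToCur_ofCur, extToA_ofA, br_A, map_zero,
      currentAct_toLin, sub_zero, add_zero]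

lemma br_curS_curS (a b : SBar) : br (curS 𝔨 a) (curS 𝔨 b) = curS 𝔨 (br a b) := by
  apply Current_ext
  · rw [toS_br, toS_curS, toS_curS, toS_curS]
  · rw [toLoop_br, toLoop_curS, toLoop_curS, toLoop_curS, map_zero, map_zero, map_zero]
    simp

lemma br_curS_curLoop (a : SBar) (w : Loop 𝔨) : br (curS 𝔨 a) (curLoop 𝔨 w) =
    curLoop 𝔨 (LinearMap.rTensor (PureEven 𝔨) (sAct a) w) := by
  apply Current_ext
  · rw [toS_br, toS_curLoop, toS_curLoop, map_zero]
  · rw [toLoop_br, toLoop_curS, toS_curS, toLoop_curLoop, toLoop_curLoop,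
      map_zero, map_zero, LinearMap.zero_apply, sub_zero, add_zero]

lemma mem_grade_extended {i : ZMod 2} {x : Extended 𝔨} :
    x ∈ grade i ↔ extToCur 𝔨 x ∈ grade i ∧ extToA 𝔨 x ∈ grade i := Iff.rfl

lemma mem_grade_current {i : ZMod 2} {p : Current 𝔨} :
    p ∈ grade i ↔ toS 𝔨 p ∈ grade i ∧ toLoop 𝔨 p ∈ grade i := Iff.rfl

lemma ofCur_mem {i : ZMod 2} {p : Current 𝔨} (hp : p ∈ grade i) : ofCur 𝔨 p ∈ grade i := by
  rw [mem_grade_extended, extToCur_ofCur, extToA_ofCur]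
  exact ⟨hp, Submodule.zero_mem _⟩

lemma ofA_mem {i : ZMod 2} {f : A} (hf : f ∈ grade i) :
    (Extended.ofA f : Extended 𝔨) ∈ grade i := by
  rw [mem_grade_extended, extToCur_ofA, extToA_ofA]
  exact ⟨Submodule.zero_mem _, hf⟩

lemma curS_mem {i : ZMod 2} {a : SBar} (ha : a ∈ grade i) : curS 𝔨 a ∈ grade i := by
  rw [mem_grade_current, toS_curS, toLoop_curS]
  exact ⟨ha, Submodule.zero_mem _⟩

lemma curLoop_mem {i : ZMod 2} {w : Loop 𝔨} (hw : w ∈ grade i) : curLoop 𝔨 w ∈ grade i := by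
  rw [mem_grade_current, toS_curLoop, toLoop_curLoop]
  exact ⟨Submodule.zero_mem _, hw⟩

lemma L_mem (i : ℤ) : L i ∈ grade 0 := elt_even _
lemma G_mem (i : ℤ) : G i ∈ grade 1 := elt_odd _
lemma te_mem (i : ℤ) : te i ∈ grade 0 := ev_mem _
lemma tx_mem (i : ℤ) : tx i ∈ grade 1 := od_mem _

lemma SBar_linear_ext {W : Type*} [AddCommGroup W] [Module ℂ W] {F F' : SBar →ₗ[ℂ] W}
    (hL : ∀ i, F (L i) = F' (L i)) (hG : ∀ i, F (G i) = F' (G i)) : F = F' := by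
  have h1 : F ∘ₗ LinearMap.inl ℂ P P = F' ∘ₗ LinearMap.inl ℂ P P := P_ext hL
  have h2 : F ∘ₗ LinearMap.inr ℂ P P = F' ∘ₗ LinearMap.inr ℂ P P := P_ext hG
  ext a
  have : a = LinearMap.inl ℂ P P (sL a) + LinearMap.inr ℂ P P (sG a) := by
    apply SBar_ext
    · exact (add_zero _).symm
    · exact (zero_add _).symm
  rw [this]
  exact (map_add F _ _).trans ((congrArg₂ (· + ·) (LinearMap.congr_fun h1 _)
    (LinearMap.congr_fun h2 _)).trans (map_add F' _ _).symm)

lemma A_linear_ext {W : Type*} [AddCommGroup W] [Module ℂ W] {F F' : A →ₗ[ℂ] W}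
    (h0 : ∀ i, F (te i) = F' (te i)) (h1 : ∀ i, F (tx i) = F' (tx i)) : F = F' := by
  have h0 : F ∘ₗ ev = F' ∘ₗ ev := P_ext h0
  have h1 : F ∘ₗ od = F' ∘ₗ od := P_ext h1
  ext f
  rw [show f = ev (coeff0 f) + od (coeff1 f) by apply A_ext <;> simp, map_add, map_add]
  exact congrArg₂ (· + ·) (LinearMap.congr_fun h0 _) (LinearMap.congr_fun h1 _)

/-- Besides identities, this reduces stability of a subspace to generators, by composing with the
quotient map; see `map₂_eq_top`. -/
lemma Extended_linear_ext {W : Type*} [AddCommGroup W] [Module ℂ W] {F F' : Extended 𝔨 →ₗ[ℂ] W}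
    (hL : ∀ i, F (Extended.ofS (L i)) = F' (Extended.ofS (L i)))
    (hG : ∀ i, F (Extended.ofS (G i)) = F' (Extended.ofS (G i)))
    (hX : ∀ i x, F (Extended.ofLoop (te i ⊗ₜ x)) = F' (Extended.ofLoop (te i ⊗ₜ x)))
    (hY : ∀ i x, F (Extended.ofLoop (tx i ⊗ₜ x)) = F' (Extended.ofLoop (tx i ⊗ₜ x)))
    (hA : ∀ f, F (Extended.ofA f) = F' (Extended.ofA f)) : F = F' := by
  have h1 : F ∘ₗ ofCur 𝔨 ∘ₗ curS 𝔨 = F' ∘ₗ ofCur 𝔨 ∘ₗ curS 𝔨 := SBar_linear_ext hL hG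
  have h2 : F ∘ₗ ofCur 𝔨 ∘ₗ curLoop 𝔨 = F' ∘ₗ ofCur 𝔨 ∘ₗ curLoop 𝔨 := by
    refine TensorProduct.ext ?_
    exact A_linear_ext (fun i => LinearMap.ext (hX i)) (fun i => LinearMap.ext (hY i))
  refine LinearMap.ext fun x => ?_
  have hx : x = ofCur 𝔨 (curS 𝔨 (toS 𝔨 (extToCur 𝔨 x))) +
      ofCur 𝔨 (curLoop 𝔨 (toLoop 𝔨 (extToCur 𝔨 x))) + Extended.ofA (extToA 𝔨 x) := by
    apply Extended_ext
    · rw [map_add, map_add, extToCur_ofCur, extToCur_ofCur, extToCur_ofA, add_zero]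
      apply Current_ext
      · rw [map_add, toS_curS, toS_curLoop, add_zero]
      · rw [map_add, toLoop_curS, toLoop_curLoop, zero_add]
    · rw [map_add, map_add, extToA_ofCur, extToA_ofCur, extToA_ofA, add_zero, zero_add]
  rw [hx]
  simp only [map_add]
  exact congrArg₂ (· + ·) (congrArg₂ (· + ·) (LinearMap.congr_fun h1 _)
    (LinearMap.congr_fun h2 _)) (hA _)

end ExtendedAlgebra

/-! ### Operators of `𝔤̃` on a module and their commutators. -/

section Action

variable {𝔨 : Type v} [LieRing 𝔨] [LieAlgebra ℂ 𝔨] (M : LieSuperModule.{v, w} (Extended 𝔨))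

/-- The operator of `Lᵢ`. -/
def lAct (i : ℤ) : M.carrier →ₗ[ℂ] M.carrier := M.act (Extended.ofS (L i))

/-- The operator of `Gᵢ`. -/
def gAct (i : ℤ) : M.carrier →ₗ[ℂ] M.carrier := M.act (Extended.ofS (G i))

/-- The operator of `x ⊗ tⁱ`. -/
def xAct (i : ℤ) (x : PureEven 𝔨) : M.carrier →ₗ[ℂ] M.carrier :=
  M.act (Extended.ofLoop (te i ⊗ₜ x))

/-- The operator of `x ⊗ tⁱ ξ`. -/
def yAct (i : ℤ) (x : PureEven 𝔨) : M.carrier →ₗ[ℂ] M.carrier :=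
  M.act (Extended.ofLoop (tx i ⊗ₜ x))

/-- The operator of `f ∈ 𝒜`. -/
def aAct : A →ₗ[ℂ] M.carrier →ₗ[ℂ] M.carrier := M.act ∘ₗ extA 𝔨

lemma lAct_grade (i : ℤ) (j : ZMod 2) (v : M.carrier) (hv : v ∈ grade j) :
    lAct M i v ∈ grade (j + 0) := by
  rw [add_comm]; exact M.act_mem (ofCur_mem (curS_mem (L_mem i))) hv
lemma gAct_grade (i : ℤ) (j : ZMod 2) (v : M.carrier) (hv : v ∈ grade j) :
    gAct M i v ∈ grade (j + 1) := by
  rw [add_comm]; exact M.act_mem (ofCur_mem (curS_mem (G_mem i))) hv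
lemma aAct_grade {k : ZMod 2} {f : A} (hf : f ∈ grade k) (j : ZMod 2) (v : M.carrier)
    (hv : v ∈ grade j) : aAct M f v ∈ grade (j + k) := by
  rw [add_comm]; exact M.act_mem (ofA_mem hf) hv

/-- The relation `[p, f] = p · f` of `𝔤̃`, read as a Leibniz rule on `M`. -/
lemma act_ofCur_aAct {i j : ZMod 2} {p : Current 𝔨} {f : A} (hp : p ∈ grade i)
    (hf : f ∈ grade j) (v : M.carrier) : M.act (ofCur 𝔨 p) (aAct M f v) =
      sgn i j • aAct M f (M.act (ofCur 𝔨 p) v) + aAct M (sAct (toS 𝔨 p) f) v := by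
  have h := M.act_br (ofCur_mem hp) (ofA_mem (𝔨 := 𝔨) hf) v
  rw [br_ofCur_ofA] at h
  replace h : aAct M (sAct (toS 𝔨 p) f) v = M.act (ofCur 𝔨 p) (aAct M f v) -
    sgn i j • aAct M f (M.act (ofCur 𝔨 p) v) := h
  rw [h]; abel

lemma even_aAct {p : Current 𝔨} (hp : p ∈ grade 0) (f : A) (v : M.carrier) :
    M.act (ofCur 𝔨 p) (aAct M f v) =
      aAct M f (M.act (ofCur 𝔨 p) v) + aAct M (sAct (toS 𝔨 p) f) v := by
  refine grade_induction (p := fun f => M.act (ofCur 𝔨 p) (aAct M f v) =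
      aAct M f (M.act (ofCur 𝔨 p) v) + aAct M (sAct (toS 𝔨 p) f) v) ?_ ?_ ?_ f
  · intro f hf; rw [act_ofCur_aAct M hp hf, sgn_zero_left, one_smul]
  · intro f hf; rw [act_ofCur_aAct M hp hf, sgn_zero_left, one_smul]
  · intro f g hf hg
    simp only [map_add, LinearMap.add_apply, hf, hg]; abel

/-- The sign `(-1)^{|f|}` is carried by `parityAut`, which makes both sides linear in `f` and
removes the homogeneity assumption. -/
lemma odd_aAct {p : Current 𝔨} (hp : p ∈ grade 1) (f : A) (v : M.carrier) :
    M.act (ofCur 𝔨 p) (aAct M f v) =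
      aAct M (parityAut f) (M.act (ofCur 𝔨 p) v) + aAct M (sAct (toS 𝔨 p) f) v := by
  refine grade_induction (p := fun f => M.act (ofCur 𝔨 p) (aAct M f v) =
      aAct M (parityAut f) (M.act (ofCur 𝔨 p) v) + aAct M (sAct (toS 𝔨 p) f) v) ?_ ?_ ?_ f
  · intro f hf
    rw [act_ofCur_aAct M hp hf, sgn_zero_right, one_smul, parityAut_even hf]
  · intro f hf
    rw [act_ofCur_aAct M hp hf, sgn_one_one, parityAut_odd hf, map_neg, LinearMap.neg_apply,
      neg_smul, one_smul]
  · intro f g hf hg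
    simp only [map_add, LinearMap.add_apply, hf, hg]; abel

lemma lAct_aAct (i : ℤ) (f : A) (v : M.carrier) : lAct M i (aAct M f v) =
    aAct M f (lAct M i v) + aAct M (sAct (L i) f) v :=
  even_aAct M (curS_mem (L_mem i)) f v

lemma gAct_aAct (i : ℤ) (f : A) (v : M.carrier) : gAct M i (aAct M f v) =
    aAct M (parityAut f) (gAct M i v) + aAct M (sAct (G i) f) v :=
  odd_aAct M (curS_mem (G_mem i)) f v

lemma xAct_aAct (i : ℤ) (x : PureEven 𝔨) (f : A) (v : M.carrier) : xAct M i x (aAct M f v) =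
    aAct M f (xAct M i x v) := by
  have h := even_aAct M (curLoop_mem (tmul_mem_loop (te_mem i) x)) f v
  rwa [toS_curLoop, map_zero, LinearMap.zero_apply, map_zero, LinearMap.zero_apply, add_zero] at h

lemma yAct_aAct (i : ℤ) (x : PureEven 𝔨) (f : A) (v : M.carrier) : yAct M i x (aAct M f v) =
    aAct M (parityAut f) (yAct M i x v) := by
  have h := odd_aAct M (curLoop_mem (tmul_mem_loop (tx_mem i) x)) f v
  rwa [toS_curLoop, map_zero, LinearMap.zero_apply, map_zero, LinearMap.zero_apply, add_zero] at h

lemma act_br_S {i j : ZMod 2} {a b : SBar} (ha : a ∈ grade i) (hb : b ∈ grade j)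
    (v : M.carrier) : M.act (Extended.ofS (br a b)) v =
      M.act (Extended.ofS a) (M.act (Extended.ofS b) v) -
        sgn i j • M.act (Extended.ofS b) (M.act (Extended.ofS a) v) := by
  have h := M.act_br (ofCur_mem (curS_mem (𝔨 := 𝔨) ha)) (ofCur_mem (curS_mem hb)) v
  rwa [br_ofCur_ofCur, br_curS_curS] at h

lemma act_br_S_loop {i j : ZMod 2} {a : SBar} {f : A} (ha : a ∈ grade i) (hf : f ∈ grade j)
    (x : PureEven 𝔨) (v : M.carrier) : M.act (Extended.ofLoop (sAct a f ⊗ₜ x)) v =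
      M.act (Extended.ofS a) (M.act (Extended.ofLoop (f ⊗ₜ x)) v) -
        sgn i j • M.act (Extended.ofLoop (f ⊗ₜ x)) (M.act (Extended.ofS a) v) := by
  have h := M.act_br (ofCur_mem (curS_mem (𝔨 := 𝔨) ha))
    (ofCur_mem (curLoop_mem (tmul_mem_loop hf x))) v
  rwa [br_ofCur_ofCur, br_curS_curLoop, LinearMap.rTensor_tmul] at h

lemma act_ofS_smul (c : ℂ) (a : SBar) (v : M.carrier) :
    M.act (Extended.ofS (c • a)) v = c • M.act (Extended.ofS a) v := by
  rw [ofS_eq, map_smul, map_smul, map_smul]; rfl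

lemma act_ofLoop_smul (c : ℂ) (f : A) (x : PureEven 𝔨) (v : M.carrier) :
    M.act (Extended.ofLoop ((c • f) ⊗ₜ x)) v = c • M.act (Extended.ofLoop (f ⊗ₜ x)) v := by
  rw [ofLoop_eq, ← TensorProduct.smul_tmul', map_smul, map_smul, map_smul]; rfl

/-- Only brackets with `L₀` and `G₀` are needed from here on, since these two operators define
`vac`. -/
lemma lAct_zero_lAct (i : ℤ) (v : M.carrier) :
    lAct M 0 (lAct M i v) = lAct M i (lAct M 0 v) + (i : ℂ) • lAct M i v := by
  have h := act_br_S M (L_mem 0) (L_mem i) v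
  rw [br_L_L, act_ofS_smul, sgn_zero_left, one_smul, zero_add, Int.cast_zero, sub_zero] at h
  simp only [lAct, h]; abel

lemma lAct_zero_gAct (i : ℤ) (v : M.carrier) :
    lAct M 0 (gAct M i v) = gAct M i (lAct M 0 v) + (i : ℂ) • gAct M i v := by
  have h := act_br_S M (L_mem 0) (G_mem i) v
  rw [br_L_G, act_ofS_smul, sgn_zero_left, one_smul, zero_add, Int.cast_zero, zero_div,
    sub_zero] at h
  simp only [lAct, gAct, h]; abel

lemma gAct_zero_lAct (i : ℤ) (v : M.carrier) :
    gAct M 0 (lAct M i v) = lAct M i (gAct M 0 v) + ((i : ℂ) / 2) • gAct M i v := by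
  have h := act_br_S M (L_mem i) (G_mem 0) v
  rw [br_L_G, act_ofS_smul, sgn_zero_left, one_smul, add_zero, Int.cast_zero, zero_sub,
    neg_smul] at h
  simp only [lAct, gAct, eq_add_of_sub_eq' h.symm]; abel

lemma gAct_zero_gAct (i : ℤ) (v : M.carrier) :
    gAct M 0 (gAct M i v) = -gAct M i (gAct M 0 v) - (2 : ℂ) • lAct M i v := by
  have h := act_br_S M (G_mem 0) (G_mem i) v
  rw [br_G_G, act_ofS_smul, sgn_one_one, neg_smul, neg_smul, one_smul, sub_neg_eq_add,
    zero_add] at h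
  simp only [lAct, gAct]
  rw [sub_eq_add_neg, h]; abel

lemma lAct_zero_xAct (i : ℤ) (x : PureEven 𝔨) (v : M.carrier) :
    lAct M 0 (xAct M i x v) = xAct M i x (lAct M 0 v) + (i : ℂ) • xAct M i x v := by
  have h := act_br_S_loop M (L_mem 0) (te_mem i) x v
  rw [sAct_L_te, act_ofLoop_smul, sgn_zero_left, one_smul, zero_add] at h
  simp only [lAct, xAct, h]; abel

lemma lAct_zero_yAct (i : ℤ) (x : PureEven 𝔨) (v : M.carrier) :
    lAct M 0 (yAct M i x v) = yAct M i x (lAct M 0 v) + (i : ℂ) • yAct M i x v := by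
  have h := act_br_S_loop M (L_mem 0) (tx_mem i) x v
  rw [sAct_L_tx, act_ofLoop_smul, sgn_zero_left, one_smul, zero_add, Int.cast_zero, zero_div,
    add_zero] at h
  simp only [lAct, yAct, h]; abel

lemma gAct_zero_xAct (i : ℤ) (x : PureEven 𝔨) (v : M.carrier) :
    gAct M 0 (xAct M i x v) = xAct M i x (gAct M 0 v) + (i : ℂ) • yAct M i x v := by
  have h := act_br_S_loop M (G_mem 0) (te_mem i) x v
  rw [sAct_G_te, act_ofLoop_smul, sgn_zero_right, one_smul, zero_add] at h
  simp only [gAct, xAct, yAct, h]; abel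

lemma gAct_zero_yAct (i : ℤ) (x : PureEven 𝔨) (v : M.carrier) :
    gAct M 0 (yAct M i x v) = -yAct M i x (gAct M 0 v) - xAct M i x v := by
  have h := act_br_S_loop M (G_mem 0) (tx_mem i) x v
  rw [sAct_G_tx, ← neg_one_smul ℂ, act_ofLoop_smul, sgn_one_one, zero_add, neg_smul, neg_smul,
    one_smul, one_smul, sub_neg_eq_add] at h
  simp only [gAct, xAct, yAct]
  rw [sub_eq_add_neg, h]; abel

variable {M} in
lemma aAct_mul (hA : IsAssociative M) (f g : A) (v : M.carrier) :
    aAct M f (aAct M g v) = aAct M (f * g) v := (hA.2 f g v).symm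

variable {M} in
lemma aAct_one (hA : IsAssociative M) (v : M.carrier) : aAct M 1 v = v := hA.1 v

end Action

lemma te_mul_te (i j : ℤ) : te i * te j = te (i + j) := by
  apply A_ext <;> simp [te, -LaurentPolynomial.T_mul, ← LaurentPolynomial.T_add]
lemma te_mul_tx (i j : ℤ) : te i * tx j = tx (i + j) := by
  apply A_ext <;> simp [te, tx, -LaurentPolynomial.T_mul, ← LaurentPolynomial.T_add]
lemma tx_mul_te (i j : ℤ) : tx i * te j = tx (i + j) := by
  apply A_ext <;> simp [te, tx, -LaurentPolynomial.T_mul, ← LaurentPolynomial.T_add]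
lemma tx_mul_tx (i j : ℤ) : tx i * tx j = 0 := by
  apply A_ext <;> simp [tx]
lemma te_zero : te 0 = 1 := by
  apply A_ext <;> simp [te]
lemma parityAut_te (i : ℤ) : parityAut (te i) = te i := parityAut_even (te_mem i)
lemma parityAut_tx (i : ℤ) : parityAut (tx i) = -tx i := parityAut_odd (tx_mem i)

/-! ### The space `vac` and the operators that preserve it. -/

section Vacuum

variable {𝔨 : Type v} [LieRing 𝔨] [LieAlgebra ℂ 𝔨] (M : LieSuperModule.{v, w} (Extended 𝔨))
  (lam : ℂ)

/-- The vectors `v` of weight `λ` with `G₀ v = λ ξ v`. -/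
def vac : Submodule ℂ M.carrier :=
  LinearMap.ker (lAct M 0 - lam • LinearMap.id) ⊓
    LinearMap.ker (gAct M 0 - lam • aAct M (tx 0))

variable {M lam} in
lemma mem_vac {v : M.carrier} : v ∈ vac M lam ↔
    lAct M 0 v = lam • v ∧ gAct M 0 v = lam • aAct M (tx 0) v := by
  simp [vac, sub_eq_zero]

/-- Both defining operators are homogeneous: `L₀ - λ` is even and `G₀ - λ ξ` is odd. -/
lemma vac_graded : IsGraded (vac M lam) := by
  refine IsGraded.inf (isGraded_ker (j := 0) fun i x hx => ?_)
    (isGraded_ker (j := 1) fun i x hx => ?_)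
  · exact Submodule.sub_mem _ (lAct_grade M 0 i x hx)
      (Submodule.smul_mem _ _ (by rwa [add_zero]))
  · exact Submodule.sub_mem _ (gAct_grade M 0 i x hx)
      (Submodule.smul_mem _ _ (aAct_grade M (tx_mem 0) i x hx))

/-- The operator through which `Lᵢ - L₀` acts on the vectors of `vac`. -/
def ellOp (i : ℤ) : M.carrier →ₗ[ℂ] M.carrier :=
  aAct M (te (-i)) ∘ₗ lAct M i - lam • LinearMap.id
    + ((i : ℂ) / 2) • (aAct M (tx (-i)) ∘ₗ gAct M i)

/-- The operator through which `Gᵢ - G₀` acts on the vectors of `vac`. -/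
def gamOp (i : ℤ) : M.carrier →ₗ[ℂ] M.carrier :=
  aAct M (te (-i)) ∘ₗ gAct M i + lam • aAct M (tx 0) - (2 : ℂ) • (aAct M (tx (-i)) ∘ₗ lAct M i)

/-- The operator through which `x ⊗ tⁱ` acts on the vectors of `vac`. -/
def chiOp (i : ℤ) (x : PureEven 𝔨) : M.carrier →ₗ[ℂ] M.carrier :=
  aAct M (te (-i)) ∘ₗ xAct M i x + (i : ℂ) • (aAct M (tx (-i)) ∘ₗ yAct M i x)

/-- The operator through which `x ⊗ tⁱ ξ` acts on the vectors of `vac`. -/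
def etaOp (i : ℤ) (x : PureEven 𝔨) : M.carrier →ₗ[ℂ] M.carrier :=
  aAct M (te (-i)) ∘ₗ yAct M i x - aAct M (tx (-i)) ∘ₗ xAct M i x

lemma ellOp_apply (i : ℤ) (v : M.carrier) : ellOp M lam i v = aAct M (te (-i)) (lAct M i v)
    - lam • v + ((i : ℂ) / 2) • aAct M (tx (-i)) (gAct M i v) := rfl
lemma gamOp_apply (i : ℤ) (v : M.carrier) : gamOp M lam i v = aAct M (te (-i)) (gAct M i v)
    + lam • aAct M (tx 0) v - (2 : ℂ) • aAct M (tx (-i)) (lAct M i v) := rfl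
lemma chiOp_apply (i : ℤ) (x : PureEven 𝔨) (v : M.carrier) : chiOp M i x v =
    aAct M (te (-i)) (xAct M i x v) + (i : ℂ) • aAct M (tx (-i)) (yAct M i x v) := rfl
lemma etaOp_apply (i : ℤ) (x : PureEven 𝔨) (v : M.carrier) : etaOp M i x v =
    aAct M (te (-i)) (yAct M i x v) - aAct M (tx (-i)) (xAct M i x v) := rfl

variable {M}

/-- Up to the units `tⁱ`, the passage from `Lᵢ, Gᵢ` to `ellOp, gamOp` is unipotent in `ξ`, so `ξ² =
0` inverts it. The identity holds on all of `M`, and for vectors of `vac` it is the formula of the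
tensor module at `f = 1`. The next three lemmas are of the same kind. -/
lemma lAct_eq (hA : IsAssociative M) (i : ℤ) (v : M.carrier) :
    lAct M i v = aAct M (te i) (ellOp M lam i v)
    - ((i : ℂ) / 2) • aAct M (tx i) (gamOp M lam i v) + lam • aAct M (te i) v := by
  simp only [ellOp_apply, gamOp_apply, map_add, map_sub, map_smul, aAct_mul hA, te_mul_te,
    te_mul_tx, tx_mul_te, tx_mul_tx, add_neg_cancel, te_zero, map_zero, LinearMap.zero_apply,
    aAct_one hA]
  module

lemma gAct_eq (hA : IsAssociative M) (i : ℤ) (v : M.carrier) :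
    gAct M i v = aAct M (te i) (gamOp M lam i v)
    + (2 : ℂ) • aAct M (tx i) (ellOp M lam i v) + lam • aAct M (tx i) v := by
  simp only [ellOp_apply, gamOp_apply, map_add, map_sub, map_smul, aAct_mul hA, te_mul_te,
    te_mul_tx, tx_mul_te, tx_mul_tx, add_neg_cancel, te_zero, map_zero, LinearMap.zero_apply,
    aAct_one hA, add_zero]
  module

lemma xAct_eq (hA : IsAssociative M) (i : ℤ) (x : PureEven 𝔨) (v : M.carrier) : xAct M i x v =
    aAct M (te i) (chiOp M i x v) - (i : ℂ) • aAct M (tx i) (etaOp M i x v) := by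
  simp only [chiOp_apply, etaOp_apply, map_add, map_sub, map_smul, aAct_mul hA, te_mul_te,
    te_mul_tx, tx_mul_te, tx_mul_tx, add_neg_cancel, te_zero, map_zero, LinearMap.zero_apply,
    aAct_one hA]
  module

lemma yAct_eq (hA : IsAssociative M) (i : ℤ) (x : PureEven 𝔨) (v : M.carrier) : yAct M i x v =
    aAct M (tx i) (chiOp M i x v) + aAct M (te i) (etaOp M i x v) := by
  simp only [chiOp_apply, etaOp_apply, map_add, map_sub, map_smul, aAct_mul hA, te_mul_te,
    te_mul_tx, tx_mul_te, tx_mul_tx, add_neg_cancel, te_zero, map_zero, LinearMap.zero_apply,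
    aAct_one hA]
  module

variable {lam}

/-- The factors `t⁻ⁱ` restore the weight `λ`, and the `ξ`-terms cancel what the brackets with `G₀`
leave over. The same holds for the other three families. -/
lemma ellOp_mem (hA : IsAssociative M) {v : M.carrier} (hv : v ∈ vac M lam) (i : ℤ) :
    ellOp M lam i v ∈ vac M lam := by
  obtain ⟨h1, h2⟩ := mem_vac.1 hv
  rw [mem_vac]
  constructor <;>
  simp only [ellOp_apply, map_add, map_sub, map_smul, map_neg, LinearMap.neg_apply,
    LinearMap.smul_apply, lAct_aAct, gAct_aAct, lAct_zero_lAct, lAct_zero_gAct, gAct_zero_lAct,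
    gAct_zero_gAct, h1, h2, sAct_L_te, sAct_L_tx, sAct_G_te, sAct_G_tx, parityAut_te,
    parityAut_tx, aAct_mul hA, te_mul_tx, tx_mul_te, tx_mul_tx, zero_add, add_zero,
    map_zero, LinearMap.zero_apply, Int.cast_neg, Int.cast_zero, neg_add_cancel] <;>
  module

lemma gamOp_mem (hA : IsAssociative M) {v : M.carrier} (hv : v ∈ vac M lam) (i : ℤ) :
    gamOp M lam i v ∈ vac M lam := by
  obtain ⟨h1, h2⟩ := mem_vac.1 hv
  rw [mem_vac]
  constructor <;>
  simp only [gamOp_apply, map_add, map_sub, map_smul, map_neg, LinearMap.neg_apply,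
    LinearMap.smul_apply, lAct_aAct, gAct_aAct, lAct_zero_lAct, lAct_zero_gAct, gAct_zero_lAct,
    gAct_zero_gAct, h1, h2, sAct_L_te, sAct_L_tx, sAct_G_te, sAct_G_tx, parityAut_te,
    parityAut_tx, aAct_mul hA, te_mul_te, te_mul_tx, tx_mul_te, tx_mul_tx, zero_add, add_zero,
    map_zero, LinearMap.zero_apply, Int.cast_neg, Int.cast_zero, neg_add_cancel, te_zero,
    aAct_one hA] <;>
  module

lemma chiOp_mem (hA : IsAssociative M) {v : M.carrier} (hv : v ∈ vac M lam) (i : ℤ)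
    (x : PureEven 𝔨) :
    chiOp M i x v ∈ vac M lam := by
  obtain ⟨h1, h2⟩ := mem_vac.1 hv
  rw [mem_vac]
  constructor <;>
  simp only [chiOp_apply, map_add, map_sub, map_smul, map_neg, LinearMap.neg_apply,
    LinearMap.smul_apply, lAct_aAct, gAct_aAct, xAct_aAct, yAct_aAct, lAct_zero_xAct,
    lAct_zero_yAct, gAct_zero_xAct, gAct_zero_yAct,
    h1, h2, sAct_L_te, sAct_L_tx, sAct_G_te, sAct_G_tx, parityAut_te,
    parityAut_tx, aAct_mul hA, te_mul_tx, tx_mul_te, tx_mul_tx, zero_add, add_zero,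
    map_zero, LinearMap.zero_apply, Int.cast_neg, Int.cast_zero] <;>
  module

lemma etaOp_mem (hA : IsAssociative M) {v : M.carrier} (hv : v ∈ vac M lam) (i : ℤ)
    (x : PureEven 𝔨) :
    etaOp M i x v ∈ vac M lam := by
  obtain ⟨h1, h2⟩ := mem_vac.1 hv
  rw [mem_vac]
  constructor <;>
  simp only [etaOp_apply, map_add, map_sub, map_smul, map_neg, LinearMap.neg_apply,
    LinearMap.smul_apply, lAct_aAct, gAct_aAct, xAct_aAct, yAct_aAct, lAct_zero_xAct,
    lAct_zero_yAct, gAct_zero_xAct, gAct_zero_yAct,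
    h1, h2, sAct_L_te, sAct_L_tx, sAct_G_te, sAct_G_tx, parityAut_te,
    parityAut_tx, aAct_mul hA, te_mul_tx, tx_mul_te, tx_mul_tx, zero_add, add_zero,
    map_zero, LinearMap.zero_apply, Int.cast_neg, Int.cast_zero] <;>
  module

lemma lAct_zero_aAct_te {v : M.carrier} (n : ℤ) (hv : lAct M 0 v = lam • v) :
    lAct M 0 (aAct M (te n) v) = (lam + n) • aAct M (te n) v := by
  rw [lAct_aAct, hv, sAct_L_te, zero_add, map_smul, map_smul, LinearMap.smul_apply, ← add_smul]

lemma lAct_zero_aAct_tx {v : M.carrier} (n : ℤ) (hv : lAct M 0 v = lam • v) :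
    lAct M 0 (aAct M (tx n) v) = (lam + n) • aAct M (tx n) v := by
  rw [lAct_aAct, hv, sAct_L_tx, zero_add, map_smul, map_smul, LinearMap.smul_apply, ← add_smul]
  simp

/-- On vectors of weight `λ` the operator `G₀ - λ ξ` preserves the weight and has square `λ - L₀ =
0`. So either `v` itself lies in its kernel, or its value at `v` does and is nonzero. -/
lemma exists_ne_zero_mem_vac (hA : IsAssociative M) {v : M.carrier} (hv0 : v ≠ 0)
    (hv : lAct M 0 v = lam • v) :
    ∃ u ∈ vac M lam, u ≠ 0 := by
  by_cases h : gAct M 0 v - lam • aAct M (tx 0) v = 0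
  · exact ⟨v, mem_vac.2 ⟨hv, sub_eq_zero.1 h⟩, hv0⟩
  · refine ⟨_, mem_vac.2 ⟨?_, ?_⟩, h⟩
    · rw [map_sub, map_smul, lAct_zero_gAct, lAct_zero_aAct_tx 0 hv, hv]
      simp only [map_smul, Int.cast_zero]; module
    -- The relation for `[G₀, G₀]` reads `G₀² = -G₀² - 2 L₀`, so the square is obtained after
    -- doubling.
    · have hG : gAct M 0 (gAct M 0 v) = -(lam • v) := by
        have h2 := gAct_zero_gAct M 0 v
        rw [hv] at h2
        have h3 : (2 : ℂ) • gAct M 0 (gAct M 0 v) = (2 : ℂ) • -(lam • v) := by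
          nth_rewrite 1 [two_smul, h2]; module
        exact smul_right_injective _ two_ne_zero h3
      simp only [map_sub, map_smul, gAct_aAct, hG, parityAut_tx, map_neg, LinearMap.neg_apply,
        sAct_G_tx, aAct_mul hA, tx_mul_tx, map_zero, LinearMap.zero_apply, add_zero, te_zero,
        aAct_one hA]
      module

end Vacuum

/-! ### The action on the tensor module, and homomorphisms from it to `M`. -/

section GammaAction

variable {𝔨 : Type v} [LieRing 𝔨] [LieAlgebra ℂ 𝔨]
  (lam : ℂ) (V : LieSuperModule.{v, w} (a0 𝔨).toSubmodule)

section

variable {W : Type*} [AddCommMonoid W] [Module ℂ W] (F : SBar →ₗ[ℂ] W) (F' : Loop 𝔨 →ₗ[ℂ] W)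
  (F'' : A →ₗ[ℂ] W)

/-- Stated for arbitrary linear maps in place of the three summands of `gammaAct`, which then need
not be unfolded. -/
lemma components_ofS (a : SBar) : F (toS 𝔨 (extToCur 𝔨 (Extended.ofS a))) +
    F' (toLoop 𝔨 (extToCur 𝔨 (Extended.ofS a))) + F'' (extToA 𝔨 (Extended.ofS a)) = F a := by
  have h1 : toS 𝔨 (extToCur 𝔨 (Extended.ofS a)) = a := rfl
  have h2 : toLoop 𝔨 (extToCur 𝔨 (Extended.ofS a)) = 0 := rfl
  have h3 : extToA 𝔨 (Extended.ofS a) = 0 := rfl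
  rw [h1, h2, h3, F'.map_zero, F''.map_zero, add_zero, add_zero]

lemma components_ofLoop (w : Loop 𝔨) : F (toS 𝔨 (extToCur 𝔨 (Extended.ofLoop w))) +
    F' (toLoop 𝔨 (extToCur 𝔨 (Extended.ofLoop w))) + F'' (extToA 𝔨 (Extended.ofLoop w)) =
      F' w := by
  have h1 : toS 𝔨 (extToCur 𝔨 (Extended.ofLoop w)) = 0 := rfl
  have h2 : toLoop 𝔨 (extToCur 𝔨 (Extended.ofLoop w)) = w := rfl
  have h3 : extToA 𝔨 (Extended.ofLoop w) = 0 := rfl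
  rw [h1, h2, h3, F.map_zero, F''.map_zero, add_zero, zero_add]

lemma components_ofA (f : A) : F (toS 𝔨 (extToCur 𝔨 (Extended.ofA f))) +
    F' (toLoop 𝔨 (extToCur 𝔨 (Extended.ofA f))) + F'' (extToA 𝔨 (Extended.ofA f)) = F'' f := by
  have h1 : toS 𝔨 (extToCur 𝔨 (Extended.ofA f)) = 0 := rfl
  have h2 : toLoop 𝔨 (extToCur 𝔨 (Extended.ofA f)) = 0 := rfl
  have h3 : extToA 𝔨 (Extended.ofA f) = f := rfl
  rw [h1, h2, h3, F.map_zero, F'.map_zero, add_zero, zero_add]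

lemma onT_te {B : Type*} [AddCommMonoid B] [Module ℂ B] (φ ψ : ℤ → B →ₗ[ℂ] W) (i : ℤ) (x : B) :
    onT φ (coeff0 (te i)) x + onT ψ (coeff1 (te i)) x = φ i x := by
  rw [te, coeff0_ev, coeff1_ev, onT_T, (onT ψ).map_zero, LinearMap.zero_apply, add_zero]

lemma onT_tx {B : Type*} [AddCommMonoid B] [Module ℂ B] (φ ψ : ℤ → B →ₗ[ℂ] W) (i : ℤ) (x : B) :
    onT φ (coeff0 (tx i)) x + onT ψ (coeff1 (tx i)) x = ψ i x := by
  rw [tx, coeff0_od, coeff1_od, onT_T, (onT φ).map_zero, LinearMap.zero_apply, zero_add]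

lemma onT_L (φ ψ : ℤ → W) (i : ℤ) : onT φ (sL (L i)) + onT ψ (sG (L i)) = φ i := by
  rw [L, sL_elt, sG_elt, onT_T, (onT ψ).map_zero, add_zero]

lemma onT_G (φ ψ : ℤ → W) (i : ℤ) : onT φ (sL (G i)) + onT ψ (sG (G i)) = ψ i := by
  rw [G, sL_elt, sG_elt, onT_T, (onT φ).map_zero, zero_add]

end

lemma gammaAct_L (i : ℤ) : gammaAct lam V (Extended.ofS (L i)) = opL lam V i :=
  have h := components_ofS (𝔨 := 𝔨) (W := A ⊗[ℂ] V.carrier →ₗ[ℂ] A ⊗[ℂ] V.carrier)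
    (gammaS lam V) (gammaLoop V) (gammaA V) (L i)
  h.trans (onT_L (opL lam V) (opG lam V) i)

lemma gammaAct_G (i : ℤ) : gammaAct lam V (Extended.ofS (G i)) = opG lam V i :=
  have h := components_ofS (𝔨 := 𝔨) (W := A ⊗[ℂ] V.carrier →ₗ[ℂ] A ⊗[ℂ] V.carrier)
    (gammaS lam V) (gammaLoop V) (gammaA V) (G i)
  h.trans (onT_G (opL lam V) (opG lam V) i)

lemma gammaAct_X (i : ℤ) (x : PureEven 𝔨) :
    gammaAct lam V (Extended.ofLoop (te i ⊗ₜ x)) = opX V i x :=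
  have h := components_ofLoop (𝔨 := 𝔨) (W := A ⊗[ℂ] V.carrier →ₗ[ℂ] A ⊗[ℂ] V.carrier)
    (gammaS lam V) (gammaLoop V) (gammaA V) (te i ⊗ₜ x)
  h.trans (onT_te (opX V) (opXi V) i x)

lemma gammaAct_Y (i : ℤ) (x : PureEven 𝔨) :
    gammaAct lam V (Extended.ofLoop (tx i ⊗ₜ x)) = opXi V i x :=
  have h := components_ofLoop (𝔨 := 𝔨) (W := A ⊗[ℂ] V.carrier →ₗ[ℂ] A ⊗[ℂ] V.carrier)
    (gammaS lam V) (gammaLoop V) (gammaA V) (tx i ⊗ₜ x)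
  h.trans (onT_tx (opX V) (opXi V) i x)

lemma gammaAct_A (f : A) : gammaAct lam V (Extended.ofA f) = gammaA V f :=
  components_ofA (𝔨 := 𝔨) (W := A ⊗[ℂ] V.carrier →ₗ[ℂ] A ⊗[ℂ] V.carrier)
    (gammaS lam V) (gammaLoop V) (gammaA V) f

lemma opL_tmul (i : ℤ) (f : A) (v : V.carrier) : opL lam V i (f ⊗ₜ v) =
    (te i * f) ⊗ₜ V.act (a0L 𝔨 i) v
      - ((i : ℂ) / 2) • ((tx i * parityAut f) ⊗ₜ V.act (a0G 𝔨 i) v)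
      + (te i * (lam • f + tdt f)) ⊗ₜ v + ((i : ℂ) / 2) • ((tx i * dxi f) ⊗ₜ v) := rfl

lemma opG_tmul (i : ℤ) (f : A) (v : V.carrier) : opG lam V i (f ⊗ₜ v) =
    (te i * parityAut f) ⊗ₜ V.act (a0G 𝔨 i) v + (2 : ℂ) • ((tx i * f) ⊗ₜ V.act (a0L 𝔨 i) v)
      + (tx i * (lam • f + tdt f)) ⊗ₜ v - (te i * dxi f) ⊗ₜ v := rfl

lemma opX_tmul (i : ℤ) (x : PureEven 𝔨) (f : A) (v : V.carrier) : opX V i x (f ⊗ₜ v) =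
    (te i * f) ⊗ₜ V.act (a0Loop (te i ⊗ₜ x)) v
      - (i : ℂ) • ((tx i * parityAut f) ⊗ₜ V.act (a0Loop (tx i ⊗ₜ x)) v) := rfl

lemma opXi_tmul (i : ℤ) (x : PureEven 𝔨) (f : A) (v : V.carrier) : opXi V i x (f ⊗ₜ v) =
    (tx i * f) ⊗ₜ V.act (a0Loop (te i ⊗ₜ x)) v
      + (te i * parityAut f) ⊗ₜ V.act (a0Loop (tx i ⊗ₜ x)) v := rfl

lemma parityAut_apply (f : A) : parityAut f = ev (coeff0 f) - od (coeff1 f) := by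
  nth_rewrite 1 [show f = ev (coeff0 f) + od (coeff1 f) by apply A_ext <;> simp]
  rw [map_add, parityAut_even (ev_mem _), parityAut_odd (od_mem _)]
  abel

lemma sAct_L (i : ℤ) (f : A) : sAct (L i) f = te i * tdt f + ((i : ℂ) / 2) • (tx i * dxi f) := by
  apply A_ext <;> simp [L, te, tx, D_T, smul_smul]
  congr 1; ring

lemma sAct_G (i : ℤ) (f : A) : sAct (G i) f = tx i * tdt f - te i * dxi f := by
  apply A_ext <;> simp [G, te, tx]

lemma map_A_mul_smul_add {W : Type*} [AddCommMonoid W] [Module ℂ W] (F : A →ₗ[ℂ] W →ₗ[ℂ] W)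
    (a f g : A) (c : ℂ) (v : W) : F (a * (c • f + g)) v = c • F (a * f) v + F (a * g) v := by
  rw [mul_add, mul_smul_comm, map_add, map_smul, LinearMap.add_apply, LinearMap.smul_apply]

lemma map_sAct_L {W : Type*} [AddCommMonoid W] [Module ℂ W] (F : A →ₗ[ℂ] W →ₗ[ℂ] W)
    (i : ℤ) (f : A) (v : W) : F (sAct (L i) f) v =
      F (te i * tdt f) v + ((i : ℂ) / 2) • F (tx i * dxi f) v := by
  rw [sAct_L, map_add, map_smul, LinearMap.add_apply, LinearMap.smul_apply]

lemma map_sAct_G {W : Type*} [AddCommGroup W] [Module ℂ W] (F : A →ₗ[ℂ] W →ₗ[ℂ] W)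
    (i : ℤ) (f : A) (v : W) : F (sAct (G i) f) v = F (tx i * tdt f) v - F (te i * dxi f) v := by
  rw [sAct_G, map_sub, LinearMap.sub_apply]

/-- Multiplication by `ξ` kills the `ξ`-part of `f`, the only part that `parityAut` changes. The
sign is therefore immaterial, and it is inserted to match the formulas of `opL` and `opX`. -/
lemma tx_mul_parityAut (i : ℤ) (f : A) : tx i * parityAut f = f * tx i := by
  rw [parityAut_apply, mul_comm f]
  apply A_ext <;> simp [tx]

lemma parityAut_mul_tx (i : ℤ) (f : A) : parityAut f * tx i = tx i * f := by
  rw [parityAut_apply, mul_comm _ (tx i)]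
  apply A_ext <;> simp [tx]

variable {lam V} {M : LieSuperModule.{v, w} (Extended 𝔨)} (ι : V.carrier →ₗ[ℂ] M.carrier)

/-- `f ⊗ v ↦ f ι(v)`. -/
def aLift : A ⊗[ℂ] V.carrier →ₗ[ℂ] M.carrier := TensorProduct.lift ((aAct M).compl₂ ι)

lemma aLift_tmul (f : A) (v : V.carrier) : aLift ι (f ⊗ₜ v) = aAct M f (ι v) := rfl

lemma aLift_opL (i : ℤ) (f : A) (v : V.carrier) : aLift ι (opL lam V i (f ⊗ₜ v)) =
    aAct M (te i * f) (ι (V.act (a0L 𝔨 i) v))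
      - ((i : ℂ) / 2) • aAct M (tx i * parityAut f) (ι (V.act (a0G 𝔨 i) v))
      + aAct M (te i * (lam • f + tdt f)) (ι v) + ((i : ℂ) / 2) • aAct M (tx i * dxi f) (ι v) := by
  rw [opL_tmul, LinearMap.map_add, LinearMap.map_add, LinearMap.map_sub, LinearMap.map_smul,
    LinearMap.map_smul]
  rfl

lemma aLift_opG (i : ℤ) (f : A) (v : V.carrier) : aLift ι (opG lam V i (f ⊗ₜ v)) =
    aAct M (te i * parityAut f) (ι (V.act (a0G 𝔨 i) v))
      + (2 : ℂ) • aAct M (tx i * f) (ι (V.act (a0L 𝔨 i) v))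
      + aAct M (tx i * (lam • f + tdt f)) (ι v) - aAct M (te i * dxi f) (ι v) := by
  rw [opG_tmul, LinearMap.map_sub, LinearMap.map_add, LinearMap.map_add, LinearMap.map_smul]
  rfl

lemma aLift_opX (i : ℤ) (x : PureEven 𝔨) (f : A) (v : V.carrier) :
    aLift ι (opX V i x (f ⊗ₜ v)) = aAct M (te i * f) (ι (V.act (a0Loop (te i ⊗ₜ x)) v))
      - (i : ℂ) • aAct M (tx i * parityAut f) (ι (V.act (a0Loop (tx i ⊗ₜ x)) v)) := by
  rw [opX_tmul, LinearMap.map_sub, LinearMap.map_smul]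
  rfl

lemma aLift_opXi (i : ℤ) (x : PureEven 𝔨) (f : A) (v : V.carrier) :
    aLift ι (opXi V i x (f ⊗ₜ v)) = aAct M (tx i * f) (ι (V.act (a0Loop (te i ⊗ₜ x)) v))
      + aAct M (te i * parityAut f) (ι (V.act (a0Loop (tx i ⊗ₜ x)) v)) := by
  rw [opXi_tmul, LinearMap.map_add]
  rfl

lemma aAct_aAct_te (hA : IsAssociative M) (i : ℤ) (f : A) (m : M.carrier) :
    aAct M f (aAct M (te i) m) = aAct M (te i * f) m := by
  rw [aAct_mul hA, mul_comm]

lemma aAct_aAct_tx (hA : IsAssociative M) (i : ℤ) (f : A) (m : M.carrier) :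
    aAct M f (aAct M (tx i) m) = aAct M (tx i * parityAut f) m := by
  rw [aAct_mul hA, tx_mul_parityAut]

lemma aAct_parityAut_aAct_tx (hA : IsAssociative M) (i : ℤ) (f : A) (m : M.carrier) :
    aAct M (parityAut f) (aAct M (tx i) m) = aAct M (tx i * f) m := by
  rw [aAct_mul hA, parityAut_mul_tx]

/-- By the Leibniz rule the operator on `f ι(v)` is `f Lᵢ ι(v) + (Lᵢ f) ι(v)`. The first summand
gives the terms with `V.act` and `λ`, the second the two terms with derivatives of `f`. -/
lemma lAct_aLift_tmul (hA : IsAssociative M)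
    (hL : ∀ i v, lAct M i (ι v) = aAct M (te i) (ι (V.act (a0L 𝔨 i) v))
      - ((i : ℂ) / 2) • aAct M (tx i) (ι (V.act (a0G 𝔨 i) v)) + lam • aAct M (te i) (ι v))
    (i : ℤ) (f : A) (v : V.carrier) :
    lAct M i (aAct M f (ι v)) = aLift ι (opL lam V i (f ⊗ₜ v)) := by
  have e : aAct M f (lAct M i (ι v)) = aAct M (te i * f) (ι (V.act (a0L 𝔨 i) v))
      - ((i : ℂ) / 2) • aAct M (tx i * parityAut f) (ι (V.act (a0G 𝔨 i) v))
      + lam • aAct M (te i * f) (ι v) := by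
    rw [← aAct_aAct_te hA, ← aAct_aAct_te hA, ← aAct_aAct_tx hA, hL]
    generalize aAct M f = F
    simp only [map_add, map_sub, map_smul]
  have e' := map_A_mul_smul_add (aAct M) (te i) f (tdt f) lam (ι v)
  refine (lAct_aAct M i f (ι v)).trans ((congrArg₂ (· + ·) e (map_sAct_L (aAct M) i f _)).trans ?_)
  refine Eq.trans ?_ (aLift_opL ι i f v).symm
  rw [e']
  abel

lemma gAct_aLift_tmul (hA : IsAssociative M)
    (hG : ∀ i v, gAct M i (ι v) = aAct M (te i) (ι (V.act (a0G 𝔨 i) v))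
      + (2 : ℂ) • aAct M (tx i) (ι (V.act (a0L 𝔨 i) v)) + lam • aAct M (tx i) (ι v))
    (i : ℤ) (f : A) (v : V.carrier) :
    gAct M i (aAct M f (ι v)) = aLift ι (opG lam V i (f ⊗ₜ v)) := by
  have e : aAct M (parityAut f) (gAct M i (ι v)) =
      aAct M (te i * parityAut f) (ι (V.act (a0G 𝔨 i) v))
      + (2 : ℂ) • aAct M (tx i * f) (ι (V.act (a0L 𝔨 i) v)) + lam • aAct M (tx i * f) (ι v) := by
    rw [← aAct_aAct_te hA, ← aAct_parityAut_aAct_tx hA, ← aAct_parityAut_aAct_tx hA, hG]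
    generalize aAct M (parityAut f) = F
    simp only [map_add, map_smul]
  have e' := map_A_mul_smul_add (aAct M) (tx i) f (tdt f) lam (ι v)
  refine (gAct_aAct M i f (ι v)).trans ((congrArg₂ (· + ·) e (map_sAct_G (aAct M) i f _)).trans ?_)
  refine Eq.trans ?_ (aLift_opG ι i f v).symm
  rw [e']
  abel

lemma xAct_aLift_tmul (hA : IsAssociative M)
    (hX : ∀ i x v, xAct M i x (ι v) = aAct M (te i) (ι (V.act (a0Loop (te i ⊗ₜ x)) v))
      - (i : ℂ) • aAct M (tx i) (ι (V.act (a0Loop (tx i ⊗ₜ x)) v)))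
    (i : ℤ) (x : PureEven 𝔨) (f : A) (v : V.carrier) :
    xAct M i x (aAct M f (ι v)) = aLift ι (opX V i x (f ⊗ₜ v)) := by
  rw [aLift_opX, xAct_aAct, hX, (aAct M f).map_sub, (aAct M f).map_smul, aAct_aAct_te hA,
    aAct_aAct_tx hA]

lemma yAct_aLift_tmul (hA : IsAssociative M)
    (hY : ∀ i x v, yAct M i x (ι v) = aAct M (tx i) (ι (V.act (a0Loop (te i ⊗ₜ x)) v))
      + aAct M (te i) (ι (V.act (a0Loop (tx i ⊗ₜ x)) v)))
    (i : ℤ) (x : PureEven 𝔨) (f : A) (v : V.carrier) :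
    yAct M i x (aAct M f (ι v)) = aLift ι (opXi V i x (f ⊗ₜ v)) := by
  rw [aLift_opXi, yAct_aAct, hY, (aAct M (parityAut f)).map_add, aAct_parityAut_aAct_tx hA,
    aAct_aAct_te hA]

/-- If the operators of `𝔤` on the image of `ι` are given by the formulas of the tensor module,
then `f ⊗ v ↦ f ι(v)` is a homomorphism from `Γ(λ, V)`. -/
lemma act_aLift (hA : IsAssociative M)
    (hL : ∀ i v, lAct M i (ι v) = aAct M (te i) (ι (V.act (a0L 𝔨 i) v))
      - ((i : ℂ) / 2) • aAct M (tx i) (ι (V.act (a0G 𝔨 i) v)) + lam • aAct M (te i) (ι v))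
    (hG : ∀ i v, gAct M i (ι v) = aAct M (te i) (ι (V.act (a0G 𝔨 i) v))
      + (2 : ℂ) • aAct M (tx i) (ι (V.act (a0L 𝔨 i) v)) + lam • aAct M (tx i) (ι v))
    (hX : ∀ i x v, xAct M i x (ι v) = aAct M (te i) (ι (V.act (a0Loop (te i ⊗ₜ x)) v))
      - (i : ℂ) • aAct M (tx i) (ι (V.act (a0Loop (tx i ⊗ₜ x)) v)))
    (hY : ∀ i x v, yAct M i x (ι v) = aAct M (tx i) (ι (V.act (a0Loop (te i ⊗ₜ x)) v))
      + aAct M (te i) (ι (V.act (a0Loop (tx i ⊗ₜ x)) v)))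
    (x : Extended 𝔨) (z : A ⊗[ℂ] V.carrier) :
    M.act x (aLift ι z) = aLift ι (gammaAct lam V x z) := by
  induction z using TensorProduct.induction_on with
  | zero => rw [(aLift ι).map_zero, (M.act x).map_zero, (gammaAct lam V x).map_zero,
      (aLift ι).map_zero]
  | add a b ha hb => rw [(aLift ι).map_add, (M.act x).map_add, (gammaAct lam V x).map_add,
      (aLift ι).map_add, ha, hb]
  | tmul f v =>
    -- With `f ⊗ v` fixed both sides are linear in the element of `𝔤̃`, so it suffices to compare
    -- them on spanning elements.
    have key : M.act.flip (aAct M f (ι v)) = aLift ι ∘ₗ (gammaAct lam V).flip (f ⊗ₜ v) := by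
      refine Extended_linear_ext (fun i => ?_) (fun i => ?_) (fun i x => ?_) (fun i x => ?_)
        (fun g => ?_)
      · exact (lAct_aLift_tmul ι hA hL i f v).trans
          (congrArg (fun T => aLift ι (T (f ⊗ₜ v))) (gammaAct_L lam V i).symm)
      · exact (gAct_aLift_tmul ι hA hG i f v).trans
          (congrArg (fun T => aLift ι (T (f ⊗ₜ v))) (gammaAct_G lam V i).symm)
      · exact (xAct_aLift_tmul ι hA hX i x f v).trans
          (congrArg (fun T => aLift ι (T (f ⊗ₜ v))) (gammaAct_X lam V i x).symm)
      · exact (yAct_aLift_tmul ι hA hY i x f v).trans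
          (congrArg (fun T => aLift ι (T (f ⊗ₜ v))) (gammaAct_Y lam V i x).symm)
      · exact (aAct_mul hA g f (ι v)).trans
          (congrArg (fun T => aLift ι (T (f ⊗ₜ v))) (gammaAct_A lam V g).symm)
    exact LinearMap.congr_fun key x

lemma aLift_mem (hι : ∀ i, ∀ v ∈ grade i, ι v ∈ grade i) (i : ZMod 2) (z : A ⊗[ℂ] V.carrier)
    (hz : z ∈ grade i) : aLift ι z ∈ grade i := by
  induction hz using Submodule.span_induction with
  | mem z hz =>
    obtain ⟨j, k, rfl, f, hf, v, hv, rfl⟩ := hz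
    rw [aLift_tmul, add_comm]
    exact aAct_grade M hf k _ (hι k v hv)
  | zero => simp
  | add a b _ _ ha hb => rw [map_add]; exact Submodule.add_mem _ ha hb
  | smul c a _ ha => rw [map_smul]; exact Submodule.smul_mem _ _ ha

end GammaAction

/-! ### Stable subspaces of `M` and the submodules they generate over `𝒜`. -/

section Generation

variable {𝔨 : Type v} [LieRing 𝔨] [LieAlgebra ℂ 𝔨] {M : LieSuperModule.{v, w} (Extended 𝔨)}
  {lam : ℂ}

lemma aAct_mem_map₂ {W : Submodule ℂ M.carrier} {w : M.carrier} (hw : w ∈ W) (f : A) :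
    aAct M f w ∈ Submodule.map₂ (aAct M) ⊤ W :=
  Submodule.apply_mem_map₂ _ trivial hw

lemma map₂_graded {W : Submodule ℂ M.carrier} (hW : IsGraded W) :
    IsGraded (Submodule.map₂ (aAct M) ⊤ W) := by
  have hom : ∀ {i j : ZMod 2} {f : A} {w : M.carrier}, f ∈ grade i → w ∈ grade j → w ∈ W →
      aAct M f w ∈ (Submodule.map₂ (aAct M) ⊤ W ⊓ grade 0) ⊔
        (Submodule.map₂ (aAct M) ⊤ W ⊓ grade 1) := by
    intro i j f w hf hw hwW
    have h := aAct_grade M hf j w hw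
    rcases parity_cases (j + i) with e | e <;> rw [e] at h
    · exact Submodule.mem_sup_left ⟨aAct_mem_map₂ hwW f, h⟩
    · exact Submodule.mem_sup_right ⟨aAct_mem_map₂ hwW f, h⟩
  rw [isGraded_iff] at hW
  refine Submodule.map₂_le.2 fun f _ w hw => ?_
  rw [← sproj_add_sproj f, ← sproj_add_sproj w]
  simp only [map_add, LinearMap.add_apply]
  refine Submodule.add_mem _ (Submodule.add_mem _ ?_ ?_) (Submodule.add_mem _ ?_ ?_) <;>
    exact hom (sproj_mem _ _) (sproj_mem _ _) (hW w hw _)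

/-- A nonzero graded space of vectors in `vac` that is stable under the four families of
operators generates a simple module over `𝒜`. -/
lemma map₂_eq_top (hA : IsAssociative M) (hs : M.IsSimple) {W : Submodule ℂ M.carrier}
    (hW : IsGraded W) (hne : W ≠ ⊥)
    (hl : ∀ i, ∀ w ∈ W, ellOp M lam i w ∈ W) (hg : ∀ i, ∀ w ∈ W, gamOp M lam i w ∈ W)
    (hx : ∀ i x, ∀ w ∈ W, chiOp M i x w ∈ W) (hy : ∀ i x, ∀ w ∈ W, etaOp M i x w ∈ W) :
    Submodule.map₂ (aAct M) ⊤ W = ⊤ := by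
  refine (hs.2 _ (map₂_graded hW) ?_).resolve_left ?_
  · intro x m hm
    have ha : ∀ {w}, w ∈ W → ∀ f, aAct M f w ∈ Submodule.map₂ (aAct M) ⊤ W :=
      fun hw f => aAct_mem_map₂ hw f
    have ha2 : ∀ f g, ∀ w ∈ W, aAct M f (aAct M g w) ∈ Submodule.map₂ (aAct M) ⊤ W :=
      fun f g w hw => by rw [aAct_mul hA]; exact ha hw _
    suffices h : Submodule.map₂ (aAct M) ⊤ W ≤ (Submodule.map₂ (aAct M) ⊤ W).comap (M.act x) from
      h hm
    refine Submodule.map₂_le.2 fun f _ w hw => ?_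
    -- Modulo `𝒜 W` the claim is the vanishing of a map linear in `x`. On generators, the Leibniz
    -- rule and `lAct_eq`, `gAct_eq`, `xAct_eq`, `yAct_eq` express the value by elements of `𝒜 W`.
    suffices h : (Submodule.map₂ (aAct M) ⊤ W).mkQ ∘ₗ M.act.flip (aAct M f w) = 0 from
      (Submodule.Quotient.mk_eq_zero (Submodule.map₂ (aAct M) ⊤ W)).1 (LinearMap.congr_fun h x)
    refine Extended_linear_ext ?_ ?_ ?_ ?_ ?_
    · intro i
      refine (Submodule.Quotient.mk_eq_zero _).2 ?_
      change lAct M i _ ∈ _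
      rw [lAct_aAct, lAct_eq lam hA, map_add, map_sub, map_smul, map_smul]
      exact Submodule.add_mem _ (Submodule.add_mem _ (Submodule.sub_mem _ (ha2 _ _ _ (hl i w hw))
        (Submodule.smul_mem _ _ (ha2 _ _ _ (hg i w hw))))
        (Submodule.smul_mem _ _ (ha2 _ _ _ hw))) (ha hw _)
    · intro i
      refine (Submodule.Quotient.mk_eq_zero _).2 ?_
      change gAct M i _ ∈ _
      rw [gAct_aAct, gAct_eq lam hA, map_add, map_add, map_smul, map_smul]
      exact Submodule.add_mem _ (Submodule.add_mem _ (Submodule.add_mem _ (ha2 _ _ _ (hg i w hw))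
        (Submodule.smul_mem _ _ (ha2 _ _ _ (hl i w hw))))
        (Submodule.smul_mem _ _ (ha2 _ _ _ hw))) (ha hw _)
    · intro i x
      refine (Submodule.Quotient.mk_eq_zero _).2 ?_
      change xAct M i x _ ∈ _
      rw [xAct_aAct, xAct_eq hA, map_sub, map_smul]
      exact Submodule.sub_mem _ (ha2 _ _ _ (hx i x w hw))
        (Submodule.smul_mem _ _ (ha2 _ _ _ (hy i x w hw)))
    · intro i x
      refine (Submodule.Quotient.mk_eq_zero _).2 ?_
      change yAct M i x _ ∈ _
      rw [yAct_aAct, yAct_eq hA, map_add]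
      exact Submodule.add_mem _ (ha2 _ _ _ (hx i x w hw)) (ha2 _ _ _ (hy i x w hw))
    · intro g
      exact (Submodule.Quotient.mk_eq_zero _).2 (ha2 g f w hw)
  · intro h
    refine hne (eq_bot_iff.2 fun w hw => ?_)
    rw [← h, ← aAct_one hA w]
    exact aAct_mem_map₂ hw 1

lemma vac_map₂_eq_top (hA : IsAssociative M) (hs : M.IsSimple) (hne : vac M lam ≠ ⊥) :
    Submodule.map₂ (aAct M) ⊤ (vac M lam) = ⊤ :=
  map₂_eq_top hA hs (vac_graded M lam) hne (fun i _ hw => ellOp_mem hA hw i)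
    (fun i _ hw => gamOp_mem hA hw i) (fun i x _ hw => chiOp_mem hA hw i x)
    (fun i x _ hw => etaOp_mem hA hw i x)

end Generation

/-! ### Freeness of `M` over `𝒜`, and the fibre `M / 𝔪 M`. -/

section TensorA

variable {W : Type*} [AddCommGroup W] [Module ℂ W]

/-- Grouping by the power of `t` prepares for `vacMap_injective`, where the `n`-th summand lands in
the `L₀`-eigenspace of `λ + n`. -/
lemma exists_sum_A_tmul (z : A ⊗[ℂ] W) : ∃ (s : Finset ℤ) (a b : ℤ → W),
    z = ∑ n ∈ s, (te n ⊗ₜ a n + tx n ⊗ₜ b n) := by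
  let T0 : (ℤ →₀ W) →ₗ[ℂ] A ⊗[ℂ] W := Finsupp.lsum ℂ fun n => TensorProduct.mk ℂ A W (te n)
  let T1 : (ℤ →₀ W) →ₗ[ℂ] A ⊗[ℂ] W := Finsupp.lsum ℂ fun n => TensorProduct.mk ℂ A W (tx n)
  suffices h : z ∈ LinearMap.range (T0.coprod T1) by
    obtain ⟨⟨a, b⟩, rfl⟩ := h
    refine ⟨a.support ∪ b.support, a, b, ?_⟩
    rw [Finset.sum_add_distrib, LinearMap.coprod_apply]
    refine congrArg₂ (· + ·) ?_ ?_
    · exact Finsupp.sum_of_support_subset a Finset.subset_union_left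
        (fun n w => te n ⊗ₜ w) (fun _ _ => TensorProduct.tmul_zero _ _)
    · exact Finsupp.sum_of_support_subset b Finset.subset_union_right
        (fun n w => tx n ⊗ₜ w) (fun _ _ => TensorProduct.tmul_zero _ _)
  induction z using TensorProduct.induction_on with
  | zero => exact Submodule.zero_mem _
  | add x y hx hy => exact Submodule.add_mem _ hx hy
  | tmul f w =>
    have key : (LinearMap.range (T0.coprod T1)).mkQ ∘ₗ (TensorProduct.mk ℂ A W).flip w = 0 := by
      refine A_linear_ext (fun i => ?_) (fun i => ?_)
      · refine (Submodule.Quotient.mk_eq_zero _).2 ⟨(Finsupp.single i w, 0), ?_⟩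
        simp [T0]
      · refine (Submodule.Quotient.mk_eq_zero _).2 ⟨(0, Finsupp.single i w), ?_⟩
        simp [T1]
    exact (Submodule.Quotient.mk_eq_zero _).1 (LinearMap.congr_fun key f)

end TensorA

lemma aug_te (i : ℤ) : aug (te i) = 1 := by
  simp [aug, te, evalOne, LaurentPolynomial.T, -LaurentPolynomial.single_eq_C_mul_T]

lemma aug_tx (i : ℤ) : aug (tx i) = 0 := aug_odd (tx_mem i)

section Vacuum

variable {𝔨 : Type v} [LieRing 𝔨] [LieAlgebra ℂ 𝔨] (M : LieSuperModule.{v, w} (Extended 𝔨))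
  (lam : ℂ)

/-- `f ⊗ v ↦ f v`, on `𝒜 ⊗ vac`. -/
def vacMap : A ⊗[ℂ] vac M lam →ₗ[ℂ] M.carrier :=
  TensorProduct.lift ((aAct M).compl₂ (vac M lam).subtype)

variable {M lam}

lemma vacMap_tmul (f : A) (v : vac M lam) : vacMap M lam (f ⊗ₜ v) = aAct M f v.1 := rfl

/-- After division by `tⁿ` the relation is `a + ξ b = 0`. Multiplying by `ξ` gives `ξ a = 0`, hence
`G₀ a = λ ξ a = 0` and so `G₀ (ξ b) = 0`. But `G₀ (ξ b) = -b` on `vac`, because `ξ G₀ b = λ ξ² b =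
0`. -/
lemma eq_zero_of_te_add_tx (hA : IsAssociative M) (n : ℤ) {a b : M.carrier} (ha : a ∈ vac M lam)
    (hb : b ∈ vac M lam) (h : aAct M (te n) a + aAct M (tx n) b = 0) : a = 0 ∧ b = 0 := by
  have h1 : a + aAct M (tx 0) b = 0 := by
    have h1 := congrArg (aAct M (te (-n))) h
    rw [(aAct M (te (-n))).map_add, (aAct M (te (-n))).map_zero] at h1
    have e1 : aAct M (te (-n)) (aAct M (te n) a) = a := by
      rw [aAct_mul hA, te_mul_te, neg_add_cancel, te_zero, aAct_one hA]
    have e2 : aAct M (te (-n)) (aAct M (tx n) b) = aAct M (tx 0) b := by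
      rw [aAct_mul hA, te_mul_tx, neg_add_cancel]
    exact (congrArg₂ (· + ·) e1 e2).symm.trans h1
  have hsq : ∀ v : M.carrier, aAct M (tx 0) (aAct M (tx 0) v) = 0 := fun v => by
    rw [aAct_mul hA, tx_mul_tx, (aAct M).map_zero, LinearMap.zero_apply]
  have hxa : aAct M (tx 0) a = 0 := by
    have h2 := congrArg (aAct M (tx 0)) h1
    rwa [(aAct M (tx 0)).map_add, (aAct M (tx 0)).map_zero, hsq, add_zero] at h2
  have h2 : gAct M 0 (aAct M (tx 0) b) = 0 := by
    have h2 := congrArg (gAct M 0) h1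
    rwa [(gAct M 0).map_add, (gAct M 0).map_zero, (mem_vac.1 ha).2, hxa, smul_zero, zero_add] at h2
  have hb0 : b = 0 := by
    rw [gAct_aAct, (mem_vac.1 hb).2, parityAut_tx, (aAct M).map_neg, LinearMap.neg_apply,
      (aAct M (tx 0)).map_smul, hsq, smul_zero, neg_zero, zero_add, sAct_G_tx, add_zero, te_zero,
      (aAct M).map_neg, LinearMap.neg_apply, aAct_one hA] at h2
    exact neg_eq_zero.1 h2
  rw [hb0, (aAct M (tx 0)).map_zero, add_zero] at h1
  exact ⟨h1, hb0⟩

/-- Eigenspaces of `L₀` for the distinct eigenvalues `λ + n` are independent, so a vanishing sum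
vanishes for each power of `t` separately. -/
lemma vacMap_injective (hA : IsAssociative M) : Function.Injective (vacMap M lam) := by
  rw [injective_iff_map_eq_zero]
  intro z hz
  obtain ⟨s, a, b, rfl⟩ := exists_sum_A_tmul z
  have hsum : ∑ n ∈ s, (aAct M (te n) (a n).1 + aAct M (tx n) (b n).1) = 0 := by
    refine Eq.trans ?_ hz
    rw [map_sum (vacMap M lam)]
    exact Finset.sum_congr rfl fun n _ =>
      ((vacMap M lam).map_add (te n ⊗ₜ a n) (tx n ⊗ₜ b n)).symm
  have hind : iSupIndep fun n : ℤ => Module.End.eigenspace (lAct M 0) (lam + n) :=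
    (Module.End.eigenspaces_iSupIndep (lAct M 0)).comp
      ((add_right_injective lam).comp Int.cast_injective)
  have h0 := (iSupIndep_iff_finsetSum_eq_zero_imp_eq_zero _).1 hind _ _ (fun n _ => by
    have h1 := lAct_zero_aAct_te n (mem_vac.1 (a n).2).1
    have h2 := lAct_zero_aAct_tx n (mem_vac.1 (b n).2).1
    rw [Module.End.mem_eigenspace_iff, (lAct M 0).map_add, h1, h2, smul_add]) hsum
  refine Finset.sum_eq_zero fun n hn => ?_
  obtain ⟨h1, h2⟩ := eq_zero_of_te_add_tx hA n (a n).2 (b n).2 (h0 n hn)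
  have h1 : a n = 0 := Subtype.ext h1
  have h2 : b n = 0 := Subtype.ext h2
  rw [h1, h2, TensorProduct.tmul_zero, TensorProduct.tmul_zero, add_zero]

lemma vacMap_bijective (hA : IsAssociative M) (hs : M.IsSimple) (hne : vac M lam ≠ ⊥) :
    Function.Bijective (vacMap M lam) := by
  refine ⟨vacMap_injective hA, LinearMap.range_eq_top.1 (eq_top_iff.2 ?_)⟩
  rw [← vac_map₂_eq_top hA hs hne]
  exact Submodule.map₂_le.2 fun f _ v hv => ⟨f ⊗ₜ ⟨v, hv⟩, rfl⟩

/-- The projection of `M = 𝒜 ⊗ vac` to `vac` with kernel `𝔪 M`. -/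
def vacProj (hb : Function.Bijective (vacMap M lam)) : M.carrier →ₗ[ℂ] vac M lam :=
  (TensorProduct.lid ℂ (vac M lam)).toLinearMap ∘ₗ LinearMap.rTensor (vac M lam) aug ∘ₗ
    (LinearEquiv.ofBijective (vacMap M lam) hb).symm.toLinearMap

variable (hb : Function.Bijective (vacMap M lam))

lemma vacProj_vacMap (z : A ⊗[ℂ] vac M lam) : vacProj hb (vacMap M lam z) =
    TensorProduct.lid ℂ (vac M lam) (LinearMap.rTensor (vac M lam) aug z) := by
  have h : (LinearEquiv.ofBijective (vacMap M lam) hb).symm (vacMap M lam z) = z :=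
    (LinearEquiv.ofBijective (vacMap M lam) hb).symm_apply_apply z
  simp only [vacProj, LinearMap.comp_apply, LinearEquiv.coe_coe, h]

lemma vacProj_aAct_coe (f : A) (v : vac M lam) : vacProj hb (aAct M f v.1) = aug f • v := by
  rw [← vacMap_tmul, vacProj_vacMap, LinearMap.rTensor_tmul, TensorProduct.lid_tmul]

lemma vacProj_coe (hA : IsAssociative M) {v : M.carrier} (hv : v ∈ vac M lam) :
    vacProj hb v = ⟨v, hv⟩ := by
  have h := vacProj_aAct_coe hb (te 0) ⟨v, hv⟩
  rwa [te_zero, aAct_one hA, ← te_zero, aug_te, one_smul] at h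

lemma vacMap_induction (hb : Function.Bijective (vacMap M lam)) {p : M.carrier → Prop}
    (h : ∀ f, ∀ v : vac M lam, p (aAct M f v.1))
    (hadd : ∀ m m', p m → p m' → p (m + m')) (m : M.carrier) : p m := by
  obtain ⟨z, rfl⟩ := hb.2 m
  induction z using TensorProduct.induction_on with
  | zero =>
    have := h 0 0
    rw [map_zero, LinearMap.zero_apply] at this
    rwa [map_zero]
  | add x y hx hy => rw [map_add]; exact hadd _ _ hx hy
  | tmul f v => exact h f v

lemma vacProj_aAct (hA : IsAssociative M) (f : A) (m : M.carrier) :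
    vacProj hb (aAct M f m) = aug f • vacProj hb m := by
  refine vacMap_induction hb (p := fun m => vacProj hb (aAct M f m) = aug f • vacProj hb m)
    (fun g v => ?_) (fun m m' h h' => ?_) m
  · rw [aAct_mul hA, vacProj_aAct_coe, vacProj_aAct_coe, aug_mul, mul_smul]
  · simp only [map_add, smul_add, h, h']

/-- The augmentation kills odd elements of `𝒜`, so only the even part of `f` contributes to the
projection of `f v`, and parities are preserved. -/
lemma vacProj_mem {i : ZMod 2} {m : M.carrier} (hm : m ∈ grade i) :
    (vacProj hb m).1 ∈ grade i := by
  have key : ∀ (j : ZMod 2) (m : M.carrier),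
      sproj j (vacProj hb m).1 = (vacProj hb (sproj j m)).1 := by
    intro j m
    refine vacMap_induction hb
      (p := fun m => sproj j (vacProj hb m).1 = (vacProj hb (sproj j m)).1)
      (fun f v => ?_) (fun m m' h h' => ?_) m
    · have hv : ∀ k, sproj k v.1 ∈ vac M lam := isGraded_iff.1 (vac_graded M lam) v.1 v.2
      have e : ∀ {k : ZMod 2} {g : A}, g ∈ grade k → sproj (j + k) (aAct M g v.1) =
        aAct M g (sproj j v.1) := fun hg => sproj_comm (fun i x hx => aAct_grade M hg i x hx) j v.1
      have e' : ∀ {k : ZMod 2} {g : A}, g ∈ grade k → sproj j (aAct M g v.1) =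
          aAct M g (sproj (j + k) v.1) := fun {k g} hg => by
        have := sproj_comm (fun i x hx => aAct_grade M hg i x hx) (j + k) v.1
        rwa [add_assoc, CharTwo.add_self_eq_zero, add_zero] at this
      have hf : aAct M f v.1 = aAct M (sproj 0 f) v.1 + aAct M (sproj 1 f) v.1 := by
        rw [← LinearMap.add_apply, ← map_add, sproj_add_sproj]
      have h0 := e' (sproj_mem 0 f)
      have h1 := e' (sproj_mem 1 f)
      have p0 := vacProj_aAct_coe hb (sproj 0 f) ⟨_, hv (j + 0)⟩
      have p1 := vacProj_aAct_coe hb (sproj 1 f) ⟨_, hv (j + 1)⟩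
      have q0 := vacProj_aAct_coe hb (sproj 0 f) v
      have q1 := vacProj_aAct_coe hb (sproj 1 f) v
      rw [hf, map_add, map_add, map_add, h0, h1, p0, p1, q0, q1, aug_odd (sproj_mem 1 f)]
      simp
    · simp only [map_add, Submodule.coe_add, h, h']
  rw [mem_grade_iff_sproj, key, mem_grade_iff_sproj.1 hm]

/-- In the Leibniz rule the term with `p · f` projects to zero since `p · f ∈ 𝔪`. The sign matters
only for odd `f`, where `aug f = 0` anyway. -/
lemma vacProj_act_aAct_of_mem (hA : IsAssociative M) {i j : ZMod 2} {p : Current 𝔨}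
    (hp : p ∈ (a0 𝔨).toSubmodule) (hpi : p ∈ grade i) {f : A} (hf : f ∈ grade j) (v : M.carrier) :
    vacProj hb (M.act (ofCur 𝔨 p) (aAct M f v)) =
      aug f • vacProj hb (M.act (ofCur 𝔨 p) v) := by
  have h0 : aug (sAct (toS 𝔨 p) f) = 0 := aug_sAct (show toS 𝔨 p ∈ ts.toSubmodule from hp) f
  rw [act_ofCur_aAct M hpi hf, (vacProj hb).map_add, (vacProj hb).map_smul, vacProj_aAct hb hA,
    vacProj_aAct hb hA, h0, zero_smul, add_zero]
  rcases parity_cases j with rfl | rfl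
  · rw [sgn_zero_right, one_smul]
  · rw [aug_odd hf, zero_smul, smul_zero]

lemma vacProj_act_add (p q : Current 𝔨) (v : M.carrier) :
    vacProj hb (M.act (ofCur 𝔨 (p + q)) v) =
      vacProj hb (M.act (ofCur 𝔨 p) v) + vacProj hb (M.act (ofCur 𝔨 q) v) := by
  rw [(ofCur 𝔨).map_add, M.act.map_add, LinearMap.add_apply, (vacProj hb).map_add]

lemma vacProj_act_aAct_of_mem_right (hA : IsAssociative M) {j : ZMod 2} {p : Current 𝔨}
    (hp : p ∈ (a0 𝔨).toSubmodule) {f : A} (hf : f ∈ grade j) (v : M.carrier) :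
    vacProj hb (M.act (ofCur 𝔨 p) (aAct M f v)) =
      aug f • vacProj hb (M.act (ofCur 𝔨 p) v) := by
  obtain ⟨q, hq, r, hr, rfl⟩ := Submodule.mem_sup.1 ((a0 𝔨).graded hp)
  rw [vacProj_act_add, vacProj_act_add, vacProj_act_aAct_of_mem hb hA hq.1 hq.2 hf,
    vacProj_act_aAct_of_mem hb hA hr.1 hr.2 hf, smul_add]

lemma vacProj_act_aAct (hA : IsAssociative M) {p : Current 𝔨} (hp : p ∈ (a0 𝔨).toSubmodule)
    (f : A) (v : M.carrier) : vacProj hb (M.act (ofCur 𝔨 p) (aAct M f v)) =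
      aug f • vacProj hb (M.act (ofCur 𝔨 p) v) := by
  have h : aAct M f v = aAct M (sproj 0 f) v + aAct M (sproj 1 f) v := by
    rw [← LinearMap.add_apply, ← (aAct M).map_add, sproj_add_sproj]
  have h' : aug f = aug (sproj 0 f) + aug (sproj 1 f) := by
    rw [← aug.map_add, sproj_add_sproj]
  rw [h, (M.act _).map_add, (vacProj hb).map_add,
    vacProj_act_aAct_of_mem_right hb hA hp (sproj_mem 0 f),
    vacProj_act_aAct_of_mem_right hb hA hp (sproj_mem 1 f), ← add_smul, ← h']

/-- `𝔞₀` preserves the kernel of `vacProj`. -/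
lemma vacProj_act (hA : IsAssociative M) {p : Current 𝔨} (hp : p ∈ (a0 𝔨).toSubmodule)
    (m : M.carrier) : vacProj hb (M.act (ofCur 𝔨 p) m) =
      vacProj hb (M.act (ofCur 𝔨 p) (vacProj hb m).1) := by
  refine vacMap_induction hb (p := fun m => vacProj hb (M.act (ofCur 𝔨 p) m) =
      vacProj hb (M.act (ofCur 𝔨 p) (vacProj hb m).1)) (fun f v => ?_) (fun m m' h h' => ?_) m
  · rw [vacProj_act_aAct hb hA hp, vacProj_aAct_coe, Submodule.coe_smul, (M.act _).map_smul,
      (vacProj hb).map_smul]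
  · rw [(M.act _).map_add, (vacProj hb).map_add, h, h', (vacProj hb).map_add, Submodule.coe_add,
      (M.act _).map_add, (vacProj hb).map_add]

/-- The `𝔞₀`-module `M / 𝔪 M`, realized on the space `vac`. -/
def vacModule (hA : IsAssociative M) : LieSuperModule.{v, w} (a0 𝔨).toSubmodule where
  carrier := vac M lam
  superSpace := subSuperSpace (vac M lam) (vac_graded M lam)
  act := LinearMap.mk₂ ℂ (fun y v => vacProj hb (M.act (ofCur 𝔨 y.1) v.1))
    (fun y y' v => by simp only [Submodule.coe_add, map_add, LinearMap.add_apply])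
    (fun c y v => by simp only [Submodule.coe_smul, map_smul, LinearMap.smul_apply])
    (fun y v v' => by simp only [Submodule.coe_add, map_add])
    (fun c y v => by simp only [Submodule.coe_smul, map_smul])
  act_mem := by
    intro i j y v hy hv
    exact vacProj_mem hb (M.act_mem (ofCur_mem hy) hv)
  act_br := by
    intro i j x y hx hy v
    have h := M.act_br (ofCur_mem (𝔨 := 𝔨) hx) (ofCur_mem hy) v.1
    rw [br_ofCur_ofCur] at h
    simp only [LinearMap.mk₂_apply]
    -- By `vacProj_act` the inner projections may be dropped, and the module axiom for the fibre is
    -- the projection of the one for `M`.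
    rw [← vacProj_act hb hA x.2, ← vacProj_act hb hA y.2, ← map_smul, ← map_sub]
    exact congrArg (vacProj hb) h

lemma vacModule_act_coe (hA : IsAssociative M) (y : (a0 𝔨).toSubmodule) (v : vac M lam) :
    (vacModule hb hA).act y v = vacProj hb (M.act (ofCur 𝔨 y.1) v.1) := rfl

/-- The projection sends `tⁱ` to `1` and `tⁱ ξ` to `0` in `lAct_eq`; the term `λ v` that is left
cancels against `L₀ v`. -/
lemma vacModule_act_a0L (hA : IsAssociative M) (i : ℤ) (v : vac M lam) :
    (vacModule hb hA).act (a0L 𝔨 i) v = (⟨ellOp M lam i v.1, ellOp_mem hA v.2 i⟩ : vac M lam) := by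
  have e : ofCur 𝔨 (a0L 𝔨 i).1 = Extended.ofS (L i) - Extended.ofS (L 0) := by
    have : (a0L 𝔨 i).1 = curS 𝔨 (L i - L 0) := rfl
    rw [this, map_sub, map_sub]; rfl
  have h : M.act (ofCur 𝔨 (a0L 𝔨 i).1) v.1 = lAct M i v.1 - lAct M 0 v.1 := by
    rw [e, map_sub]; rfl
  rw [vacModule_act_coe, h, lAct_eq lam hA i, (mem_vac.1 v.2).1]
  simp only [map_sub, map_add, map_smul, vacProj_aAct hb hA, aug_te, aug_tx,
    vacProj_coe hb hA v.2, vacProj_coe hb hA (ellOp_mem hA v.2 i), zero_smul, smul_zero, one_smul]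
  abel

/-- Here the `λ`-term and `G₀ v` are multiples of `ξ` and disappear under the projection. -/
lemma vacModule_act_a0G (hA : IsAssociative M) (i : ℤ) (v : vac M lam) :
    (vacModule hb hA).act (a0G 𝔨 i) v = (⟨gamOp M lam i v.1, gamOp_mem hA v.2 i⟩ : vac M lam) := by
  have e : ofCur 𝔨 (a0G 𝔨 i).1 = Extended.ofS (G i) - Extended.ofS (G 0) := by
    have : (a0G 𝔨 i).1 = curS 𝔨 (G i - G 0) := rfl
    rw [this, map_sub, map_sub]; rfl
  have h : M.act (ofCur 𝔨 (a0G 𝔨 i).1) v.1 = gAct M i v.1 - gAct M 0 v.1 := by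
    rw [e, map_sub]; rfl
  rw [vacModule_act_coe, h, gAct_eq lam hA i, (mem_vac.1 v.2).2]
  simp only [map_sub, map_add, map_smul, vacProj_aAct hb hA, aug_te, aug_tx,
    vacProj_coe hb hA (gamOp_mem hA v.2 i), zero_smul, smul_zero, one_smul, add_zero, sub_zero]
  rfl

lemma vacModule_act_X (hA : IsAssociative M) (i : ℤ) (x : PureEven 𝔨) (v : vac M lam) :
    (vacModule hb hA).act (a0Loop (te i ⊗ₜ x)) v =
      (⟨chiOp M i x v.1, chiOp_mem hA v.2 i x⟩ : vac M lam) := by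
  have h : M.act (ofCur 𝔨 (a0Loop (te i ⊗ₜ x)).1) v.1 = xAct M i x v.1 := rfl
  rw [vacModule_act_coe, h, xAct_eq hA i x]
  simp only [map_sub, map_smul, vacProj_aAct hb hA, aug_te, aug_tx,
    vacProj_coe hb hA (chiOp_mem hA v.2 i x), zero_smul, smul_zero, one_smul, sub_zero]
  rfl

lemma vacModule_act_Y (hA : IsAssociative M) (i : ℤ) (x : PureEven 𝔨) (v : vac M lam) :
    (vacModule hb hA).act (a0Loop (tx i ⊗ₜ x)) v =
      (⟨etaOp M i x v.1, etaOp_mem hA v.2 i x⟩ : vac M lam) := by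
  have h : M.act (ofCur 𝔨 (a0Loop (tx i ⊗ₜ x)).1) v.1 = yAct M i x v.1 := rfl
  rw [vacModule_act_coe, h, yAct_eq hA i x]
  simp only [map_add, vacProj_aAct hb hA, aug_te, aug_tx,
    vacProj_coe hb hA (etaOp_mem hA v.2 i x), zero_smul, one_smul, zero_add]
  rfl

end Vacuum

/-! ### Simplicity of the fibre and the isomorphism with the tensor module. -/

section Structure

variable {𝔨 : Type v} [LieRing 𝔨] [LieAlgebra ℂ 𝔨] {M : LieSuperModule.{v, w} (Extended 𝔨)}
  {lam : ℂ}

/-- The inclusion of the `𝔞₀`-module on `vac` in `M`. -/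
def vacIncl (hb : Function.Bijective (vacMap M lam)) (hA : IsAssociative M) :
    (vacModule hb hA).carrier →ₗ[ℂ] M.carrier := (vac M lam).subtype

variable (hb : Function.Bijective (vacMap M lam))

lemma vacIncl_mem (hA : IsAssociative M) (i : ZMod 2) (v : (vacModule hb hA).carrier)
    (hv : v ∈ grade i) : vacIncl hb hA v ∈ grade i := hv

lemma vacIncl_act_a0L (hA : IsAssociative M) (i : ℤ) (v : (vacModule hb hA).carrier) :
    vacIncl hb hA ((vacModule hb hA).act (a0L 𝔨 i) v) = ellOp M lam i (vacIncl hb hA v) :=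
  congrArg Subtype.val (vacModule_act_a0L hb hA i v)

lemma vacIncl_act_a0G (hA : IsAssociative M) (i : ℤ) (v : (vacModule hb hA).carrier) :
    vacIncl hb hA ((vacModule hb hA).act (a0G 𝔨 i) v) = gamOp M lam i (vacIncl hb hA v) :=
  congrArg Subtype.val (vacModule_act_a0G hb hA i v)

lemma vacIncl_act_X (hA : IsAssociative M) (i : ℤ) (x : PureEven 𝔨)
    (v : (vacModule hb hA).carrier) :
    vacIncl hb hA ((vacModule hb hA).act (a0Loop (te i ⊗ₜ x)) v) =
      chiOp M i x (vacIncl hb hA v) :=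
  congrArg Subtype.val (vacModule_act_X hb hA i x v)

lemma vacIncl_act_Y (hA : IsAssociative M) (i : ℤ) (x : PureEven 𝔨)
    (v : (vacModule hb hA).carrier) :
    vacIncl hb hA ((vacModule hb hA).act (a0Loop (tx i ⊗ₜ x)) v) =
      etaOp M i x (vacIncl hb hA v) :=
  congrArg Subtype.val (vacModule_act_Y hb hA i x v)

/-- A nonzero graded `𝔞₀`-submodule `W` is stable under the four families, so `𝒜 W = M` by
`map₂_eq_top`. The projection to the fibre maps `𝒜 W` into `W` and is the identity on `vac`, whence
`W` is everything. -/
lemma vacModule_isSimple (hA : IsAssociative M) (hs : M.IsSimple) (hne : vac M lam ≠ ⊥) :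
    (vacModule hb hA).IsSimple := by
  refine ⟨Submodule.nontrivial_iff_ne_bot.2 hne, fun W hW hinv => or_iff_not_imp_left.2 ?_⟩
  intro hW0
  have hgr : IsGraded (W.map (vacIncl hb hA)) := by
    intro m hm
    obtain ⟨w, hw, rfl⟩ := Submodule.mem_map.1 hm
    obtain ⟨a, ha, c, hc, rfl⟩ := Submodule.mem_sup.1 (hW hw)
    rw [(vacIncl hb hA).map_add]
    exact Submodule.add_mem_sup
      ⟨Submodule.mem_map_of_mem ha.1, vacIncl_mem hb hA 0 a ha.2⟩
      ⟨Submodule.mem_map_of_mem hc.1, vacIncl_mem hb hA 1 c hc.2⟩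
  have hbot : W.map (vacIncl hb hA) ≠ ⊥ := by
    intro h
    refine hW0 ((Submodule.eq_bot_iff _).2 fun w hw => ?_)
    have h1 : vacIncl hb hA w ∈ (⊥ : Submodule ℂ M.carrier) := h ▸ Submodule.mem_map_of_mem hw
    exact Subtype.ext ((Submodule.mem_bot ℂ).1 h1)
  have htop : Submodule.map₂ (aAct M) ⊤ (W.map (vacIncl hb hA)) = ⊤ := by
    refine map₂_eq_top (lam := lam) hA hs hgr hbot ?_ ?_ ?_ ?_
    · rintro i _ ⟨w, hw, rfl⟩
      exact vacIncl_act_a0L hb hA i w ▸ Submodule.mem_map_of_mem (hinv _ _ hw)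
    · rintro i _ ⟨w, hw, rfl⟩
      exact vacIncl_act_a0G hb hA i w ▸ Submodule.mem_map_of_mem (hinv _ _ hw)
    · rintro i x _ ⟨w, hw, rfl⟩
      exact vacIncl_act_X hb hA i x w ▸ Submodule.mem_map_of_mem (hinv _ _ hw)
    · rintro i x _ ⟨w, hw, rfl⟩
      exact vacIncl_act_Y hb hA i x w ▸ Submodule.mem_map_of_mem (hinv _ _ hw)
  -- The same map as `vacProj hb`, typed with the carrier of the module so that `W` can be pulled
  -- back along it.
  let q : M.carrier →ₗ[ℂ] (vacModule hb hA).carrier := vacProj hb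
  have hproj : Submodule.map₂ (aAct M) ⊤ (W.map (vacIncl hb hA)) ≤
      Submodule.comap q W := by
    refine Submodule.map₂_le.2 ?_
    rintro f - _ ⟨w, hw, rfl⟩
    have h : q (aAct M f (vacIncl hb hA w)) = aug f • w := vacProj_aAct_coe hb f w
    rw [Submodule.mem_comap, h]
    exact Submodule.smul_mem W (aug f) hw
  refine (Submodule.eq_top_iff' (p := W)).2 fun v => ?_
  have h1 : vacIncl hb hA v ∈ Submodule.comap q W :=
    hproj (htop ▸ Submodule.mem_top)
  have h2 : q (vacIncl hb hA v) = v := vacProj_coe hb hA v.2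
  rwa [Submodule.mem_comap, h2] at h1

lemma iso_gamma_vacModule (hA : IsAssociative M) :
    IsoGammaUpToParity M lam (vacModule hb hA) := by
  have hb' : Function.Bijective (aLift (vacIncl hb hA)) := hb
  have hact : ∀ (x : Extended 𝔨) (z : A ⊗[ℂ] (vacModule hb hA).carrier),
      M.act x (aLift (vacIncl hb hA) z) =
        aLift (vacIncl hb hA) (gammaAct lam (vacModule hb hA) x z) := by
    refine act_aLift _ hA (fun i v => ?_) (fun i v => ?_) (fun i x v => ?_) (fun i x v => ?_)
    · rw [vacIncl_act_a0L, vacIncl_act_a0G]; exact lAct_eq lam hA i _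
    · rw [vacIncl_act_a0L, vacIncl_act_a0G]; exact gAct_eq lam hA i _
    · rw [vacIncl_act_X, vacIncl_act_Y]; exact xAct_eq hA i x _
    · rw [vacIncl_act_X, vacIncl_act_Y]; exact yAct_eq hA i x _
  let e := LinearEquiv.ofBijective (aLift (vacIncl hb hA)) hb'
  have he : ∀ m, aLift (vacIncl hb hA) (e.symm m) = m := fun m => e.apply_symm_apply m
  -- The space `vac` carries the parity inherited from `M`, so the isomorphism is even and no
  -- exchange of parities occurs.
  refine ⟨e.symm, ⟨0, fun i m hm => ?_⟩, fun x m => ?_⟩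
  -- An even bijection commutes with the parity projections, so its inverse is even as well.
  · have h := sproj_comm (T := aLift (vacIncl hb hA)) (j := 0)
      (fun i z hz => by rw [add_zero]; exact aLift_mem _ (vacIncl_mem hb hA) i z hz) i (e.symm m)
    rw [add_zero, he, mem_grade_iff_sproj.1 hm] at h
    rw [add_zero, mem_grade_iff_sproj]
    exact hb'.1 (h.symm.trans (he m).symm)
  · refine hb'.1 ?_
    rw [he, ← hact, he]

lemma IsCuspidal.exists_vac_ne_bot (hA : IsAssociative M) (hs : M.IsSimple) (hc : IsCuspidal M) :
    ∃ lam : ℂ, vac M lam ≠ ⊥ := by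
  have : Nontrivial M.carrier := hs.1
  obtain ⟨lam, hlam⟩ : ∃ lam, weightSpace M lam ≠ ⊥ := by
    by_contra! h
    have h1 := hc.1
    rw [IsWeight, iSup_congr h, iSup_bot] at h1
    exact bot_ne_top h1
  obtain ⟨v, hv, hv0⟩ := Submodule.exists_mem_ne_zero_of_ne_bot hlam
  obtain ⟨u, hu, hu0⟩ := exists_ne_zero_mem_vac hA hv0 (Module.End.mem_eigenspace_iff.1 hv)
  exact ⟨lam, (Submodule.ne_bot_iff _).2 ⟨u, hu, hu0⟩⟩

/-- By its first defining equation `vac` lies in the weight space of `lam`, whose dimension is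
bounded. -/
lemma IsCuspidal.finiteDimensional_vac (hc : IsCuspidal M) (lam : ℂ) :
    FiniteDimensional ℂ (vac M lam) := by
  obtain ⟨N, hN⟩ := hc.2
  have h1 : FiniteDimensional ℂ (weightSpace M lam) :=
    Module.rank_lt_aleph0_iff.1 ((hN lam).trans_lt Cardinal.natCast_lt_aleph0)
  exact Submodule.finiteDimensional_of_le (S₂ := weightSpace M lam) fun v hv =>
    Module.End.mem_eigenspace_iff.2 (mem_vac.1 hv).1

end Structure

end Ramond
end

theorem theorem4p13 {𝔨 : Type v} [LieRing 𝔨] [LieAlgebra ℂ 𝔨] [FiniteDimensional ℂ 𝔨]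
    [LieAlgebra.IsSimple ℂ 𝔨] (M : LieSuperModule.{v, w} (Ramond.Extended 𝔨))
    (hA : Ramond.IsAssociative M) (hs : M.IsSimple) (hc : Ramond.IsCuspidal M) :
    ∃ (lam : ℂ) (V : LieSuperModule.{v, w} (Ramond.RSemi 𝔨)),
      FiniteDimensional ℂ V.carrier ∧ V.IsSimple ∧
        Ramond.IsoGammaUpToParity M lam (V.pullback (Ramond.a0ToRSemi 𝔨)) := by
  obtain ⟨lam, hne⟩ := hc.exists_vac_ne_bot hA hs
  have hb := Ramond.vacMap_bijective hA hs hne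
  have hfin : FiniteDimensional ℂ (Ramond.vacModule hb hA).carrier := hc.finiteDimensional_vac lam
  have hsimple := Ramond.vacModule_isSimple hb hA hs hne
  obtain ⟨N, hN⟩ := LieSuperModule.exists_pullback_eq (Ramond.a0ToRSemi 𝔨)
    Ramond.a0ToRSemi_surjective (Ramond.vacModule hb hA)
    fun y hy => Ramond.act_eq_zero_of_a0ToRSemi hsimple y hy
  -- Replaces the fibre by the pullback of `N`, so that finite dimension and simplicity pass to `N`.
  rw [← hN] at hfin hsimple
  refine ⟨lam, N, hfin, LieSuperModule.isSimple_of_pullback _ N hsimple, ?_⟩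
  rw [hN]
  exact Ramond.iso_gamma_vacModule hb hA
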